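/- Let $k$ be an algebraically closed field of characteristic zero and $\mathbb P^2=\mathbb P(k^3)$, with coordinates $X=(X_0,X_1,X_2)$. For seven distinct points $P_1,\dots,P_7\in\mathbb P^2$ not on a conic, and a matrix $\begin{pmatrix}L_0&L_1&L_2\\ \theta_0&\theta_1&\theta_2\end{pmatrix}$ of linear forms $L_j$ and quadratic forms $\theta_j$ in $X$ whose maximal minors generate the homogeneous ideal of $\{P_1,\dots,P_7\}$, put $$S(\xi,X)=\det\begin{pmatrix}L_0(\xi)&L_1(\xi)&L_2(\xi)\\ L_0(X)&L_1(X)&L_2(X)\\ \theta_0(X)&\theta_1(X)&\theta_2(X)\end{pmatrix}.$$ Up to nonzero constants, the coefficients of $S(\xi,X)$ can be expressed as polynomials in the coordinates of the points, multihomogeneous of degree $5$ in each $P_i$. With $S$ so expressed, let $F(P_1,\dots,P_7)$ be the pfaffian of the $6\times 6$ skew-symmetric matrix of coefficients of the biquadratic form $M(\xi,X)=\sum_j\xi_j\,\partial S(\xi,X)/\partial X_j$. For six points put $\mathcal Q(p_1,\dots,p_6)=|134||156||235||246|-|135||146||234||256|$, where $|ijk|$ is the determinant of the coordinates of $p_i,p_j,p_k$.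 The Morley invariant is the polynomial $\Psi$, determined up to a nonzero constant, such that $$F(P_1,\dots,P_7)=\Psi(P_1,\dots,P_7)\prod_{i=1}^7\mathcal Q(P_1,\dots,\widehat{P_i},\dots,P_7).$$ Let $\mathcal W$ be the image in the symmetric product $(\mathbb P^2)^{(7)}$ of $V(\Psi)=\{\Psi=0\}\subset(\mathbb P^2)^7$. Then such a polynomial $\Psi$ exists, $\Psi$ is irreducible, and $\mathcal W\subset(\mathbb P^2)^{(7)}$ is irreducible. Moreover, let $\theta=\sum A_{ij}X_iX_j$ be a nonsingular conic, with dual $\theta^*=\sum a_{ij}\partial_i\partial_j$, where $(a_{ij})$ is the adjugate of the symmetric matrix $(A_{ij})$. Then for six general points $P_1,\dots,P_6\in\theta$ the cubic $E_{P_1,\dots,P_6}$ with equation $\Psi(P_1,\dots,P_6,X)=0$ is irreducible, and it is the unique cubic through $P_1,\dots,P_6$ that is apolar to $\theta$, i.e. such that $\theta^*$, acting as a differential operator, annihilates its equation. -/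

import Mathlib

open MvPolynomial
open scoped LinearAlgebra.Projectivization

noncomputable section

namespace Morley

/-- A polynomial in the coordinates of points `P_i` (`i : ι`) of the plane is multihomogeneous of
multidegree `d` if it is homogeneous of degree `d i` in the coordinates of each `P_i`. -/
def IsMultihomogeneous {ι R : Type*} [DecidableEq ι] [CommSemiring R]
    (G : MvPolynomial (ι × Fin 3) R) (d : ι → ℕ) : Prop :=
  ∀ i, IsWeightedHomogeneous (fun a : ι × Fin 3 => if a.1 = i then 1 else 0) G (d i)

/-! ### Seven points and the Hilbert–Burch matrix -/

/-- The homogeneous ideal in `k[X₀, X₁, X₂]` of the points of the plane with coordinate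
vectors `p i`: all polynomials that vanish on the affine cone over the points. -/
def pointsIdeal {k : Type*} [Field k] {n : ℕ} (p : Fin n → Fin 3 → k) :
    Ideal (MvPolynomial (Fin 3) k) :=
  vanishingIdeal k {v | ∃ (i : Fin n) (t : k), v = t • p i}

/-- The vectors `p i` are nonzero and pairwise not proportional. -/
def DistinctPoints {k : Type*} [Field k] {n : ℕ} (p : Fin n → Fin 3 → k) : Prop :=
  (∀ i, p i ≠ 0) ∧ ∀ i j, i ≠ j → LinearIndependent k ![p i, p j]

/-- The points `p i` lie on a conic (possibly singular). -/
def OnConic {k : Type*} [Field k] {n : ℕ} (p : Fin n → Fin 3 → k) : Prop :=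
  ∃ C : MvPolynomial (Fin 3) k, C ≠ 0 ∧ C.IsHomogeneous 2 ∧ ∀ i, eval (p i) C = 0

/-- The `2 × 3` matrix with rows `L₀, L₁, L₂` (linear forms) and `θ₀, θ₁, θ₂` (quadratic forms)
has maximal minors generating the homogeneous ideal of the points `p i`. -/
def IsHilbertBurchMatrix {k : Type*} [Field k] {n : ℕ} (p : Fin n → Fin 3 → k)
    (L θ : Fin 3 → MvPolynomial (Fin 3) k) : Prop :=
  (∀ j, (L j).IsHomogeneous 1) ∧ (∀ j, (θ j).IsHomogeneous 2) ∧
    Ideal.span {L 1 * θ 2 - L 2 * θ 1, L 2 * θ 0 - L 0 * θ 2, L 0 * θ 1 - L 1 * θ 0} =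
      pointsIdeal p

/-! ### The form `S(ξ, X)`

Forms in `ξ = (ξ₀, ξ₁, ξ₂)` and `X = (X₀, X₁, X₂)` are polynomials in variables indexed by
`Fin 3 ⊕ Fin 3`; the left summand stands for `ξ` and the right one for `X`. -/

/-- The determinant with rows `L(ξ)`, `L(X)`, `θ(X)`. -/
def detForm {k : Type*} [CommRing k] (L θ : Fin 3 → MvPolynomial (Fin 3) k) :
    MvPolynomial (Fin 3 ⊕ Fin 3) k :=
  Matrix.det (Matrix.of ![fun j => rename Sum.inl (L j), fun j => rename Sum.inr (L j),
    fun j => rename Sum.inr (θ j)])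

/-- The ring of polynomials in the coordinates `x_{ij}` of seven points of the plane. -/
abbrev CoordRing (k : Type*) [CommSemiring k] : Type _ := MvPolynomial (Fin 7 × Fin 3) k

/-- `S` is the form `S(ξ, X)` of seven points, with coefficients expressed as polynomials in the
coordinates of the points, multihomogeneous of degree `5` in each point: for seven distinct points
not on a conic it is, up to a nonzero constant, the determinant `detForm L θ` obtained from any
Hilbert–Burch matrix of the points. -/
def IsUniversalS {k : Type*} [Field k] (S : MvPolynomial (Fin 3 ⊕ Fin 3) (CoordRing k)) : Prop :=
  (∀ m, IsMultihomogeneous (coeff m S) fun _ => 5) ∧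
    ∀ p : Fin 7 → Fin 3 → k, DistinctPoints p → ¬ OnConic p →
      ∀ L θ : Fin 3 → MvPolynomial (Fin 3) k, IsHilbertBurchMatrix p L θ →
        ∃ c : k, c ≠ 0 ∧ map (eval fun a : Fin 7 × Fin 3 => p a.1 a.2) S = C c * detForm L θ

/-! ### The Morley form, its pfaffian and the Morley invariant -/

/-- The Morley form `M(ξ, X) = Δ_ξ S(ξ, X) = ∑ⱼ ξⱼ ∂S/∂Xⱼ`. -/
def morleyForm {R : Type*} [CommRing R] (S : MvPolynomial (Fin 3 ⊕ Fin 3) R) :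
    MvPolynomial (Fin 3 ⊕ Fin 3) R :=
  ∑ j : Fin 3, X (Sum.inl j) * pderiv (Sum.inr j) S

/-- The six quadratic monomials in three variables, as pairs of indices. -/
def quadIndex : Fin 6 → Fin 3 × Fin 3 :=
  ![(0, 0), (1, 1), (2, 2), (0, 1), (0, 2), (1, 2)]

/-- The `6 × 6` matrix of coefficients of a biquadratic form in `ξ, X`. -/
def coeffMatrix {R : Type*} [CommRing R] (M : MvPolynomial (Fin 3 ⊕ Fin 3) R) :
    Matrix (Fin 6) (Fin 6) R :=
  Matrix.of fun h k => coeff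
    (Finsupp.single (Sum.inl (quadIndex h).1) 1 + Finsupp.single (Sum.inl (quadIndex h).2) 1 +
      Finsupp.single (Sum.inr (quadIndex k).1) 1 + Finsupp.single (Sum.inr (quadIndex k).2) 1) M

/-- The pfaffian of the `4 × 4` skew-symmetric submatrix with indices `a, b, c, d`. -/
def pfaffian4 {R : Type*} [CommRing R] (m : Matrix (Fin 6) (Fin 6) R) (a b c d : Fin 6) : R :=
  m a b * m c d - m a c * m b d + m a d * m b c

/-- The pfaffian of a `6 × 6` skew-symmetric matrix, by expansion along the first row. -/
def pfaffian6 {R : Type*} [CommRing R] (m : Matrix (Fin 6) (Fin 6) R) : R :=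
  m 0 1 * pfaffian4 m 2 3 4 5 - m 0 2 * pfaffian4 m 1 3 4 5 + m 0 3 * pfaffian4 m 1 2 4 5 -
    m 0 4 * pfaffian4 m 1 2 3 5 + m 0 5 * pfaffian4 m 1 2 3 4

/-- The bracket `|P Q R|`. -/
def bracket {R : Type*} [CommRing R] (u v w : Fin 3 → R) : R :=
  Matrix.det (Matrix.of ![u, v, w])

/-- The invariant `|134||156||235||246| - |135||146||234||256|` of six points, which vanishes
if and only if they are on a conic (the points are numbered from `0` in the code). -/
def conicInvariant {R : Type*} [CommRing R] (p : Fin 6 → Fin 3 → R) : R :=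
  bracket (p 0) (p 2) (p 3) * bracket (p 0) (p 4) (p 5) *
      bracket (p 1) (p 2) (p 4) * bracket (p 1) (p 3) (p 5) -
    bracket (p 0) (p 2) (p 4) * bracket (p 0) (p 3) (p 5) *
      bracket (p 1) (p 2) (p 3) * bracket (p 1) (p 4) (p 5)

/-- The generic seven points, `P_i = (x_{i0}, x_{i1}, x_{i2})`. -/
def genericPoint (k : Type*) [CommRing k] (i : Fin 7) (j : Fin 3) : CoordRing k := X (i, j)

/-- `Ψ` is the Morley invariant of seven points: the quotient of the pfaffian `F(P₁, …, P₇)` of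
the Morley form by the product of the seven conic invariants of the points with one of them
omitted. It is well defined up to a nonzero constant, as `S(ξ, X)` is. -/
def IsMorleyInvariant {k : Type*} [Field k] (Ψ : CoordRing k) : Prop :=
  ∃ S : MvPolynomial (Fin 3 ⊕ Fin 3) (CoordRing k), IsUniversalS S ∧
    pfaffian6 (coeffMatrix (morleyForm S)) =
      Ψ * ∏ i : Fin 7, conicInvariant fun l : Fin 6 => genericPoint k (i.succAbove l)

/-! ### Products and the symmetric product of the plane, with their Zariski topologies -/

/-- The set of `n`-tuples of points of the projective plane. A separate type, because the Zariski
topology on it is not the product topology. -/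
def PlanePower (k : Type*) [Field k] (n : ℕ) : Type _ := Fin n → ℙ k (Fin 3 → k)

/-- Homogeneous coordinates of the points of an `n`-tuple. -/
def PlanePower.coords {k : Type*} [Field k] {n : ℕ} (Z : PlanePower k n) (i : Fin n) : Fin 3 → k :=
  Projectivization.rep (Z i)

/-- The zero locus in `(ℙ²)ⁿ` of a (multihomogeneous) polynomial. -/
def multiZeroLocus {k : Type*} [Field k] {n : ℕ} (G : MvPolynomial (Fin n × Fin 3) k) :
    Set (PlanePower k n) :=
  {Z | eval (fun a : Fin n × Fin 3 => Z.coords a.1 a.2) G = 0}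

/-- The Zariski topology on `(ℙ²)ⁿ`: the complements of the zero loci of multihomogeneous
polynomials are a basis of it. -/
instance PlanePower.zariski (k : Type*) [Field k] (n : ℕ) : TopologicalSpace (PlanePower k n) :=
  TopologicalSpace.generateFrom
    {U | ∃ (G : MvPolynomial (Fin n × Fin 3) k) (d : Fin n → ℕ),
      IsMultihomogeneous G d ∧ U = (multiZeroLocus G)ᶜ}

/-- The symmetric product `(ℙ²)⁽ⁿ⁾`, the set of unordered `n`-tuples of points. -/
def PlaneSym (k : Type*) [Field k] (n : ℕ) : Type _ := Sym (ℙ k (Fin 3 → k)) n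

/-- The quotient map `(ℙ²)ⁿ → (ℙ²)⁽ⁿ⁾`. -/
def toSym {k : Type*} [Field k] {n : ℕ} (Z : PlanePower k n) : PlaneSym k n :=
  ⟨Finset.univ.val.map (fun i : Fin n => Z i), by simp⟩

/-- The Zariski topology of the quotient variety `(ℙ²)⁽ⁿ⁾ = (ℙ²)ⁿ / Sₙ`: the quotient topology. -/
instance PlaneSym.zariski (k : Type*) [Field k] (n : ℕ) : TopologicalSpace (PlaneSym k n) :=
  TopologicalSpace.coinduced (toSym (k := k) (n := n)) (PlanePower.zariski k n)

/-- The image `𝒲` in `(ℙ²)⁽⁷⁾` of the hypersurface `V(Ψ)` of `(ℙ²)⁷`. -/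
def hypersurfaceW {k : Type*} [Field k] (Ψ : CoordRing k) : Set (PlaneSym k 7) :=
  toSym '' multiZeroLocus Ψ

/-! ### The cubic of the seventh point, and apolarity -/

/-- The polynomial `Ψ(P₁, …, P₆, X)`, defining the cubic `E_{P₁, …, P₆}`. -/
def seventhPointCubic {k : Type*} [Field k] (Ψ : CoordRing k) (p : Fin 6 → Fin 3 → k) :
    MvPolynomial (Fin 3) k :=
  aeval (fun a : Fin 7 × Fin 3 =>
    Fin.lastCases (motive := fun _ => MvPolynomial (Fin 3) k) (X a.2) (fun i => C (p i a.2)) a.1) Ψ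

/-- The conic `θ = ∑ A_{ij} X_i X_j`. -/
def conicForm {k : Type*} [Field k] (A : Matrix (Fin 3) (Fin 3) k) : MvPolynomial (Fin 3) k :=
  ∑ i, ∑ j, C (A i j) * X i * X j

/-- `P_{θ*}(D) = ∑ a_{ij} ∂_i ∂_j D`, where the dual conic `θ* = ∑ a_{ij} ∂_i ∂_j` of
`θ = ∑ A_{ij} X_i X_j` (defined up to a nonzero constant) has the adjugate of `A` as its matrix. -/
def dualConicApply {k : Type*} [Field k] (A : Matrix (Fin 3) (Fin 3) k)
    (D : MvPolynomial (Fin 3) k) : MvPolynomial (Fin 3) k :=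
  ∑ i, ∑ j, C (A.adjugate i j) * pderiv i (pderiv j D)

/-- The cubic forms (with zero) that vanish at the points `p i` and are apolar to the nonsingular
conic with matrix `A`. -/
def apolarCubicsThrough {k : Type*} [Field k] {n : ℕ} (A : Matrix (Fin 3) (Fin 3) k)
    (p : Fin n → Fin 3 → k) : Set (MvPolynomial (Fin 3) k) :=
  {D | D.IsHomogeneous 3 ∧ (∀ i, eval (p i) D = 0) ∧ dualConicApply A D = 0}

/-- A property holds for six general points on the conic with matrix `A`: it holds for all
six-tuples in a Zariski open subset of `(ℙ²)⁶` that meets `θ⁶`. -/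
def ForGeneralSixOn {k : Type*} [Field k] (A : Matrix (Fin 3) (Fin 3) k)
    (Q : PlanePower k 6 → Prop) : Prop :=
  ∃ U : Set (PlanePower k 6), IsOpen U ∧
    (∃ Z ∈ U, ∀ i, eval (Z.coords i) (conicForm A) = 0) ∧
    ∀ Z ∈ U, (∀ i, eval (Z.coords i) (conicForm A) = 0) → Q Z

end Morley

end

open MvPolynomial
open scoped LinearAlgebra.Projectivization

noncomputable section

namespace Morley

/-! ### Weighted homogeneous polynomials -/

section Weighted

variable {σ τ R : Type*}

/-! The proof identifies Ψ, up to a constant, with an explicit linear form in the 7 × 7 minors of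
the 7 × 10 matrix `W` of cubic monomials of the seven points.

Vector fields. For a quadratic vector field Q put S(ξ, X) = det(ξ, X, Q(X)); its coefficients in ξ
are the three cubics of X × Q. The pfaffian of the associated Morley form is minus the alternating
invariant (abc)³ of these cubics, suitably scaled (`pfaffian6_fieldForm`). This invariant
(`netInvariant`) is linear in the 3 × 3 minors of the coefficients. If three independent cubics pass
through seven points that impose independent conditions, their minors are proportional to the
complementary minors of `W` (`dualInvariant_mul_det`), and the invariant becomes a form
`dualInvariant` in `W`. This form is `explicitPsi`, of degree 3 in each point.

The universal S. The conditions Q(P_i) = λ_i P_i, with Q taken modulo multiples of X, are 21 linear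
equations in 15 + 7 unknowns. Their signed maximal minors give a solution of degree 3·2 - 1 = 5 in
each point. Every Hilbert–Burch matrix leads to the same solution up to a constant, because the
linear syzygies of its minors are the multiples of its first row (`universalField_eq_detForm`).
Conversely, on a nonempty open set the row X and the universal field form a Hilbert–Burch matrix
(`isHilbertBurchMatrix_of_sylvester`), so any admissible S is proportional to the universal one.

Factorization. If the six points other than P_i lie on a conic C, the field C(X) P_i is a solution
whose three cubics are dependent, so the pfaffian vanishes; hence each of the seven prime conic
invariants divides it. The prime `explicitPsi` divides the pfaffian times one 7 × 7 minor of `W`,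
and not that minor, as the Fano plane shows. The degrees 21 + 7·12 = 105 = 3·35 leave only a
constant (`exists_netInvariantS_eq`).

Points on a conic θ. For cubics θl, θm, c the invariant is twice the pairing of θ*(c) with l × m,
and θ*(θl) = 10 det(A) l. It follows that Ψ does not vanish at seven distinct points of θ, that
Ψ(P₁, …, P₆, X) is apolar to θ, and that an apolar cubic with seven zeros on θ is zero, which gives
uniqueness. If the cubic is reducible, a line in it contains two of the points, so the cubic is
tangent to their join (or singular) there. If this happened for all choices of points, the cubic
would be singular at all six, and its restriction to θ, of degree at most 6, would have 12 zeros. So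
the cubic is irreducible for general points of θ.

Irreducibility of Ψ follows, since Ψ vanishes when two points coincide and has irreducible
specializations in each point (`irreducible_of_specializations`). Then V(Ψ) is irreducible, and so
is its image 𝒲. -/

theorem eval_weight_smul [CommRing R] {w : σ → ℕ} {G : MvPolynomial σ R} {n : ℕ}
    (hG : IsWeightedHomogeneous w G n) (t : R) (p : σ → R) :
    eval (fun a => t ^ w a * p a) G = t ^ n * eval p G := by
  rw [eval_eq, eval_eq, Finset.mul_sum]
  refine Finset.sum_congr rfl fun m hm => ?_
  have h := hG (mem_support_iff.1 hm)
  rw [Finsupp.weight_apply, Finsupp.sum] at h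
  simp only [smul_eq_mul] at h
  rw [← h, ← Finset.prod_pow_eq_pow_sum]
  simp only [mul_pow, Finset.prod_mul_distrib, ← pow_mul, mul_comm (w _)]
  ring

theorem eval_multihomogeneous_smul {ι : Type*} [DecidableEq ι] [Fintype ι] [CommRing R]
    {G : MvPolynomial (ι × Fin 3) R} {d : ι → ℕ} (hG : IsMultihomogeneous G d) (t : ι → R)
    (p : ι × Fin 3 → R) :
    eval (fun a => t a.1 * p a) G = (∏ i, t i ^ d i) * eval p G := by
  rw [eval_eq', eval_eq', Finset.mul_sum]
  refine Finset.sum_congr rfl fun m hm => ?_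
  have h : ∀ i, ∑ j, m (i, j) = d i := by
    intro i
    have h := hG i (mem_support_iff.1 hm)
    rw [Finsupp.weight_apply, Finsupp.sum_fintype _ _ (by simp), Fintype.sum_prod_type,
      Finset.sum_eq_single i] at h
    · simpa using h
    · intro b _ hb
      simp [hb]
    · simp
  have h2 : ∏ a : ι × Fin 3, t a.1 ^ m a = ∏ i, t i ^ d i := by
    rw [Fintype.prod_prod_type]
    refine Finset.prod_congr rfl fun i _ => ?_
    rw [← h i, ← Finset.prod_pow_eq_pow_sum]
  simp only [mul_pow, Finset.prod_mul_distrib, h2]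
  ring

theorem IsMultihomogeneous.mul {ι : Type*} [DecidableEq ι] [CommRing R]
    {G H : MvPolynomial (ι × Fin 3) R} {d e : ι → ℕ} (hG : IsMultihomogeneous G d)
    (hH : IsMultihomogeneous H e) : IsMultihomogeneous (G * H) (d + e) :=
  fun i => (hG i).mul (hH i)

theorem IsMultihomogeneous.prod {ι κ : Type*} [DecidableEq ι] [CommRing R] (s : Finset κ)
    {G : κ → MvPolynomial (ι × Fin 3) R} {d : κ → ι → ℕ}
    (hG : ∀ a ∈ s, IsMultihomogeneous (G a) (d a)) :
    IsMultihomogeneous (∏ a ∈ s, G a) (∑ a ∈ s, d a) := fun i => by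
  rw [Finset.sum_apply]
  exact IsWeightedHomogeneous.prod s G (fun a => d a i) fun a ha => hG a ha i

theorem IsMultihomogeneous.C_mul {ι : Type*} [DecidableEq ι] [CommRing R]
    {G : MvPolynomial (ι × Fin 3) R} {d : ι → ℕ} (hG : IsMultihomogeneous G d) (c : R) :
    IsMultihomogeneous (C c * G) d := fun i => (hG i).C_mul c

theorem isMultihomogeneous_X {ι : Type*} [DecidableEq ι] [CommRing R] (a : ι × Fin 3) :
    IsMultihomogeneous (X a : MvPolynomial (ι × Fin 3) R) (Pi.single a.1 1) := fun i => by
  have := isWeightedHomogeneous_X R (fun b : ι × Fin 3 => if b.1 = i then 1 else 0) a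
  convert this using 1
  simp [Pi.single_apply, eq_comm]

theorem IsWeightedHomogeneous.aeval_isHomogeneous [CommRing R] {w : σ → ℕ}
    {G : MvPolynomial σ R} {n : ℕ} (hG : IsWeightedHomogeneous w G n)
    {f : σ → MvPolynomial τ R} (hf : ∀ a, (f a).IsHomogeneous (w a)) :
    (aeval f G).IsHomogeneous n := by
  rw [aeval_def, eval₂_eq]
  refine IsHomogeneous.sum _ _ _ fun m hm => ?_
  have h := hG (mem_support_iff.1 hm)
  rw [Finsupp.weight_apply, Finsupp.sum] at h
  rw [← h, ← zero_add (∑ _ ∈ _, _)]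
  refine IsHomogeneous.mul (isHomogeneous_C _ _) (IsHomogeneous.prod _ _ _ fun a _ => ?_)
  rw [smul_eq_mul, mul_comm]
  exact (hf a).pow _

/-- The homomorphism that multiplies each variable `X a` by `T ^ w a`. -/
def weightScale [CommRing R] (w : σ → ℕ) :
    MvPolynomial σ R →ₐ[R] Polynomial (MvPolynomial σ R) :=
  aeval fun a => Polynomial.X ^ w a * Polynomial.C (X a)

theorem weightScale_monomial [CommRing R] (w : σ → ℕ) (m : σ →₀ ℕ) (c : R) :
    weightScale w (monomial m c) =
      Polynomial.X ^ (Finsupp.weight w m) * Polynomial.C (monomial m c) := by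
  rw [weightScale, aeval_monomial, Finsupp.prod]
  simp only [mul_pow, Finset.prod_mul_distrib, ← pow_mul]
  rw [Finset.prod_pow_eq_pow_sum, monomial_eq, Finsupp.weight_apply, Finsupp.sum, Finsupp.prod]
  simp only [smul_eq_mul, mul_comm (w _), Polynomial.C_mul, map_prod, map_pow]
  have : algebraMap R (Polynomial (MvPolynomial σ R)) c = Polynomial.C (C c) := rfl
  rw [this]
  ring

theorem coeff_weightScale [CommRing R] (w : σ → ℕ) (G : MvPolynomial σ R) (i : ℕ) (m : σ →₀ ℕ) :
    coeff m ((weightScale w G).coeff i) = if Finsupp.weight w m = i then coeff m G else 0 := by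
  classical
  induction G using MvPolynomial.induction_on' with
  | monomial u a =>
    rw [weightScale_monomial, Polynomial.coeff_X_pow_mul', Polynomial.coeff_C]
    by_cases h : u = m
    · subst h
      by_cases h2 : Finsupp.weight w u = i
      · simp [h2]
      · rw [if_neg h2]
        split_ifs with h3 h4
        · omega
        · simp
        · simp
    · split_ifs <;> simp [coeff_monomial, h]
  | add p q hp hq =>
    rw [map_add, Polynomial.coeff_add, coeff_add, hp, hq, coeff_add]
    split_ifs <;> simp

theorem weightScale_eval_one [CommRing R] (w : σ → ℕ) (G : MvPolynomial σ R) :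
    (weightScale w G).eval 1 = G := by
  induction G using MvPolynomial.induction_on' with
  | monomial u a => simp [weightScale_monomial]
  | add p q hp hq => simp [hp, hq]

theorem weightScale_eq_iff [CommRing R] {w : σ → ℕ} {G : MvPolynomial σ R} {n : ℕ} :
    IsWeightedHomogeneous w G n ↔ weightScale w G = Polynomial.C G * Polynomial.X ^ n := by
  constructor
  · intro h
    ext i m
    rw [coeff_weightScale, Polynomial.coeff_C_mul_X_pow]
    by_cases hm : coeff m G = 0
    · split_ifs <;> simp [hm]
    · rw [h hm]
      split_ifs with h1 h2 h2
      · rfl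
      · omega
      · omega
      · simp
  · intro h m hm
    have := coeff_weightScale w G n m
    rw [h, Polynomial.coeff_C_mul_X_pow, if_pos rfl] at this
    by_contra hne
    rw [if_neg hne] at this
    exact hm this

/-- Over a domain both the degree and the lowest degree in the scaling variable are additive. They
coincide for the product, hence for each factor. -/
theorem isWeightedHomogeneous_factor [CommRing R] [IsDomain R] {w : σ → ℕ}
    {A B : MvPolynomial σ R} {n : ℕ} (h : IsWeightedHomogeneous w (A * B) n) (h0 : A * B ≠ 0) :
    ∃ a b, a + b = n ∧ IsWeightedHomogeneous w A a ∧ IsWeightedHomogeneous w B b := by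
  have hA : A ≠ 0 := left_ne_zero_of_mul h0
  have hB : B ≠ 0 := right_ne_zero_of_mul h0
  have hinj : ∀ G : MvPolynomial σ R, G ≠ 0 → weightScale w G ≠ 0 := fun G hG h1 => hG (by
    rw [← weightScale_eval_one w G, h1]; simp)
  rw [weightScale_eq_iff, map_mul] at h
  have h1 := congrArg Polynomial.natDegree h
  have h2 := congrArg Polynomial.natTrailingDegree h
  rw [Polynomial.natDegree_mul (hinj A hA) (hinj B hB),
    Polynomial.natDegree_C_mul_X_pow _ _ h0] at h1
  rw [Polynomial.natTrailingDegree_mul (hinj A hA) (hinj B hB),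
    Polynomial.C_mul_X_pow_eq_monomial, Polynomial.natTrailingDegree_monomial h0] at h2
  have h3 := Polynomial.natTrailingDegree_le_natDegree (weightScale w A)
  have h4 := Polynomial.natTrailingDegree_le_natDegree (weightScale w B)
  have key : ∀ G : MvPolynomial σ R,
      (weightScale w G).natTrailingDegree = (weightScale w G).natDegree →
      IsWeightedHomogeneous w G (weightScale w G).natDegree := by
    intro G hG
    rw [weightScale_eq_iff]
    have h5 : weightScale w G =
        Polynomial.C ((weightScale w G).coeff (weightScale w G).natDegree) *
          Polynomial.X ^ (weightScale w G).natDegree := by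
      ext1 i
      rw [Polynomial.coeff_C_mul_X_pow]
      split_ifs with hi
      · rw [hi]
      · rcases lt_or_gt_of_ne hi with hi | hi
        · exact Polynomial.coeff_eq_zero_of_lt_natTrailingDegree (hG ▸ hi)
        · exact Polynomial.coeff_eq_zero_of_natDegree_lt hi
    have h6 := weightScale_eval_one w G
    rw [h5] at h6
    simp only [Polynomial.eval_mul, Polynomial.eval_C, Polynomial.eval_pow, Polynomial.eval_X,
      one_pow, mul_one] at h6
    rw [h6] at h5
    exact h5
  exact ⟨_, _, h1, key A (by omega), key B (by omega)⟩

theorem isHomogeneous_factor [CommRing R] [IsDomain R] {A B : MvPolynomial σ R} {n : ℕ}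
    (h : (A * B).IsHomogeneous n) (h0 : A * B ≠ 0) :
    ∃ a b, a + b = n ∧ A.IsHomogeneous a ∧ B.IsHomogeneous b :=
  isWeightedHomogeneous_factor h h0

end Weighted

/-! ### Zeros of polynomials -/

section Zeros

variable {σ k : Type*} [Field k]

theorem exists_eval_ne_zero [Infinite k] {G : MvPolynomial σ k} (hG : G ≠ 0) :
    ∃ p, eval p G ≠ 0 := by
  by_contra! h
  exact hG (MvPolynomial.funext fun x => by simp [h x])

/-- Nullstellensatz: some power of `H` lies in the ideal generated by `G`, and `G` is prime. -/
theorem dvd_of_forall_eval_eq_zero [IsAlgClosed k] [Finite σ] {G H : MvPolynomial σ k}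
    (hG : Prime G) (h : ∀ p, eval p G = 0 → eval p H = 0) : G ∣ H := by
  have h1 : H ∈ vanishingIdeal k (zeroLocus k (Ideal.span {G})) := by
    intro x hx
    have := hx G (Ideal.mem_span_singleton_self G)
    rw [aeval_eq_eval] at this ⊢
    exact h x this
  rw [vanishingIdeal_zeroLocus_eq_radical] at h1
  obtain ⟨n, hn⟩ := h1
  exact hG.dvd_of_dvd_pow (Ideal.mem_span_singleton.1 hn)

theorem exists_eq_C_of_isHomogeneous_zero {G : MvPolynomial σ k} (h : G.IsHomogeneous 0) :
    ∃ c, G = C c :=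
  ⟨_, totalDegree_eq_zero_iff_eq_C.1 (Nat.le_zero.1 h.totalDegree_le)⟩

theorem isHomogeneous_unit {G : MvPolynomial σ k} {n : ℕ} (h : G.IsHomogeneous n)
    (hu : IsUnit G) : n = 0 := by
  obtain ⟨r, hr, hC⟩ := MvPolynomial.isUnit_iff_eq_C_of_isReduced.1 hu
  have := h.totalDegree hu.ne_zero
  rw [hC, totalDegree_C] at this
  exact this.symm

theorem isUnit_of_isHomogeneous_zero {G : MvPolynomial σ k} (h : G.IsHomogeneous 0)
    (h0 : G ≠ 0) : IsUnit G := by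
  obtain ⟨c, rfl⟩ := exists_eq_C_of_isHomogeneous_zero h
  exact (isUnit_iff_ne_zero.2 fun hc => h0 (by rw [hc, C_0])).map C

end Zeros

/-! ### Irreducibility of multihomogeneous polynomials -/

section Irreducible

variable {ι k : Type*} [DecidableEq ι] [Field k]

/-- The polynomial in the coordinates of the point with index `i` obtained by specializing the
other points to `p`. -/
def specializeAt (i : ι) (p : ι → Fin 3 → k) :
    MvPolynomial (ι × Fin 3) k →ₐ[k] MvPolynomial (Fin 3) k :=
  aeval fun a => if a.1 = i then X a.2 else C (p a.1 a.2)

theorem specializeAt_isHomogeneous {i : ι} {p : ι → Fin 3 → k} {G : MvPolynomial (ι × Fin 3) k}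
    {n : ℕ} (hG : IsWeightedHomogeneous (fun a : ι × Fin 3 => if a.1 = i then 1 else 0) G n) :
    (specializeAt i p G).IsHomogeneous n := by
  refine IsWeightedHomogeneous.aeval_isHomogeneous hG fun a => ?_
  split_ifs
  · exact isHomogeneous_X _ _
  · exact isHomogeneous_C _ _

/-- Scaling the coordinates of the `i`-th point by 0 does not change the value. -/
theorem eval_eq_of_degree_zero {i : ι} {G : MvPolynomial (ι × Fin 3) k}
    (hG : IsWeightedHomogeneous (fun a : ι × Fin 3 => if a.1 = i then 1 else 0) G 0)
    {p q : ι × Fin 3 → k} (h : ∀ a, a.1 ≠ i → p a = q a) : eval p G = eval q G := by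
  have h1 := eval_weight_smul hG 0 p
  have h2 := eval_weight_smul hG 0 q
  rw [pow_zero, one_mul] at h1 h2
  rw [← h1, ← h2]
  congr 2
  funext a
  by_cases ha : a.1 = i
  · simp [ha]
  · simp [ha, h a ha]

theorem isHomogeneous_sum_of_isMultihomogeneous [Fintype ι] {G : MvPolynomial (ι × Fin 3) k}
    {d : ι → ℕ} (hG : IsMultihomogeneous G d) : G.IsHomogeneous (∑ i, d i) := by
  intro m hm
  have h : ∀ i, ∑ j, m (i, j) = d i := by
    intro i
    have h := hG i hm
    rw [Finsupp.weight_apply, Finsupp.sum_fintype _ _ (by simp), Fintype.sum_prod_type,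
      Finset.sum_eq_single i] at h
    · simpa using h
    · intro b _ hb
      simp [hb]
    · simp
  rw [Finsupp.weight_apply, Finsupp.sum_fintype _ _ (by simp), Fintype.sum_prod_type]
  simp [h]

/-- A multihomogeneous polynomial that vanishes whenever two points coincide and whose
specializations in each point include an irreducible one is irreducible. -/
theorem irreducible_of_specializations [Fintype ι] [Nonempty ι] [Infinite k]
    {G : MvPolynomial (ι × Fin 3) k} {d : ℕ} (hd : d ≠ 0)
    (hG : IsMultihomogeneous G fun _ => d)
    (hspec : ∀ i, ∃ p, Irreducible (specializeAt i p G))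
    (hdiag : ∀ i j, i ≠ j → ∀ p : ι → Fin 3 → k, p i = p j →
      eval (fun a : ι × Fin 3 => p a.1 a.2) G = 0) : Irreducible G := by
  have hG0 : G ≠ 0 := by
    rintro rfl
    obtain ⟨p, hp⟩ := hspec (Classical.arbitrary ι)
    exact hp.ne_zero (map_zero _)
  rw [irreducible_iff]
  constructor
  · intro hu
    have := isHomogeneous_unit (isHomogeneous_sum_of_isMultihomogeneous hG) hu
    simp [hd] at this
  intro A B hAB
  have hAB0 : A * B ≠ 0 := hAB ▸ hG0
  have hA0 := left_ne_zero_of_mul hAB0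
  have hB0 := right_ne_zero_of_mul hAB0
  have hdeg : ∀ i, ∃ a b, a + b = d ∧
      IsWeightedHomogeneous (fun a : ι × Fin 3 => if a.1 = i then 1 else 0) A a ∧
      IsWeightedHomogeneous (fun a : ι × Fin 3 => if a.1 = i then 1 else 0) B b :=
    fun i => isWeightedHomogeneous_factor (hAB ▸ hG i) hAB0
  choose a b hab hA hB using hdeg
  have hAm : IsMultihomogeneous A a := hA
  have hBm : IsMultihomogeneous B b := hB
  -- A specialization in the `i`-th point that stays irreducible has a unit factor, and a
  -- homogeneous unit has degree 0.
  have hor : ∀ i, a i = 0 ∨ b i = 0 := by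
    intro i
    obtain ⟨p, hp⟩ := hspec i
    rw [hAB, map_mul] at hp
    rcases hp.isUnit_or_isUnit rfl with hu | hu
    · exact Or.inl (isHomogeneous_unit (specializeAt_isHomogeneous (hA i)) hu)
    · exact Or.inr (isHomogeneous_unit (specializeAt_isHomogeneous (hB i)) hu)
  by_cases ha : ∀ i, a i = 0
  · left
    refine isUnit_of_isHomogeneous_zero ?_ hA0
    simpa [ha] using isHomogeneous_sum_of_isMultihomogeneous hAm
  by_cases hb : ∀ i, b i = 0
  · right
    refine isUnit_of_isHomogeneous_zero ?_ hB0
    simpa [hb] using isHomogeneous_sum_of_isMultihomogeneous hBm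
  exfalso
  push Not at ha hb
  obtain ⟨j, hj⟩ := ha
  obtain ⟨i, hi⟩ := hb
  have hbj : b j = 0 := (hor j).resolve_left hj
  have hai : a i = 0 := (hor i).resolve_right hi
  have hij : i ≠ j := by
    rintro rfl
    exact hj hai
  have hAi := hA i
  have hBj := hB j
  rw [hai] at hAi
  rw [hbj] at hBj
  -- `A` does not involve the point `i` and `B` does not involve the point `j`. Moving `j` onto `i`
  -- thus turns `A * B` into a renaming of `A` times `B`; this is not the zero polynomial, although
  -- `G` vanishes on that diagonal.
  have hAs : rename (Prod.map (Equiv.swap i j) id) A ≠ 0 := by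
    intro h
    refine hA0 (rename_injective _ ?_ (h.trans (map_zero _).symm))
    exact (Equiv.swap i j).injective.prodMap Function.injective_id
  obtain ⟨p, hp⟩ := exists_eval_ne_zero (mul_ne_zero hAs hB0)
  rw [map_mul, eval_rename] at hp
  let p' : ι → Fin 3 → k := Function.update (fun a b => p (a, b)) j fun b => p (i, b)
  have h1 : eval (fun a : ι × Fin 3 => p' a.1 a.2) A = eval (p ∘ Prod.map (Equiv.swap i j) id) A :=
      by
    refine eval_eq_of_degree_zero hAi ?_
    rintro ⟨a, b⟩ ha
    by_cases haj : a = j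
    · simp [p', haj]
    · simp [p', haj, Equiv.swap_apply_of_ne_of_ne ha haj]
  have h2 : eval (fun a : ι × Fin 3 => p' a.1 a.2) B = eval p B := by
    refine eval_eq_of_degree_zero hBj fun a ha => ?_
    simp [p', ha]
  have h3 := hdiag i j hij p' (by simp [p', hij])
  rw [hAB, map_mul, h1, h2] at h3
  exact hp h3

end Irreducible

/-! ### Determinants with homogeneous entries -/

section Det

variable {σ n R : Type*} [CommRing R] [Fintype n] [DecidableEq n]

/-- The entry in row `r` and column `c` has degree `a r - b c`, written without subtraction, so
along any permutation the degrees add up to the same number. Zero entries are exempt. -/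
theorem det_isWeightedHomogeneous {w : σ → ℕ} {M : Matrix n n (MvPolynomial σ R)} {a b : n → ℕ}
    {N : ℕ} (hM : ∀ r c, M r c = 0 ∨ ∃ e, e + b c = a r ∧ IsWeightedHomogeneous w (M r c) e)
    (hN : N + ∑ c, b c = ∑ r, a r) : IsWeightedHomogeneous w M.det N := by
  rw [Matrix.det_apply']
  refine IsWeightedHomogeneous.sum _ _ _ fun s _ => ?_
  by_cases h0 : ∃ c, M (s c) c = 0
  · obtain ⟨c, hc⟩ := h0
    rw [Finset.prod_eq_zero (f := fun c => M (s c) c) (Finset.mem_univ c) hc, mul_zero]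
    exact isWeightedHomogeneous_zero R w N
  push Not at h0
  have h1 : ∀ c, ∃ e, e + b c = a (s c) ∧ IsWeightedHomogeneous w (M (s c) c) e :=
    fun c => (hM (s c) c).resolve_left (h0 c)
  choose e he hw using h1
  have h2 : N = ∑ c, e c := by
    have : ∑ c, (e c + b c) = ∑ r, a r := by
      rw [Finset.sum_congr rfl fun c _ => he c]
      exact Equiv.sum_comp s a
    rw [Finset.sum_add_distrib] at this
    omega
  rw [h2]
  have h3 := IsWeightedHomogeneous.prod Finset.univ (fun c => M (s c) c) e fun c _ => hw c
  have h4 : ((Equiv.Perm.sign s : ℤ) : MvPolynomial σ R) = C ((Equiv.Perm.sign s : ℤ) : R) := by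
    simp
  rw [h4]
  exact h3.C_mul _

end Det

/-! ### Forms in three variables -/

section Forms

variable {R : Type*} [CommRing R]

theorem coeff_sum_monomials {σ ι : Type*} [Fintype σ] [Fintype ι] [DecidableEq ι]
    {e : ι → σ → ℕ} (he : Function.Injective e) (c : ι → R) (i : ι) :
    coeff (Finsupp.equivFunOnFinite.symm (e i)) (∑ j, C (c j) * ∏ s, X s ^ e j s) = c i := by
  classical
  rw [coeff_sum, Finset.sum_eq_single i]
  · have : (∏ s, X s ^ e i s : MvPolynomial σ R) =
        monomial (Finsupp.equivFunOnFinite.symm (e i)) 1 := by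
      rw [monomial_eq, Finsupp.prod_fintype _ _ (by simp)]
      simp
    rw [this, coeff_C_mul, coeff_monomial, if_pos rfl, mul_one]
  · intro j _ hj
    have : (∏ s, X s ^ e j s : MvPolynomial σ R) =
        monomial (Finsupp.equivFunOnFinite.symm (e j)) 1 := by
      rw [monomial_eq, Finsupp.prod_fintype _ _ (by simp)]
      simp
    rw [this, coeff_C_mul, coeff_monomial, if_neg, mul_zero]
    exact fun h => hj (he (Finsupp.equivFunOnFinite.symm.injective h))
  · simp

/-- The index set of the ten cubic monomials in three variables. -/
abbrev CubicIndex := Fin 7 ⊕ Fin 3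

/-- The values of the ten cubic monomials. -/
def cubicMonomials (v : Fin 3 → R) : CubicIndex → R :=
  Sum.elim ![v 0 ^ 3, v 1 ^ 3, v 2 ^ 3, v 0 ^ 2 * v 1, v 0 ^ 2 * v 2, v 1 ^ 2 * v 2,
    v 0 * v 1 * v 2] ![v 0 * v 1 ^ 2, v 0 * v 2 ^ 2, v 1 * v 2 ^ 2]

/-- The exponents of the ten cubic monomials. -/
def cubicExponents : CubicIndex → Fin 3 → ℕ :=
  Sum.elim ![![3, 0, 0], ![0, 3, 0], ![0, 0, 3], ![2, 1, 0], ![2, 0, 1], ![0, 2, 1], ![1, 1, 1]]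
    ![![1, 2, 0], ![1, 0, 2], ![0, 1, 2]]

theorem cubicMonomials_eq_prod (v : Fin 3 → R) (m : CubicIndex) :
    cubicMonomials v m = ∏ s, v s ^ cubicExponents m s := by
  rcases m with m | m <;> fin_cases m <;>
    simp [cubicMonomials, cubicExponents, Fin.prod_univ_three]

/-- The values of the six quadratic monomials. -/
def quadMonomials (v : Fin 3 → R) (h : Fin 6) : R := v (quadIndex h).1 * v (quadIndex h).2

/-- The cubic form with given coefficients. -/
def cubicForm (c : CubicIndex → R) : MvPolynomial (Fin 3) R := ∑ m, C (c m) * cubicMonomials X m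

/-- The quadratic form with given coefficients. -/
def quadForm (c : Fin 6 → R) : MvPolynomial (Fin 3) R := ∑ m, C (c m) * quadMonomials X m

/-- The linear form with given coefficients. -/
def linForm (c : Fin 3 → R) : MvPolynomial (Fin 3) R := ∑ m, C (c m) * X m

theorem map_cubicMonomials {S : Type*} [CommRing S] (f : R →+* S) (v : Fin 3 → R) (m : CubicIndex) :
    f (cubicMonomials v m) = cubicMonomials (fun j => f (v j)) m := by
  simp [cubicMonomials_eq_prod]

theorem map_quadMonomials {S : Type*} [CommRing S] (f : R →+* S) (v : Fin 3 → R) (m : Fin 6) :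
    f (quadMonomials v m) = quadMonomials (fun j => f (v j)) m := by
  simp [quadMonomials]

theorem eval_cubicForm (c : CubicIndex → R) (v : Fin 3 → R) :
    eval v (cubicForm c) = ∑ m, c m * cubicMonomials v m := by
  simp [cubicForm, map_cubicMonomials]

theorem eval_quadForm (c : Fin 6 → R) (v : Fin 3 → R) :
    eval v (quadForm c) = ∑ m, c m * quadMonomials v m := by
  simp [quadForm, map_quadMonomials]

theorem eval_linForm (c : Fin 3 → R) (v : Fin 3 → R) :
    eval v (linForm c) = ∑ m, c m * v m := by
  simp [linForm]

theorem cubicForm_add (c d : CubicIndex → R) : cubicForm (c + d) = cubicForm c + cubicForm d := by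
  simp only [cubicForm, Pi.add_apply, map_add, add_mul, Finset.sum_add_distrib]

theorem cubicForm_smul (a : R) (c : CubicIndex → R) : cubicForm (a • c) = C a * cubicForm c := by
  simp only [cubicForm, Pi.smul_apply, smul_eq_mul, map_mul, Finset.mul_sum, mul_assoc]

theorem cubicExponents_injective : Function.Injective cubicExponents := by
  decide

theorem coeff_cubicForm (c : CubicIndex → R) (m : CubicIndex) :
    coeff (Finsupp.equivFunOnFinite.symm (cubicExponents m)) (cubicForm c) = c m := by
  simp only [cubicForm, cubicMonomials_eq_prod]
  exact coeff_sum_monomials cubicExponents_injective c m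

theorem cubicForm_injective : Function.Injective (cubicForm (R := R)) := fun c d h => by
  funext m
  rw [← coeff_cubicForm c m, h, coeff_cubicForm]

theorem cubicForm_zero : cubicForm (0 : CubicIndex → R) = 0 := by
  simp [cubicForm]

theorem cubicForm_isHomogeneous (c : CubicIndex → R) : (cubicForm c).IsHomogeneous 3 := by
  refine IsHomogeneous.sum _ _ _ fun m _ => ?_
  rw [cubicMonomials_eq_prod]
  have h := IsHomogeneous.prod Finset.univ (fun s => (X s : MvPolynomial (Fin 3) R) ^ cubicExponents
      m s)
    (fun s => cubicExponents m s) fun s _ => by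
      simpa using (isHomogeneous_X R s).pow (cubicExponents m s)
  have h3 : ∀ m, ∑ s, cubicExponents m s = 3 := by decide
  rw [h3] at h
  exact h.C_mul _

theorem quadForm_isHomogeneous (c : Fin 6 → R) : (quadForm c).IsHomogeneous 2 := by
  refine IsHomogeneous.sum _ _ _ fun m _ => ?_
  exact ((isHomogeneous_X R _).mul (isHomogeneous_X R _)).C_mul _

theorem linForm_isHomogeneous (c : Fin 3 → R) : (linForm c).IsHomogeneous 1 := by
  refine IsHomogeneous.sum _ _ _ fun m _ => ?_
  exact (isHomogeneous_X R _).C_mul _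

variable {k : Type*} [Field k] [CharZero k]

/-- Euler's formula, which needs division by the degree. -/
theorem exists_sum_X_mul {n : ℕ} {p : MvPolynomial (Fin 3) k} (h : p.IsHomogeneous (n + 1)) :
    ∃ f : Fin 3 → MvPolynomial (Fin 3) k, (∀ j, (f j).IsHomogeneous n) ∧ p = ∑ j, X j * f j := by
  refine ⟨fun j => C ((n + 1 : k)⁻¹) * pderiv j p, fun j => ?_, ?_⟩
  · exact (h.pderiv (i := j)).C_mul _
  · have h1 := h.sum_X_mul_pderiv
    have h2 : (n + 1 : k) ≠ 0 := by exact_mod_cast Nat.succ_ne_zero n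
    calc p = C ((n + 1 : k)⁻¹) * ((n + 1) • p) := by
            rw [nsmul_eq_mul, ← mul_assoc]
            have : ((n + 1 : ℕ) : MvPolynomial (Fin 3) k) = C (n + 1 : k) := by simp
            rw [this, ← C_mul, inv_mul_cancel₀ h2, C_1, one_mul]
      _ = _ := by
            rw [← h1, Finset.mul_sum]
            exact Finset.sum_congr rfl fun j _ => by ring

theorem exists_linForm {p : MvPolynomial (Fin 3) k} (h : p.IsHomogeneous 1) :
    ∃ c, p = linForm c := by
  obtain ⟨f, hf, rfl⟩ := exists_sum_X_mul h
  choose c hc using fun j => exists_eq_C_of_isHomogeneous_zero (hf j)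
  exact ⟨c, by simp [linForm, hc, mul_comm]⟩

theorem exists_quadForm {p : MvPolynomial (Fin 3) k} (h : p.IsHomogeneous 2) :
    ∃ c, p = quadForm c := by
  obtain ⟨f, hf, rfl⟩ := exists_sum_X_mul h
  choose c hc using fun j => exists_linForm (hf j)
  refine ⟨![c 0 0, c 1 1, c 2 2, c 0 1 + c 1 0, c 0 2 + c 2 0, c 1 2 + c 2 1], ?_⟩
  simp [quadForm, linForm, hc, Fin.sum_univ_succ, quadMonomials, quadIndex]
  ring

theorem exists_cubicForm {p : MvPolynomial (Fin 3) k} (h : p.IsHomogeneous 3) :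
    ∃ c, p = cubicForm c := by
  obtain ⟨f, hf, rfl⟩ := exists_sum_X_mul h
  choose c hc using fun j => exists_quadForm (hf j)
  refine ⟨Sum.elim ![c 0 0, c 1 1, c 2 2, c 0 3 + c 1 0, c 0 4 + c 2 0, c 1 5 + c 2 1,
    c 0 5 + c 1 4 + c 2 3] ![c 0 1 + c 1 3, c 0 2 + c 2 4, c 1 2 + c 2 5], ?_⟩
  simp [quadForm, cubicForm, cubicMonomials, hc, Fin.sum_univ_succ, quadMonomials, quadIndex]
  ring

end Forms

/-! ### The invariant of nets of cubics -/

section Net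

variable {R : Type*} [CommRing R]

/-- The triples of cubic monomials that occur in the cube of a `3 × 3` determinant. -/
def invariantTriples : Fin 9 → Fin 3 → CubicIndex :=
  ![![.inl 0, .inl 1, .inl 2], ![.inl 3, .inl 5, .inr 1], ![.inl 4, .inr 0, .inr 2],
    ![.inl 0, .inl 5, .inr 2], ![.inl 3, .inl 6, .inr 2], ![.inl 4, .inl 5, .inl 6],
    ![.inl 6, .inr 0, .inr 1], ![.inl 1, .inl 4, .inr 1], ![.inl 2, .inl 3, .inr 0]]

/-- The coefficients of the invariant `(abc)³` of three cubics. -/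
def invariantWeights : Fin 9 → R := ![9, 1, 1, -3, 1, 1, 1, 3, -3]

/-- The alternating invariant `(abc)³` of three cubics. -/
def netInvariant (G : Fin 3 → CubicIndex → R) : R :=
  ∑ t, invariantWeights t * Matrix.det (Matrix.of fun i a => G i (invariantTriples t a))

/-- The alternating form on seven vectors dual to `netInvariant`. -/
def dualInvariant (W : Fin 7 → CubicIndex → R) : R :=
  ∑ t, invariantWeights t * Matrix.det (Matrix.of (Sum.elim W fun a =>
    (Pi.single (invariantTriples t a) 1 : CubicIndex → R)))

/-- Complementary minors. Multiply the matrix with rows `W` and three unit vectors by the matrix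
with columns `K` and `G`. Since `G` is killed by `W`, the product is block triangular, with diagonal
blocks `W K` and the 3 × 3 submatrix of `G` at the chosen monomials. A weighted sum over the nine
triples gives the formula. -/
theorem dualInvariant_mul_det (W : Fin 7 → CubicIndex → R) (G : Fin 3 → CubicIndex → R)
    (hWG : ∀ i j, ∑ m, W i m * G j m = 0) (K : CubicIndex → Fin 7 → R) :
    dualInvariant W * Matrix.det (Matrix.of fun m => Sum.elim (K m) fun j => G j m) =
      Matrix.det (Matrix.of fun i b => ∑ m, W i m * K m b) * netInvariant G := by
  rw [dualInvariant, netInvariant, Finset.sum_mul, Finset.mul_sum]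
  refine Finset.sum_congr rfl fun t _ => ?_
  rw [mul_assoc, ← Matrix.det_mul]
  have h : (Matrix.of (Sum.elim W fun a => (Pi.single (invariantTriples t a) 1 : CubicIndex → R))) *
      (Matrix.of fun m => Sum.elim (K m) fun j => G j m : Matrix CubicIndex CubicIndex R) =
      Matrix.fromBlocks (Matrix.of fun i b => ∑ m, W i m * K m b) 0
        (Matrix.of fun a b => K (invariantTriples t a) b)
        (Matrix.transpose (Matrix.of fun i a => G i (invariantTriples t a))) := by
    ext r c
    rw [Matrix.mul_apply]
    rcases r with r | r <;> rcases c with c | c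
    · simp [Matrix.fromBlocks]
    · simpa [Matrix.fromBlocks] using hWG r c
    · simp only [Matrix.of_apply, Sum.elim_inr, Matrix.fromBlocks_apply₂₁, Sum.elim_inl]
      rw [Finset.sum_eq_single (invariantTriples t r)]
      · simp
      · intro b _ hb
        simp [hb]
      · simp
    · simp only [Matrix.of_apply, Sum.elim_inr, Matrix.fromBlocks_apply₂₂, Matrix.transpose_apply]
      rw [Finset.sum_eq_single (invariantTriples t r)]
      · simp
      · intro b _ hb
        simp [hb]
      · simp
  rw [h, Matrix.det_fromBlocks_zero₁₂, Matrix.det_transpose]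
  ring

theorem dualInvariant_perm (W : Fin 7 → CubicIndex → R) (s : Equiv.Perm (Fin 7)) :
    dualInvariant (fun i => W (s i)) = (Equiv.Perm.sign s : ℤ) * dualInvariant W := by
  rw [dualInvariant, dualInvariant, Finset.mul_sum]
  refine Finset.sum_congr rfl fun t _ => ?_
  have h := Matrix.det_permute (Equiv.sumCongr s (Equiv.refl (Fin 3)))
    (Matrix.of (Sum.elim W fun a => (Pi.single (invariantTriples t a) 1 : CubicIndex → R)))
  have h2 : Equiv.Perm.sign (Equiv.sumCongr s (Equiv.refl (Fin 3))) = Equiv.Perm.sign s := by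
    have := Equiv.Perm.sign_sumCongr s (1 : Equiv.Perm (Fin 3))
    rw [Equiv.Perm.sign_one, mul_one] at this
    exact this
  have h3 : (Matrix.of (Sum.elim W fun a => (Pi.single (invariantTriples t a) 1 : CubicIndex →
      R))).submatrix
      (Equiv.sumCongr s (Equiv.refl (Fin 3))) id = Matrix.of (Sum.elim (fun i => W (s i)) fun a =>
        (Pi.single (invariantTriples t a) 1 : CubicIndex → R)) := by
    ext r c
    rcases r with r | r <;> simp
  rw [← h3, h, h2]
  ring

theorem dualInvariant_eq_zero_of_eq (W : Fin 7 → CubicIndex → R) {i j : Fin 7} (hij : i ≠ j)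
    (h : W i = W j) : dualInvariant W = 0 := by
  refine Finset.sum_eq_zero fun t _ => ?_
  rw [Matrix.det_zero_of_row_eq (i := Sum.inl i) (j := Sum.inl j) (by simpa using hij)
    (show W i = W j from h), mul_zero]

theorem map_dualInvariant {S : Type*} [CommRing S] (f : R →+* S) (W : Fin 7 → CubicIndex → R) :
    f (dualInvariant W) = dualInvariant fun i m => f (W i m) := by
  simp only [dualInvariant, map_sum, map_mul, RingHom.map_det]
  refine Finset.sum_congr rfl fun t _ => ?_
  congr 1
  · fin_cases t <;> simp [invariantWeights] <;> exact map_ofNat f _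
  · congr 1
    ext r c
    rcases r with r | r
    · simp
    · simp only [RingHom.mapMatrix_apply, Matrix.map_apply, Matrix.of_apply, Sum.elim_inr,
        Pi.single_apply]
      split_ifs <;> simp

end Net

/-! ### Quadratic vector fields -/

section Field

variable {R : Type*} [CommRing R]

/-- The coefficients of the partial derivatives of a cubic form. -/
def gradCoeff (c : CubicIndex → R) : Fin 3 → Fin 6 → R :=
  ![![3 * c (.inl 0), c (.inr 0), c (.inr 1), 2 * c (.inl 3), 2 * c (.inl 4), c (.inl 6)],
    ![c (.inl 3), 3 * c (.inl 1), c (.inr 2), 2 * c (.inr 0), c (.inl 6), 2 * c (.inl 5)],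
    ![c (.inl 4), c (.inl 5), 3 * c (.inl 2), c (.inl 6), 2 * c (.inr 1), 2 * c (.inr 2)]]

theorem pderiv_cubicForm (c : CubicIndex → R) (j : Fin 3) :
    pderiv j (cubicForm c) = quadForm (gradCoeff c j) := by
  have h2 : (C (2 : R) : MvPolynomial (Fin 3) R) = 2 := map_ofNat C 2
  have h3 : (C (3 : R) : MvPolynomial (Fin 3) R) = 3 := map_ofNat C 3
  fin_cases j <;>
  · simp [cubicForm, quadForm, gradCoeff, Fin.sum_univ_succ, cubicMonomials, quadMonomials,
      quadIndex, pderiv_X, h2, h3]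
    ring

/-- The coefficients of the three components of a quadratic vector field, normalized by the
condition that the last component does not involve the last coordinate. -/
def fieldCoeff (q : Fin 15 → R) : Fin 3 → Fin 6 → R :=
  ![![q 0, q 1, q 2, q 3, q 4, q 5], ![q 6, q 7, q 8, q 9, q 10, q 11],
    ![q 12, q 13, 0, q 14, 0, 0]]

/-- The determinant of `ξ`, `X` and the vector field with coefficients `q` at `X`. -/
def fieldForm (q : Fin 15 → R) : MvPolynomial (Fin 3 ⊕ Fin 3) R :=
  detForm X fun j => quadForm (fieldCoeff q j)

/-- The coefficients of the three components of `X × Q(X)`. -/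
def fieldCubic (q : Fin 15 → R) : Fin 3 → CubicIndex → R :=
  ![Sum.elim ![0, q 13, -q 8, q 12, -q 6, -q 7, -q 9] ![q 14, -q 10, -q 11],
    Sum.elim ![-q 12, 0, q 2, -q 14, q 0, q 1, q 3] ![-q 13, q 4, q 5],
    Sum.elim ![q 6, -q 1, 0, q 9 - q 0, q 10, -q 5, q 11 - q 4] ![q 7 - q 3, q 8, -q 2]]

theorem cubicForm_fieldCubic (q : Fin 15 → R) :
    cubicForm (fieldCubic q 0) = X 1 * quadForm (fieldCoeff q 2) - X 2 * quadForm (fieldCoeff q 1) ∧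
    cubicForm (fieldCubic q 1) = X 2 * quadForm (fieldCoeff q 0) - X 0 * quadForm (fieldCoeff q 2) ∧
    cubicForm (fieldCubic q 2) = X 0 * quadForm (fieldCoeff q 1) - X 1 * quadForm (fieldCoeff q 0)
        := by
  refine ⟨?_, ?_, ?_⟩ <;>
  · simp [cubicForm, quadForm, fieldCubic, fieldCoeff, Fin.sum_univ_succ, cubicMonomials,
      quadMonomials, quadIndex]
    ring

theorem fieldForm_eq (q : Fin 15 → R) :
    fieldForm q = ∑ j, X (Sum.inl j) * rename Sum.inr (cubicForm (fieldCubic q j)) := by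
  obtain ⟨h0, h1, h2⟩ := cubicForm_fieldCubic q
  rw [Fin.sum_univ_three, h0, h1, h2, fieldForm, detForm, Matrix.det_fin_three]
  simp
  ring

/-- The matrix of the Morley form of a quadratic vector field. -/
def fieldMatrix (q : Fin 15 → R) : Matrix (Fin 6) (Fin 6) R :=
  !![0, q 14, -q 10, 2 * q 12, -2 * q 6, -q 9;
    -q 14, 0, q 5, -2 * q 13, q 3, 2 * q 1;
    q 10, -q 5, 0, -q 4 + q 11, 2 * q 8, -2 * q 2;
    -2 * q 12, 2 * q 13, q 4 - q 11, 0, 2 * q 0 - q 9, q 3 - 2 * q 7;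
    2 * q 6, -q 3, -2 * q 8, -2 * q 0 + q 9, 0, -q 4 - q 11;
    q 9, -2 * q 1, 2 * q 2, -q 3 + 2 * q 7, q 4 + q 11, 0]

/-- The exponents of the biquadratic monomials. -/
def biquadExponents (h : Fin 6 × Fin 6) : Fin 3 ⊕ Fin 3 → ℕ :=
  Sum.elim (fun j => (if (quadIndex h.1).1 = j then 1 else 0) + if (quadIndex h.1).2 =
      j then 1 else 0)
    (fun j => (if (quadIndex h.2).1 = j then 1 else 0) + if (quadIndex h.2).2 = j then 1 else 0)

theorem biquadExponents_injective : Function.Injective biquadExponents := by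
  decide +kernel

theorem coeffMatrix_sum (m : Matrix (Fin 6) (Fin 6) R) :
    coeffMatrix (∑ h : Fin 6 × Fin 6, C (m h.1 h.2) *
      (quadMonomials (fun j => X (Sum.inl j)) h.1 * quadMonomials (fun j => X (Sum.inr j)) h.2)) =
      m := by
  ext h l
  have h1 := coeff_sum_monomials biquadExponents_injective (fun h => m h.1 h.2) (h, l)
  have h2 : ∀ h : Fin 6 × Fin 6, (∏ s, X s ^ biquadExponents h s : MvPolynomial (Fin 3 ⊕ Fin 3) R) =
      quadMonomials (fun j => X (Sum.inl j)) h.1 * quadMonomials (fun j => X (Sum.inr j)) h.2 := by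
    intro h
    rw [Fintype.prod_sum_type]
    simp only [biquadExponents, Sum.elim_inl, Sum.elim_inr, pow_add, Finset.prod_mul_distrib,
      Finset.prod_pow_boole]
    simp [quadMonomials]
  simp only [h2] at h1
  rw [coeffMatrix, Matrix.of_apply, ← h1]
  congr 1
  ext s
  rcases s with s | s <;>
    simp [biquadExponents, Finsupp.single_apply]

theorem morleyForm_fieldForm (q : Fin 15 → R) :
    morleyForm (fieldForm q) = ∑ j, ∑ l, X (Sum.inl j) * X (Sum.inl l) *
      rename Sum.inr (quadForm (gradCoeff (fieldCubic q l) j)) := by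
  rw [morleyForm]
  refine Finset.sum_congr rfl fun j _ => ?_
  rw [fieldForm_eq, map_sum, Finset.mul_sum]
  refine Finset.sum_congr rfl fun l _ => ?_
  rw [Derivation.leibniz, pderiv_rename Sum.inr_injective, pderiv_cubicForm,
    pderiv_X_of_ne (by simp)]
  simp only [smul_eq_mul, mul_zero, add_zero]
  ring

set_option maxHeartbeats 2000000 in
theorem coeffMatrix_morleyForm_fieldForm (q : Fin 15 → R) :
    coeffMatrix (morleyForm (fieldForm q)) = fieldMatrix q := by
  rw [← coeffMatrix_sum (fieldMatrix q)]
  congr 1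
  rw [morleyForm_fieldForm, Fintype.sum_prod_type]
  simp [Fin.sum_univ_succ, quadForm, gradCoeff, fieldCubic, quadMonomials, quadIndex, fieldMatrix]
  have h2 : (C (2 : R) : MvPolynomial (Fin 3 ⊕ Fin 3) R) = 2 := map_ofNat C 2
  have h3 : (C (3 : R) : MvPolynomial (Fin 3 ⊕ Fin 3) R) = 3 := map_ofNat C 3
  rw [h2, h3]
  ring

/-- The bridge from the pfaffian to the invariant theory of nets of cubics: an identity of cubic
polynomials in the fifteen coefficients of the field. -/
theorem pfaffian6_fieldForm (q : Fin 15 → R) :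
    pfaffian6 (coeffMatrix (morleyForm (fieldForm q))) = -netInvariant (fieldCubic q) := by
  rw [coeffMatrix_morleyForm_fieldForm]
  simp [netInvariant, Fin.sum_univ_succ, invariantWeights, invariantTriples, Matrix.det_fin_three,
    fieldCubic, pfaffian6, pfaffian4, fieldMatrix]
  ring

end Field

/-! ### Apolarity -/

section Apolar

variable {R : Type*} [CommRing R]

/-- The coefficients of the product of the conic with matrix `A` and a linear form. -/
def conicMulLin (A : Matrix (Fin 3) (Fin 3) R) (l : Fin 3 → R) : CubicIndex → R :=
  Sum.elim ![A 0 0 * l 0, A 1 1 * l 1, A 2 2 * l 2, A 0 0 * l 1 + (A 0 1 + A 1 0) * l 0,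
    A 0 0 * l 2 + (A 0 2 + A 2 0) * l 0, A 1 1 * l 2 + (A 1 2 + A 2 1) * l 1,
    (A 0 1 + A 1 0) * l 2 + (A 0 2 + A 2 0) * l 1 + (A 1 2 + A 2 1) * l 0]
    ![A 1 1 * l 0 + (A 0 1 + A 1 0) * l 1, A 2 2 * l 0 + (A 0 2 + A 2 0) * l 2,
      A 2 2 * l 1 + (A 1 2 + A 2 1) * l 2]

/-- The coefficients of the linear form obtained from a cubic by a second order operator. -/
def polarCoeff (a : Matrix (Fin 3) (Fin 3) R) (c : CubicIndex → R) : Fin 3 → R :=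
  ![6 * a 0 0 * c (.inl 0) + 2 * a 1 1 * c (.inr 0) + 2 * a 2 2 * c (.inr 1) +
      2 * (a 0 1 + a 1 0) * c (.inl 3) + 2 * (a 0 2 + a 2 0) * c (.inl 4) +
      (a 1 2 + a 2 1) * c (.inl 6),
    2 * a 0 0 * c (.inl 3) + 6 * a 1 1 * c (.inl 1) + 2 * a 2 2 * c (.inr 2) +
      2 * (a 0 1 + a 1 0) * c (.inr 0) + (a 0 2 + a 2 0) * c (.inl 6) +
      2 * (a 1 2 + a 2 1) * c (.inl 5),
    2 * a 0 0 * c (.inl 4) + 2 * a 1 1 * c (.inl 5) + 6 * a 2 2 * c (.inl 2) +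
      (a 0 1 + a 1 0) * c (.inl 6) + 2 * (a 0 2 + a 2 0) * c (.inr 1) +
      2 * (a 1 2 + a 2 1) * c (.inr 2)]

/-- For a net containing two multiples of the conic, the invariant is a pairing of θ*(c) with l × m.
This is how apolarity enters. -/
theorem netInvariant_conicMulLin (A : Matrix (Fin 3) (Fin 3) R) (hA : A.IsSymm)
    (l m : Fin 3 → R) (c : CubicIndex → R) :
    netInvariant ![conicMulLin A l, conicMulLin A m, c] =
      2 * (polarCoeff A.adjugate c 0 * (l 1 * m 2 - l 2 * m 1) +
        polarCoeff A.adjugate c 1 * (l 2 * m 0 - l 0 * m 2) +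
        polarCoeff A.adjugate c 2 * (l 0 * m 1 - l 1 * m 0)) := by
  have h1 := hA.apply 0 1
  have h2 := hA.apply 0 2
  have h3 := hA.apply 1 2
  simp [netInvariant, Fin.sum_univ_succ, invariantWeights, invariantTriples, Matrix.det_fin_three,
    conicMulLin, polarCoeff, Matrix.adjugate_fin_three]
  rw [h1, h2, h3]
  ring

/-- Of the constant 10, a summand 6 comes from θ*(θ) = 6 det A and a summand 4 from the mixed
derivatives of θ and `l`. In particular no nonzero multiple θl is apolar to a nonsingular θ. -/
theorem polarCoeff_conicMulLin (A : Matrix (Fin 3) (Fin 3) R) (hA : A.IsSymm) (l : Fin 3 → R)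
    (j : Fin 3) : polarCoeff A.adjugate (conicMulLin A l) j = 10 * A.det * l j := by
  have h1 := hA.apply 0 1
  have h2 := hA.apply 0 2
  have h3 := hA.apply 1 2
  fin_cases j <;>
  · simp [Matrix.det_fin_three, conicMulLin, polarCoeff, Matrix.adjugate_fin_three]
    rw [h1, h2, h3]
    ring

variable {k : Type*} [Field k]

theorem cubicForm_conicMulLin (A : Matrix (Fin 3) (Fin 3) k) (l : Fin 3 → k) :
    cubicForm (conicMulLin A l) = conicForm A * linForm l := by
  simp [cubicForm, conicMulLin, conicForm, linForm, Fin.sum_univ_succ, cubicMonomials]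
  ring

theorem dualConicApply_cubicForm (A : Matrix (Fin 3) (Fin 3) k) (c : CubicIndex → k) :
    dualConicApply A (cubicForm c) = linForm (polarCoeff A.adjugate c) := by
  rw [dualConicApply]
  generalize A.adjugate = a
  have h2 : (C (2 : k) : MvPolynomial (Fin 3) k) = 2 := map_ofNat C 2
  have h3 : (C (3 : k) : MvPolynomial (Fin 3) k) = 3 := map_ofNat C 3
  have h6 : (C (6 : k) : MvPolynomial (Fin 3) k) = 6 := map_ofNat C 6
  simp only [pderiv_cubicForm]
  simp [quadForm, gradCoeff, polarCoeff, linForm, Fin.sum_univ_succ, quadMonomials, quadIndex,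
    pderiv_X, Pi.single_apply, h2, h3, h6]
  ring

end Apolar

/-! ### The maximal minors of a matrix with one more column than rows -/

section Minors

variable {ρ κ R : Type*} [Fintype κ] [DecidableEq κ] [CommRing R]

/-- The square matrix obtained by adding a row `y` to the rows of `N`. -/
def bordered (e : Option ρ ≃ κ) (N : ρ → κ → R) (y : κ → R) : Matrix κ κ R :=
  Matrix.of fun r => (e.symm r).elim y N

/-- The signed maximal minors of `N`. -/
def signedMinors (e : Option ρ ≃ κ) (N : ρ → κ → R) (c : κ) : R :=
  (bordered e N (Pi.single c 1)).det

/-- The cofactors along the added row do not see `y`, so one vector of minors serves for every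
choice of that row. -/
theorem adjugate_bordered (e : Option ρ ≃ κ) (N : ρ → κ → R) (y : κ → R) (c : κ) :
    (bordered e N y).adjugate c (e none) = signedMinors e N c := by
  rw [Matrix.adjugate_apply, signedMinors]
  congr 1
  ext r s
  by_cases hr : r = e none
  · subst hr
    simp [bordered]
  · rw [Matrix.updateRow_ne hr]
    have : ∃ r', r = e (some r') := by
      rcases h : e.symm r with _ | r'
      · exact absurd ((Equiv.symm_apply_eq e).1 h) hr
      · exact ⟨r', (Equiv.symm_apply_eq e).1 h⟩
    obtain ⟨r', rfl⟩ := this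
    simp [bordered]

theorem sum_mul_signedMinors (e : Option ρ ≃ κ) (N : ρ → κ → R) (y : κ → R) :
    ∑ c, y c * signedMinors e N c = (bordered e N y).det := by
  have h := congrFun (congrFun (Matrix.mul_adjugate (bordered e N y)) (e none)) (e none)
  rw [Matrix.mul_apply] at h
  simp only [adjugate_bordered] at h
  simpa [bordered] using h

theorem equations_signedMinors (e : Option ρ ≃ κ) (N : ρ → κ → R) (r : ρ) :
    ∑ c, N r c * signedMinors e N c = 0 := by
  have h := congrFun (congrFun (Matrix.mul_adjugate (bordered e N 0)) (e (some r))) (e none)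
  rw [Matrix.mul_apply] at h
  simp only [adjugate_bordered] at h
  simpa [bordered] using h

/-- Cramer's rule without a rank assumption: the matrix bordered by the unit row at `a` sends a
solution `x` to `x a` times a unit vector; apply the adjugate. -/
theorem signedMinors_proportional (e : Option ρ ≃ κ) (N : ρ → κ → R) (x : κ → R)
    (hx : ∀ r, ∑ c, N r c * x c = 0) (a b : κ) :
    signedMinors e N a * x b = x a * signedMinors e N b := by
  let y : κ → R := Pi.single a 1
  have h1 : (bordered e N y).mulVec x = Pi.single (e none) (x a) := by
    ext r
    obtain ⟨o, rfl⟩ := e.surjective r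
    rcases o with _ | r
    · simp [bordered, Matrix.mulVec, dotProduct, y, Pi.single_apply]
    · simpa [bordered, Matrix.mulVec, dotProduct] using hx r
  have h2 := congrArg (fun v => (bordered e N y).adjugate.mulVec v b) h1
  simp only [Matrix.mulVec_mulVec, Matrix.adjugate_mul] at h2
  rw [Matrix.mulVec_single, Matrix.smul_mulVec, Matrix.one_mulVec] at h2
  simp only [Pi.smul_apply, Matrix.col_apply, adjugate_bordered, smul_eq_mul,
      MulOpposite.smul_eq_mul_unop, MulOpposite.unop_op] at h2
  rw [← sum_mul_signedMinors] at h2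
  simp only [y, Pi.single_apply, ite_mul, one_mul, zero_mul, Finset.sum_ite_eq', Finset.mem_univ,
    if_true] at h2
  rw [h2, mul_comm]

/-- If the minor at `a` were zero, the bordered matrix would have a kernel vector: a solution with
vanishing `a`-th coordinate. It would be a multiple of `x`, hence zero. -/
theorem signedMinors_ne_zero {k : Type*} [Field k] (e : Option ρ ≃ κ) (N : ρ → κ → k) (x : κ → k)
    {a : κ} (ha : x a ≠ 0)
    (h : ∀ y : κ → k, (∀ r, ∑ c, N r c * y c = 0) → ∃ c : k, y = c • x) :
    signedMinors e N a ≠ 0 := by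
  intro h0
  obtain ⟨v, hv0, hv⟩ := Matrix.exists_mulVec_eq_zero_iff.2 h0
  have h1 : ∀ r, ∑ c, N r c * v c = 0 := fun r => by
    simpa [bordered, Matrix.mulVec, dotProduct] using congrFun hv (e (some r))
  have h2 : v a = 0 := by
    simpa [bordered, Matrix.mulVec, dotProduct, Pi.single_apply] using congrFun hv (e none)
  obtain ⟨c, rfl⟩ := h v h1
  rw [Pi.smul_apply, smul_eq_mul, mul_eq_zero, or_iff_left ha] at h2
  exact hv0 (by rw [h2, zero_smul])

theorem map_signedMinors {S : Type*} [CommRing S] (f : R →+* S) (e : Option ρ ≃ κ)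
    (N : ρ → κ → R) (c : κ) :
    f (signedMinors e N c) = signedMinors e (fun r c => f (N r c)) c := by
  rw [signedMinors, signedMinors, RingHom.map_det]
  congr 1
  ext r s
  rcases h : e.symm r with _ | r'
  · simp only [bordered, RingHom.mapMatrix_apply, Matrix.map_apply, Matrix.of_apply, h,
      Option.elim, Pi.single_apply]
    split_ifs <;> simp
  · simp [bordered, h]

end Minors

/-! ### The vector field singular at seven points -/

section Universal

variable {R : Type*} [CommRing R]

theorem map_fieldCoeff {S : Type*} [CommRing S] (f : R →+* S) (q : Fin 15 → R) (j : Fin 3)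
    (h : Fin 6) : f (fieldCoeff q j h) = fieldCoeff (fun b => f (q b)) j h := by
  fin_cases j <;> fin_cases h <;> simp [fieldCoeff]

theorem fieldCoeff_eq_sum (q : Fin 15 → R) (j : Fin 3) (h : Fin 6) :
    fieldCoeff q j h = ∑ b, fieldCoeff (Pi.single b (1 : R)) j h * q b := by
  fin_cases j <;> fin_cases h <;> simp [fieldCoeff, Pi.single_apply]

theorem map_fieldForm {S : Type*} [CommRing S] (f : R →+* S) (q : Fin 15 → R) :
    map f (fieldForm q) = fieldForm fun b => f (q b) := by
  rw [fieldForm, fieldForm, detForm, detForm, RingHom.map_det]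
  congr 1
  ext1 r c
  fin_cases r
  · simp
  · simp
  · simp [quadForm, map_fieldCoeff, map_rename, map_quadMonomials]

/-- The linear equations for a quadratic vector field `Q` and scalars `λᵢ` that express
`Q(pᵢ) = λᵢ pᵢ`. -/
def fieldEquations (p : Fin 7 → Fin 3 → R) (r : Fin 7 × Fin 3) : Fin 15 ⊕ Fin 7 → R :=
  Sum.elim (fun b => ∑ h, fieldCoeff (Pi.single b (1 : R)) r.2 h * quadMonomials (p r.1) h)
    fun i => if i = r.1 then -p r.1 r.2 else 0

theorem fieldEquations_iff (p : Fin 7 → Fin 3 → R) (x : Fin 15 ⊕ Fin 7 → R) (r : Fin 7 × Fin 3) :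
    ∑ c, fieldEquations p r c * x c = 0 ↔
      ∑ h, fieldCoeff (fun b => x (.inl b)) r.2 h * quadMonomials (p r.1) h =
        x (.inr r.1) * p r.1 r.2 := by
  rw [Fintype.sum_sum_type]
  have h1 : ∑ b, fieldEquations p r (.inl b) * x (.inl b) =
      ∑ h, fieldCoeff (fun b => x (.inl b)) r.2 h * quadMonomials (p r.1) h := by
    simp only [fieldEquations, Sum.elim_inl]
    simp only [Finset.sum_mul]
    rw [Finset.sum_comm]
    refine Finset.sum_congr rfl fun h _ => ?_
    rw [fieldCoeff_eq_sum (fun b => x (.inl b)), Finset.sum_mul]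
    exact Finset.sum_congr rfl fun b _ => by ring
  have h2 : ∑ i, fieldEquations p r (.inr i) * x (.inr i) = -(x (.inr r.1) * p r.1 r.2) := by
    simp only [fieldEquations, Sum.elim_inr, ite_mul, zero_mul, Finset.sum_ite_eq',
      Finset.mem_univ, if_true]
    ring
  rw [h1, h2, ← sub_eq_add_neg, sub_eq_zero]

/-- An enumeration of the unknowns by the equations and one more index. -/
def fieldEquiv : Option (Fin 7 × Fin 3) ≃ Fin 15 ⊕ Fin 7 := Fintype.equivOfCardEq (by simp)

/-- The coefficients of the quadratic vector field singular at the points `p`. -/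
def universalField (p : Fin 7 → Fin 3 → R) (b : Fin 15) : R :=
  signedMinors fieldEquiv (fieldEquations p) (.inl b)

theorem map_universalField {S : Type*} [CommRing S] (f : R →+* S) (p : Fin 7 → Fin 3 → R)
    (b : Fin 15) : f (universalField p b) = universalField (fun i j => f (p i j)) b := by
  rw [universalField, universalField, map_signedMinors]
  congr 1
  funext r c
  rcases c with c | c
  · simp only [fieldEquations, Sum.elim_inl, map_sum, map_mul, map_quadMonomials, map_fieldCoeff]
    refine Finset.sum_congr rfl fun h _ => ?_
    congr 2
    funext b'
    simp only [Pi.single_apply]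
    split_ifs <;> simp
  · simp only [fieldEquations, Sum.elim_inr]
    split_ifs <;> simp

theorem fieldCubic_eval_eq_zero (q : Fin 15 → R) (v : Fin 3 → R) (t : R)
    (h : ∀ j, ∑ h, fieldCoeff q j h * quadMonomials v h = t * v j) (j : Fin 3) :
    ∑ m, fieldCubic q j m * cubicMonomials v m = 0 := by
  rw [← eval_cubicForm]
  obtain ⟨h0, h1, h2⟩ := cubicForm_fieldCubic q
  fin_cases j
  · simp only [Fin.zero_eta, h0, map_sub, map_mul, eval_X, eval_quadForm, h]
    ring
  · simp only [Fin.mk_one, h1, map_sub, map_mul, eval_X, eval_quadForm, h]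
    ring
  · simp only [Fin.reduceFinMk, h2, map_sub, map_mul, eval_X, eval_quadForm, h]
    ring

theorem universalField_eval_eq_zero (p : Fin 7 → Fin 3 → R) (i : Fin 7) (j : Fin 3) :
    ∑ m, fieldCubic (universalField p) j m * cubicMonomials (p i) m = 0 := by
  refine fieldCubic_eval_eq_zero _ _ (signedMinors fieldEquiv (fieldEquations p) (.inr i)) ?_ j
  intro j
  exact (fieldEquations_iff p (signedMinors fieldEquiv (fieldEquations p)) (i, j)).1
    (equations_signedMinors _ _ _)

theorem universalField_isMultihomogeneous (k : Type*) [Field k] (b : Fin 15) :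
    IsMultihomogeneous (universalField (genericPoint k) b) fun _ => 5 := by
  intro i
  rw [universalField, signedMinors]
  -- The three rows of the point `i` count 2 each, the column of λ_i counts -1 and the added row 0.
  -- The total is 3·2 - 1 = 5.
  refine det_isWeightedHomogeneous (a := fun r => (fieldEquiv.symm r).elim 0
    fun r => if r.1 = i then 2 else 0) (b := fun c => if c = .inr i then 1 else 0) ?_ ?_
  · intro r c
    rcases h : fieldEquiv.symm r with _ | r'
    · simp only [bordered, Matrix.of_apply, h, Option.elim, Pi.single_apply]
      split_ifs with h1 h2
      · simp [h1] at h2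
      · exact Or.inr ⟨0, rfl, isWeightedHomogeneous_one _ _⟩
      · exact Or.inl rfl
      · exact Or.inl rfl
    · simp only [bordered, Matrix.of_apply, h, Option.elim]
      rcases c with c | c
      · right
        refine ⟨_, add_zero _, ?_⟩
        simp only [fieldEquations, Sum.elim_inl]
        refine IsWeightedHomogeneous.sum _ _ _ fun h _ => ?_
        have h1 : fieldCoeff (Pi.single c (1 : CoordRing k)) r'.2 h =
            C (fieldCoeff (Pi.single c (1 : k)) r'.2 h) := by
          rw [map_fieldCoeff]
          congr 1
          funext b'
          simp only [Pi.single_apply]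
          split_ifs <;> simp
        rw [h1]
        have h2 := (isWeightedHomogeneous_X k (fun a : Fin 7 × Fin 3 => if a.1 = i then 1 else 0)
          (r'.1, (quadIndex h).1)).mul (isWeightedHomogeneous_X k
            (fun a : Fin 7 × Fin 3 => if a.1 = i then 1 else 0) (r'.1, (quadIndex h).2))
        have h3 := h2.C_mul (fieldCoeff (Pi.single c (1 : k)) r'.2 h)
        have h4 : ((if r'.1 = i then 1 else 0) + if r'.1 = i then 1 else 0) =
            if r'.1 = i then 2 else 0 := by split_ifs <;> rfl
        rw [← h4]
        exact h3
      · simp only [fieldEquations, Sum.elim_inr]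
        split_ifs with h1 h2 h3 h3
        · right
          refine ⟨1, rfl, ?_⟩
          have := isWeightedHomogeneous_X k (fun a : Fin 7 × Fin 3 => if a.1 = i then 1 else 0) r'
          rw [if_pos h3] at this
          exact this.neg
        · exact absurd (Sum.inr_injective h2) (h1 ▸ h3)
        · exact absurd (by rw [h1, h3]) h2
        · right
          refine ⟨0, rfl, ?_⟩
          have := isWeightedHomogeneous_X k (fun a : Fin 7 × Fin 3 => if a.1 = i then 1 else 0) r'
          rw [if_neg h3] at this
          exact this.neg
        all_goals exact Or.inl rfl
  · rw [Equiv.sum_comp fieldEquiv.symm fun r => Option.elim r 0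
      fun r : Fin 7 × Fin 3 => if r.1 = i then 2 else 0, Fintype.sum_option, Fintype.sum_prod_type,
      Finset.sum_comm]
    simp

end Universal

/-! ### Ideals of points -/

section PointsIdeal

variable {k : Type*} [Field k]

theorem mem_pointsIdeal_iff {n d : ℕ} {p : Fin n → Fin 3 → k} {f : MvPolynomial (Fin 3) k}
    (hf : f.IsHomogeneous d) : f ∈ pointsIdeal p ↔ ∀ i, eval (p i) f = 0 := by
  constructor
  · intro h i
    have := h (p i) ⟨i, 1, by simp⟩
    rwa [aeval_eq_eval] at this
  · rintro h _ ⟨i, t, rfl⟩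
    rw [aeval_eq_eval]
    have := eval_weight_smul hf t (p i)
    simp only [Pi.one_apply, pow_one, h i, mul_zero] at this
    exact this

/-- A common prime factor of these two linear forms through `v` would be linear and make them
proportional, which they are not because `v j ≠ 0`. Indices are modulo 3. -/
theorem not_dvd_both_linear {b : MvPolynomial (Fin 3) k} (hb : Prime b) {v : Fin 3 → k}
    {j : Fin 3} (hj : v j ≠ 0) :
    ¬ (b ∣ C (v j) * X (j + 1) - C (v (j + 1)) * X j ∧
      b ∣ C (v j) * X (j + 2) - C (v (j + 2)) * X j) := by
  rintro ⟨⟨g, hg⟩, g', hg'⟩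
  have h1 : (C (v j) * X (j + 1) - C (v (j + 1)) * X j : MvPolynomial (Fin 3) k).IsHomogeneous 1 :=
    ((isHomogeneous_X k _).C_mul _).sub ((isHomogeneous_X k _).C_mul _)
  have h2 : (C (v j) * X (j + 2) - C (v (j + 2)) * X j : MvPolynomial (Fin 3) k).IsHomogeneous 1 :=
    ((isHomogeneous_X k _).C_mul _).sub ((isHomogeneous_X k _).C_mul _)
  have e1 : j ≠ j + 1 := by fin_cases j <;> decide
  have e2 : j ≠ j + 2 := by fin_cases j <;> decide
  have n1 : (C (v j) * X (j + 1) - C (v (j + 1)) * X j : MvPolynomial (Fin 3) k) ≠ 0 := by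
    intro h
    have := congrArg (eval (Pi.single (j + 1) 1)) h
    simp [e1, hj] at this
  have n2 : (C (v j) * X (j + 2) - C (v (j + 2)) * X j : MvPolynomial (Fin 3) k) ≠ 0 := by
    intro h
    have := congrArg (eval (Pi.single (j + 2) 1)) h
    simp [e2, hj] at this
  have key : ∀ {f g : MvPolynomial (Fin 3) k}, f.IsHomogeneous 1 → f ≠ 0 → f = b * g →
      ∃ c, g = C c := by
    intro f g hf hf0 hfg
    rw [hfg] at hf hf0
    obtain ⟨a, c, hac, ha, hc⟩ := isHomogeneous_factor hf hf0
    rcases Nat.eq_zero_or_pos a with h | h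
    · exact absurd (isUnit_of_isHomogeneous_zero (h ▸ ha) hb.ne_zero) hb.not_isUnit
    · have : c = 0 := by omega
      exact exists_eq_C_of_isHomogeneous_zero (this ▸ hc)
  obtain ⟨c, rfl⟩ := key h1 n1 hg
  obtain ⟨c', rfl⟩ := key h2 n2 hg'
  have h3 : C c' * (C (v j) * X (j + 1) - C (v (j + 1)) * X j) =
      C c * (C (v j) * X (j + 2) - C (v (j + 2)) * X j) := by
    rw [hg, hg']
    ring
  have h4 := congrArg (eval (Pi.single (j + 1) 1)) h3
  simp [e1, hj] at h4
  rw [h4, C_0, mul_zero] at hg'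
  exact n2 hg'

/-- The witness is a product of linear forms, one through each point, none divisible by `b`. Hence
generators of the ideal of the points have no common factor. -/
theorem exists_mem_pointsIdeal_not_dvd {n : ℕ} {p : Fin n → Fin 3 → k} (hp : ∀ i, p i ≠ 0)
    {b : MvPolynomial (Fin 3) k} (hb : Prime b) : ∃ f ∈ pointsIdeal p, ¬ b ∣ f := by
  have h : ∀ i, ∃ l : MvPolynomial (Fin 3) k, l.IsHomogeneous 1 ∧ eval (p i) l = 0 ∧ ¬ b ∣ l := by
    intro i
    obtain ⟨j, hj⟩ := Function.ne_iff.1 (hp i)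
    by_cases h1 : b ∣ C (p i j) * X (j + 1) - C (p i (j + 1)) * X j
    · refine ⟨_, ((isHomogeneous_X k (j + 2)).C_mul (p i j)).sub
        ((isHomogeneous_X k j).C_mul (p i (j + 2))), ?_,
        fun h2 => not_dvd_both_linear hb hj ⟨h1, h2⟩⟩
      simp [mul_comm]
    · refine ⟨_, ((isHomogeneous_X k (j + 1)).C_mul (p i j)).sub
        ((isHomogeneous_X k j).C_mul (p i (j + 1))), ?_, h1⟩
      simp [mul_comm]
  choose l hl hl0 hlb using h
  refine ⟨∏ i, l i, ?_, ?_⟩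
  · rintro _ ⟨i, t, rfl⟩
    rw [map_prod]
    refine Finset.prod_eq_zero (Finset.mem_univ i) ?_
    rw [aeval_eq_eval]
    have := eval_weight_smul (hl i) t (p i)
    simp only [Pi.one_apply, pow_one, hl0 i, mul_zero] at this
    exact this
  · rw [hb.dvd_finsetProd_iff]
    rintro ⟨i, _, hi⟩
    exact hlb i hi

/-- The maximal minors of a `2 × 3` matrix. -/
def maxMinors (L θ : Fin 3 → MvPolynomial (Fin 3) k) : Fin 3 → MvPolynomial (Fin 3) k :=
  ![L 1 * θ 2 - L 2 * θ 1, L 2 * θ 0 - L 0 * θ 2, L 0 * θ 1 - L 1 * θ 0]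

theorem span_range_maxMinors (L θ : Fin 3 → MvPolynomial (Fin 3) k) :
    Ideal.span (Set.range (maxMinors L θ)) =
      Ideal.span {L 1 * θ 2 - L 2 * θ 1, L 2 * θ 0 - L 0 * θ 2, L 0 * θ 1 - L 1 * θ 0} := by
  congr 1
  ext f
  simp [maxMinors]
  tauto

theorem isUnit_of_dvd_maxMinors {n : ℕ} {p : Fin n → Fin 3 → k} (hp : ∀ i, p i ≠ 0)
    {L θ : Fin 3 → MvPolynomial (Fin 3) k} (h : IsHilbertBurchMatrix p L θ)
    {b : MvPolynomial (Fin 3) k} (hb : ∀ a, b ∣ maxMinors L θ a) : IsUnit b := by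
  have key : ∀ c : MvPolynomial (Fin 3) k, Prime c → ¬ ∀ a, c ∣ maxMinors L θ a := by
    intro c hc hdvd
    obtain ⟨f, hf, hcf⟩ := exists_mem_pointsIdeal_not_dvd hp hc
    rw [← h.2.2, ← span_range_maxMinors] at hf
    refine hcf (Ideal.mem_span_singleton.1 ((Ideal.span_le.2 ?_) hf))
    rintro _ ⟨a, rfl⟩
    exact Ideal.mem_span_singleton.2 (hdvd a)
  by_contra hu
  by_cases hb0 : b = 0
  · refine key (X 0) MvPolynomial.X_prime fun a => ?_
    have := hb a
    rw [hb0, zero_dvd_iff] at this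
    rw [this]
    exact dvd_zero _
  · obtain ⟨c, hc, hcb⟩ := WfDvdMonoid.exists_irreducible_factor hu hb0
    exact key c hc.prime fun a => hcb.trans (hb a)

/-- The gcd of the three products is `r` times the gcd of the `m j`, a unit. Only a factor common to
all three `m j` is excluded; two of them may share one. -/
theorem dvd_of_dvd_mul_of_coprime {α : Type*} [CommRing α] [IsDomain α]
    [UniqueFactorizationMonoid α] {a r : α} {m : Fin 3 → α}
    (hm : ∀ b, (∀ j, b ∣ m j) → IsUnit b) (h : ∀ j, a ∣ r * m j) : a ∣ r := by
  classical
  let _ := UniqueFactorizationMonoid.toGCDMonoid α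
  have h1 : a ∣ gcd (r * m 0) (gcd (r * m 1) (r * m 2)) := dvd_gcd (h 0) (dvd_gcd (h 1) (h 2))
  have h2 : Associated (gcd (r * m 1) (r * m 2)) (r * gcd (m 1) (m 2)) := gcd_mul_left' r _ _
  have h3 : Associated (gcd (r * m 0) (r * gcd (m 1) (m 2))) (r * gcd (m 0) (gcd (m 1) (m 2))) :=
    gcd_mul_left' r _ _
  have h4 : a ∣ r * gcd (m 0) (gcd (m 1) (m 2)) :=
    h3.dvd_iff_dvd_right.1 (h1.trans (dvd_gcd (gcd_dvd_left _ _)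
      ((gcd_dvd_right _ _).trans h2.dvd)))
  have h5 : IsUnit (gcd (m 0) (gcd (m 1) (m 2))) := by
    refine hm _ fun j => ?_
    fin_cases j
    · exact gcd_dvd_left _ _
    · exact (gcd_dvd_right _ _).trans (gcd_dvd_left _ _)
    · exact (gcd_dvd_right _ _).trans (gcd_dvd_right _ _)
  exact (h5.dvd_mul_right).1 h4

theorem eq_zero_of_dvd_of_lt {f g : MvPolynomial (Fin 3) k} {m n : ℕ} (hf : f.IsHomogeneous m)
    (hg : g.IsHomogeneous n) (hmn : n < m) (h : f ∣ g) : g = 0 := by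
  by_contra h0
  obtain ⟨c, rfl⟩ := h
  obtain ⟨a, b, hab, ha, _⟩ := isHomogeneous_factor hg h0
  have := ha.inj_right hf (left_ne_zero_of_mul h0)
  omega

/-- The linear syzygies of the maximal minors of a Hilbert–Burch matrix are the multiples of its
first row. -/
theorem linear_syzygy {n : ℕ} {p : Fin n → Fin 3 → k} (hp : ∀ i, p i ≠ 0)
    {L θ : Fin 3 → MvPolynomial (Fin 3) k} (h : IsHilbertBurchMatrix p L θ)
    (hm0 : ∀ a, maxMinors L θ a ≠ 0) {N : Fin 3 → MvPolynomial (Fin 3) k}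
    (hN : ∀ a, (N a).IsHomogeneous 1) (hs : ∑ a, N a * maxMinors L θ a = 0) :
    ∃ c : k, ∀ a, N a = C c * L a := by
  have hco : ∀ b, (∀ j, b ∣ maxMinors L θ j) → IsUnit b := fun b hb =>
      isUnit_of_dvd_maxMinors hp h hb
  obtain ⟨hL, hθ, -⟩ := h
  have hmh : ∀ a, (maxMinors L θ a).IsHomogeneous 3 := by
    intro a
    fin_cases a
    · exact ((hL 1).mul (hθ 2)).sub ((hL 2).mul (hθ 1))
    · exact ((hL 2).mul (hθ 0)).sub ((hL 0).mul (hθ 2))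
    · exact ((hL 0).mul (hθ 1)).sub ((hL 1).mul (hθ 0))
  have hs' : N 0 * (L 1 * θ 2 - L 2 * θ 1) + N 1 * (L 2 * θ 0 - L 0 * θ 2) +
      N 2 * (L 0 * θ 1 - L 1 * θ 0) = 0 := by
    rw [← hs, Fin.sum_univ_three]
    rfl
  -- Both `N` and `L` are orthogonal to the vector m of minors, so N × L is parallel to m. The
  -- entries of m are coprime, so each divides the corresponding entry of N × L; the degrees are 3
  -- and 2, so the latter is zero.
  have hcross : ∀ a, maxMinors N L a = 0 := by
    intro a
    refine eq_zero_of_dvd_of_lt (hmh a) (n := 2) ?_ (by norm_num)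
      (dvd_of_dvd_mul_of_coprime hco fun j => ⟨maxMinors N L j, ?_⟩)
    · fin_cases a
      · exact ((hN 1).mul (hL 2)).sub ((hN 2).mul (hL 1))
      · exact ((hN 2).mul (hL 0)).sub ((hN 0).mul (hL 2))
      · exact ((hN 0).mul (hL 1)).sub ((hN 1).mul (hL 0))
    · fin_cases a <;> fin_cases j <;> simp [maxMinors]
      · ring
      · linear_combination (L 2) * hs'
      · linear_combination -(L 1) * hs'
      · linear_combination -(L 2) * hs'
      · ring
      · linear_combination (L 0) * hs'
      · linear_combination (L 1) * hs'
      · linear_combination -(L 0) * hs'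
      · ring
  have hpar : ∀ a b, N a * L b = N b * L a := by
    have h0 : N 1 * L 2 - N 2 * L 1 = 0 := hcross 0
    have h1 : N 2 * L 0 - N 0 * L 2 = 0 := hcross 1
    have h2 : N 0 * L 1 - N 1 * L 0 = 0 := hcross 2
    intro a b
    fin_cases a <;> fin_cases b <;> simp
    · linear_combination h2
    · linear_combination -h1
    · linear_combination -h2
    · linear_combination h0
    · linear_combination h1
    · linear_combination -h0
  -- A common factor of the `L j` would divide every minor. Since `L` is thus primitive, the
  -- parallel vector `N` of the same degree is a constant multiple of it.
  have hcoL : ∀ b, (∀ j, b ∣ L j) → IsUnit b := by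
    intro b hb
    refine hco b fun j => ?_
    fin_cases j
    · exact dvd_sub ((hb 1).mul_right _) ((hb 2).mul_right _)
    · exact dvd_sub ((hb 2).mul_right _) ((hb 0).mul_right _)
    · exact dvd_sub ((hb 0).mul_right _) ((hb 1).mul_right _)
  obtain ⟨a, ha⟩ : ∃ a, L a ≠ 0 := by
    by_contra! hL0
    exact hm0 0 (by simp [maxMinors, hL0])
  obtain ⟨g, hg⟩ : L a ∣ N a := dvd_of_dvd_mul_of_coprime hcoL fun j => ⟨N j, by
    rw [hpar a j, mul_comm]⟩
  have hgc : ∃ c, g = C c := by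
    by_cases hN0 : N a = 0
    · refine ⟨0, ?_⟩
      rw [hN0, eq_comm, mul_eq_zero, or_iff_right ha] at hg
      rw [hg, C_0]
    · have hNa := hN a
      rw [hg] at hN0 hNa
      obtain ⟨u, v, huv, hu, hv⟩ := isHomogeneous_factor hNa hN0
      have hu1 : u = 1 := hu.inj_right (hL a) ha
      have : v = 0 := by omega
      exact exists_eq_C_of_isHomogeneous_zero (this ▸ hv)
  obtain ⟨c, rfl⟩ := hgc
  refine ⟨c, fun j => mul_right_cancel₀ ha ?_⟩
  rw [hpar j a, hg]
  ring

/-- In any representation of `f`, replace the coefficients by their components of degree `n`. -/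
theorem exists_homogeneous_coeffs {ι : Type*} [Fintype ι] {m : ι → MvPolynomial (Fin 3) k}
    {d : ℕ} (hm : ∀ a, (m a).IsHomogeneous d) {f : MvPolynomial (Fin 3) k} {n : ℕ}
    (hf : f.IsHomogeneous (n + d)) (h : f ∈ Ideal.span (Set.range m)) :
    ∃ g : ι → MvPolynomial (Fin 3) k, (∀ a, (g a).IsHomogeneous n) ∧ f = ∑ a, g a * m a := by
  obtain ⟨c, hc⟩ := Ideal.mem_span_range_iff_exists_fun.1 h
  refine ⟨fun a => (weightScale 1 (c a)).coeff n, fun a => ?_, ?_⟩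
  · intro e he
    rw [coeff_weightScale] at he
    by_contra hne
    rw [if_neg hne] at he
    exact he rfl
  · have h1 := congrArg (fun g => (weightScale (1 : Fin 3 → ℕ) g).coeff (n + d)) hc
    simp only [map_sum, map_mul] at h1
    rw [weightScale_eq_iff.1 hf, Polynomial.coeff_C_mul_X_pow, if_pos rfl,
      Polynomial.finsetSum_coeff] at h1
    rw [← h1]
    refine Finset.sum_congr rfl fun a _ => ?_
    rw [weightScale_eq_iff.1 (hm a), ← mul_assoc, Polynomial.coeff_mul_X_pow,
      Polynomial.coeff_mul_C]

end PointsIdeal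

/-! ### The form `S` from a Hilbert–Burch matrix -/

section HilbertBurch

theorem fieldCubic_sum_X {R : Type*} [CommRing R] (q : Fin 15 → R) :
    ∑ j, X j * cubicForm (fieldCubic q j) = 0 := by
  obtain ⟨h0, h1, h2⟩ := cubicForm_fieldCubic q
  rw [Fin.sum_univ_three, h0, h1, h2]
  ring

/-- The cross product X × Q determines Q up to adding ℓ(X) X with ℓ linear. The normalization of
`fieldCoeff`, which bans X₂ from the third component, selects one field of each class. -/
theorem fieldCubic_injective {R : Type*} [CommRing R] :
    Function.Injective (fieldCubic (R := R)) := by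
  intro q q' h
  have h0 : ∀ m, fieldCubic q 0 m = fieldCubic q' 0 m := fun m => by rw [h]
  have h1 : ∀ m, fieldCubic q 1 m = fieldCubic q' 1 m := fun m => by rw [h]
  have a1 := h0 (.inl 1)
  have a2 := h0 (.inl 2)
  have a3 := h0 (.inl 3)
  have a4 := h0 (.inl 4)
  have a5 := h0 (.inl 5)
  have a6 := h0 (.inl 6)
  have a7 := h0 (.inr 0)
  have a8 := h0 (.inr 1)
  have a9 := h0 (.inr 2)
  have b2 := h1 (.inl 2)
  have b4 := h1 (.inl 4)
  have b5 := h1 (.inl 5)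
  have b6 := h1 (.inl 6)
  have b8 := h1 (.inr 1)
  have b9 := h1 (.inr 2)
  simp [fieldCubic] at *
  funext b
  fin_cases b <;> assumption

/-- The exponents of the fifteen quartic monomials. -/
def quarticExponents : Fin 15 → Fin 3 → ℕ :=
  ![![4, 0, 0], ![0, 4, 0], ![0, 0, 4], ![3, 1, 0], ![3, 0, 1], ![1, 3, 0], ![0, 3, 1], ![1, 0, 3],
    ![0, 1, 3], ![2, 2, 0], ![2, 0, 2], ![0, 2, 2], ![2, 1, 1], ![1, 2, 1], ![1, 1, 2]]

theorem quarticExponents_injective : Function.Injective quarticExponents := by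
  decide

/-- Three cubics `C` with `∑ Xⱼ Cⱼ = 0` are the components of `X × Q` for a vector field `Q`. -/
theorem exists_fieldCubic {R : Type*} [CommRing R] (d : Fin 3 → CubicIndex → R)
    (h : ∑ j, X j * cubicForm (d j) = 0) : ∃ q, fieldCubic q = d := by
  -- The coefficients of the quartic ∑ Xⱼ Cⱼ, in the order of `quarticExponents`.
  let c : Fin 15 → R := ![d 0 (.inl 0), d 1 (.inl 1), d 2 (.inl 2), d 0 (.inl 3) + d 1 (.inl 0),
    d 0 (.inl 4) + d 2 (.inl 0), d 0 (.inl 1) + d 1 (.inr 0), d 1 (.inl 5) + d 2 (.inl 1),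
    d 0 (.inl 2) + d 2 (.inr 1), d 1 (.inl 2) + d 2 (.inr 2), d 0 (.inr 0) + d 1 (.inl 3),
    d 0 (.inr 1) + d 2 (.inl 4), d 1 (.inr 2) + d 2 (.inl 5),
    d 0 (.inl 6) + d 1 (.inl 4) + d 2 (.inl 3), d 0 (.inl 5) + d 1 (.inl 6) + d 2 (.inr 0),
    d 0 (.inr 2) + d 1 (.inr 1) + d 2 (.inl 6)]
  have h1 : ∑ e, C (c e) * ∏ s, X s ^ quarticExponents e s = 0 := by
    rw [← h]
    simp [c, Fin.sum_univ_succ, Fin.prod_univ_succ, quarticExponents, cubicForm, cubicMonomials]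
    ring
  have hc : ∀ e, c e = 0 := fun e => by
    rw [← coeff_sum_monomials quarticExponents_injective c e, h1, coeff_zero]
  have e0 : d 0 (.inl 0) = 0 := hc 0
  have e1 : d 1 (.inl 1) = 0 := hc 1
  have e2 : d 2 (.inl 2) = 0 := hc 2
  have e3 : d 0 (.inl 3) + d 1 (.inl 0) = 0 := hc 3
  have e4 : d 0 (.inl 4) + d 2 (.inl 0) = 0 := hc 4
  have e5 : d 0 (.inl 1) + d 1 (.inr 0) = 0 := hc 5
  have e6 : d 1 (.inl 5) + d 2 (.inl 1) = 0 := hc 6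
  have e7 : d 0 (.inl 2) + d 2 (.inr 1) = 0 := hc 7
  have e8 : d 1 (.inl 2) + d 2 (.inr 2) = 0 := hc 8
  have e9 : d 0 (.inr 0) + d 1 (.inl 3) = 0 := hc 9
  have e10 : d 0 (.inr 1) + d 2 (.inl 4) = 0 := hc 10
  have e11 : d 1 (.inr 2) + d 2 (.inl 5) = 0 := hc 11
  have e12 : d 0 (.inl 6) + d 1 (.inl 4) + d 2 (.inl 3) = 0 := hc 12
  have e13 : d 0 (.inl 5) + d 1 (.inl 6) + d 2 (.inr 0) = 0 := hc 13
  have e14 : d 0 (.inr 2) + d 1 (.inr 1) + d 2 (.inl 6) = 0 := hc 14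
  -- With the third component of Q free of X₂, the terms divisible by X₂ in C₁ = X₂Q₀ - X₀Q₂ and in
  -- C₀ = X₁Q₂ - X₂Q₁ give Q₀ and -Q₁; the other terms of C₀ give Q₂.
  refine ⟨![d 1 (.inl 4), d 1 (.inl 5), d 1 (.inl 2), d 1 (.inl 6), d 1 (.inr 1), d 1 (.inr 2),
    -d 0 (.inl 4), -d 0 (.inl 5), -d 0 (.inl 2), -d 0 (.inl 6), -d 0 (.inr 1), -d 0 (.inr 2),
    d 0 (.inl 3), d 0 (.inl 1), d 0 (.inr 0)], ?_⟩
  funext j m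
  rcases m with m | m <;> fin_cases j <;> fin_cases m <;> simp [fieldCubic] <;> grind

variable {k : Type*} [Field k] [CharZero k]

theorem fieldCoeff_smul {R : Type*} [CommRing R] (a : R) (q : Fin 15 → R) (j : Fin 3) (h : Fin 6) :
    fieldCoeff (fun b => a * q b) j h = a * fieldCoeff q j h := by
  fin_cases j <;> fin_cases h <;> simp [fieldCoeff]

theorem fieldCubic_smul {R : Type*} [CommRing R] (a : R) (q : Fin 15 → R) (j : Fin 3)
    (m : CubicIndex) : fieldCubic (fun b => a * q b) j m = a * fieldCubic q j m := by
  fin_cases j <;> rcases m with m | m <;> fin_cases m <;> simp [fieldCubic] <;> ring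

theorem fieldForm_smul {R : Type*} [CommRing R] (a : R) (q : Fin 15 → R) :
    fieldForm (fun b => a * q b) = C a * fieldForm q := by
  rw [fieldForm_eq, fieldForm_eq, Finset.mul_sum]
  refine Finset.sum_congr rfl fun j _ => ?_
  have : fieldCubic (fun b => a * q b) j = a • fieldCubic q j := by
    funext m
    simp [fieldCubic_smul]
  rw [this, cubicForm_smul, map_mul, rename_C]
  ring

/-- The form `S` computed from the universal vector field agrees, up to a nonzero constant, with
the determinant of any Hilbert–Burch matrix. -/
theorem universalField_eq_detForm {p : Fin 7 → Fin 3 → k} (hp : ∀ i, p i ≠ 0)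
    {L θ : Fin 3 → MvPolynomial (Fin 3) k} (h : IsHilbertBurchMatrix p L θ) :
    ∃ c : k, c ≠ 0 ∧ fieldForm (universalField p) = C c * detForm L θ := by
  have hspan := h.2.2
  rw [← span_range_maxMinors] at hspan
  have hmh : ∀ a, (maxMinors L θ a).IsHomogeneous 3 := by
    intro a
    fin_cases a
    · exact ((h.1 1).mul (h.2.1 2)).sub ((h.1 2).mul (h.2.1 1))
    · exact ((h.1 2).mul (h.2.1 0)).sub ((h.1 0).mul (h.2.1 2))
    · exact ((h.1 0).mul (h.2.1 1)).sub ((h.1 1).mul (h.2.1 0))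
  choose m hm using fun a => exists_cubicForm (hmh a)
  choose l hl using fun a => exists_linForm (h.1 a)
  -- cubics through the points are combinations of the minors
  have hcomb : ∀ c : CubicIndex → k, (∀ i, ∑ e, c e * cubicMonomials (p i) e = 0) →
      ∃ n : Fin 3 → k, c = ∑ a, n a • m a := by
    intro c hc
    have h1 : cubicForm c ∈ Ideal.span (Set.range (maxMinors L θ)) := by
      rw [hspan, mem_pointsIdeal_iff (cubicForm_isHomogeneous c)]
      intro i
      rw [eval_cubicForm, hc]
    obtain ⟨g, hg, hgs⟩ := exists_homogeneous_coeffs hmh (n := 0)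
      (by simpa using cubicForm_isHomogeneous c) h1
    choose n hn using fun a => exists_eq_C_of_isHomogeneous_zero (hg a)
    refine ⟨n, cubicForm_injective ?_⟩
    rw [hgs, Fin.sum_univ_three, Fin.sum_univ_three]
    simp only [cubicForm_add, cubicForm_smul, hn, hm]
  -- Seven points impose at most seven conditions on the ten coefficients of a cubic. The space of
  -- cubics through them, which the three minors span, has dimension at least 3.
  have hind : LinearIndependent k m := by
    rw [linearIndependent_iff_card_le_finrank_span]
    let ev : (CubicIndex → k) →ₗ[k] (Fin 7 → k) :=
      LinearMap.pi fun i => ∑ e, cubicMonomials (p i) e • LinearMap.proj e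
    have h1 := LinearMap.finrank_range_add_finrank_ker ev
    have h2 : Module.finrank k (LinearMap.range ev) ≤ 7 := by
      simpa using Submodule.finrank_le (LinearMap.range ev)
    have h3 : LinearMap.ker ev ≤ Submodule.span k (Set.range m) := by
      intro c hc
      obtain ⟨n, rfl⟩ := hcomb c fun i => by
        have := congrFun (LinearMap.mem_ker.1 hc) i
        simp only [ev, LinearMap.pi_apply, LinearMap.sum_apply, LinearMap.smul_apply,
          LinearMap.proj_apply, smul_eq_mul, Pi.zero_apply] at this
        rw [← this]
        exact Finset.sum_congr rfl fun e _ => mul_comm _ _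
      exact Submodule.sum_mem _ fun a _ =>
        Submodule.smul_mem _ _ (Submodule.subset_span ⟨a, rfl⟩)
    have h4 := Submodule.finrank_mono h3
    have h5 : Module.finrank k (CubicIndex → k) = 10 := by simp
    simp only [Fintype.card_fin, Set.finrank]
    omega
  have hm0 : ∀ a, maxMinors L θ a ≠ 0 := by
    intro a ha
    refine hind.ne_zero a (cubicForm_injective ?_)
    rw [← hm, ha, cubicForm_zero]
  -- These are the coefficients of the ξⱼ in `detForm L θ`. They satisfy ∑ Xⱼ Cⱼ = ∑ L_a m_a = 0, so
  -- they come from a vector field.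
  let d : Fin 3 → CubicIndex → k := fun j => ∑ a, l a j • m a
  have hd : ∀ j, cubicForm (d j) = ∑ a, C (l a j) * maxMinors L θ a := by
    intro j
    simp only [d, Fin.sum_univ_three, cubicForm_add, cubicForm_smul, hm]
  have hLm : ∑ a, L a * maxMinors L θ a = 0 := by
    simp only [Fin.sum_univ_three, maxMinors]
    simp
    ring
  obtain ⟨q, hq⟩ := exists_fieldCubic d (by
    rw [← hLm]
    simp only [hd]
    simp only [hl, linForm, Fin.sum_univ_three]
    ring)
  have hT : detForm L θ = fieldForm q := by
    rw [fieldForm_eq, hq]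
    simp only [hd, detForm, Matrix.det_fin_three, maxMinors, Fin.sum_univ_three]
    have e : ∀ a, rename Sum.inl (L a) = ∑ j, C (l a j) * X (Sum.inl j : Fin 3 ⊕ Fin 3) := by
      intro a
      rw [hl a, linForm, map_sum]
      simp
    simp [e, Fin.sum_univ_three]
    ring
  have hq0 : q ≠ 0 := by
    rintro rfl
    have hd0 : ∀ j, d j = 0 := by
      intro j
      rw [← hq]
      funext e
      have := fieldCubic_smul (0 : k) 0 j e
      simp only [zero_mul] at this
      exact this
    have hl0 : ∀ a, l a = 0 := by
      intro a
      funext j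
      exact Fintype.linearIndependent_iff.1 hind (fun a => l a j) (hd0 j) a
    refine hm0 0 ?_
    simp [maxMinors, hl, hl0, linForm]
  -- The cubics of a solution pass through the points, so they are combinations of the minors. The
  -- identity ∑ Xⱼ Cⱼ = 0 then is a linear syzygy of the minors, hence a multiple of `L`.
  have hker : ∀ x : Fin 15 ⊕ Fin 7 → k, (∀ r, ∑ c, fieldEquations p r c * x c = 0) →
      ∃ c : k, ∀ b, x (.inl b) = c * q b := by
    intro x hx
    choose n hn using fun j => hcomb (fieldCubic (fun b => x (.inl b)) j) fun i =>
      fieldCubic_eval_eq_zero _ _ (x (.inr i)) (fun j => (fieldEquations_iff p x (i, j)).1 (hx (i,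
          j))) j
    have hs : ∑ a, linForm (fun j => n j a) * maxMinors L θ a = 0 := by
      rw [← fieldCubic_sum_X fun b => x (.inl b)]
      simp only [hn, Fin.sum_univ_three, cubicForm_add, cubicForm_smul, hm, linForm]
      ring
    obtain ⟨c, hc⟩ := linear_syzygy hp h hm0 (fun a => linForm_isHomogeneous _) hs
    have hnl : ∀ j a, n j a = c * l a j := by
      intro j a
      have := congrArg (eval (Pi.single j 1)) (hc a)
      rw [hl a, eval_linForm, map_mul, eval_C, eval_linForm] at this
      simpa [Pi.single_apply] using this
    refine ⟨c, fun b => ?_⟩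
    refine congrFun (fieldCubic_injective (a₁ := fun b => x (.inl b)) (a₂ := fun b => c * q b) ?_) b
    funext j e
    rw [fieldCubic_smul, hq, hn j]
    simp [d, hnl, Finset.sum_apply, Finset.mul_sum, mul_assoc]
  -- a kernel vector of the equations that extends `q`
  have hev : ∀ i j, ∑ e, fieldCubic q j e * cubicMonomials (p i) e = 0 := by
    intro i j
    rw [← eval_cubicForm, hq]
    refine (mem_pointsIdeal_iff (cubicForm_isHomogeneous _)).1 ?_ i
    rw [← hspan, hd]
    exact Ideal.sum_mem _ fun a _ => Ideal.mul_mem_left _ _ (Ideal.subset_span ⟨a, rfl⟩)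
  -- The vanishing of X × Q at `p i ≠ 0` says that Q(p_i) is parallel to p_i.
  have hlam : ∀ i, ∃ t : k, ∀ j, ∑ h, fieldCoeff q j h * quadMonomials (p i) h = t * p i j := by
    intro i
    obtain ⟨h0, h1, h2⟩ := cubicForm_fieldCubic q
    have g0 := hev i 0
    have g1 := hev i 1
    have g2 := hev i 2
    rw [← eval_cubicForm] at g0 g1 g2
    simp only [h0, h1, h2, map_sub, map_mul, eval_X, eval_quadForm] at g0 g1 g2
    obtain ⟨j, hj⟩ := Function.ne_iff.1 (hp i)
    refine ⟨(∑ h, fieldCoeff q j h * quadMonomials (p i) h) / p i j, fun j' => ?_⟩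
    rw [div_mul_eq_mul_div, eq_div_iff hj]
    generalize hQ : (fun j => ∑ h, fieldCoeff q j h * quadMonomials (p i) h) = Q at *
    have hQ' : ∀ j, ∑ h, fieldCoeff q j h * quadMonomials (p i) h = Q j := fun j => congrFun hQ j
    simp only [hQ'] at *
    fin_cases j <;> fin_cases j' <;> simp <;> grind
  choose t ht using hlam
  let x : Fin 15 ⊕ Fin 7 → k := Sum.elim q t
  have hx : ∀ r, ∑ c, fieldEquations p r c * x c = 0 := fun r =>
    (fieldEquations_iff p x r).2 (ht r.1 r.2)
  obtain ⟨b, hb⟩ := Function.ne_iff.1 hq0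
  have hker' : ∀ y : Fin 15 ⊕ Fin 7 → k, (∀ r, ∑ c, fieldEquations p r c * y c = 0) →
      ∃ c : k, y = c • x := by
    intro y hy
    obtain ⟨c, hc⟩ := hker y hy
    refine ⟨c, ?_⟩
    funext s
    rcases s with s | i
    · simp [x, hc]
    · obtain ⟨j, hj⟩ := Function.ne_iff.1 (hp i)
      have h1 := (fieldEquations_iff p y (i, j)).1 (hy (i, j))
      have h2 : (fun b => y (.inl b)) = fun b => c * q b := funext hc
      rw [h2] at h1
      simp only [fieldCoeff_smul, mul_assoc] at h1
      rw [← Finset.mul_sum, ht, ← mul_assoc] at h1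
      simpa [x] using (mul_right_cancel₀ hj h1).symm
  have hne := signedMinors_ne_zero fieldEquiv (fieldEquations p) x (a := .inl b) hb hker'
  obtain ⟨c, hc⟩ := hker (signedMinors fieldEquiv (fieldEquations p))
    (equations_signedMinors _ _)
  refine ⟨c, ?_, ?_⟩
  · rintro rfl
    exact hne (by rw [hc, zero_mul])
  · rw [hT, ← fieldForm_smul]
    congr 1
    funext b
    exact hc b

end HilbertBurch

/-! ### Hilbert–Burch matrices of general points -/

section Generic

variable {k : Type*} [Field k]

/-- The Sylvester matrix of the binary forms `Q₂` and `X₀ Q₁ - X₁ Q₀` on the line `X₂ = 0`. -/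
def sylvesterMatrix {R : Type*} [CommRing R] (q : Fin 15 → R) : Matrix (Fin 5) (Fin 5) R :=
  !![q 12, q 14, q 13, 0, 0;
    0, q 12, q 14, q 13, 0;
    0, 0, q 12, q 14, q 13;
    q 6, q 9 - q 0, q 7 - q 3, -q 1, 0;
    0, q 6, q 9 - q 0, q 7 - q 3, -q 1]

/-- Restriction to the line `X₂ = 0`. -/
def restrictLine (k : Type*) [Field k] : MvPolynomial (Fin 3) k →ₐ[k] MvPolynomial (Fin 3) k :=
  aeval ![X 0, X 1, 0]

theorem sub_restrictLine_mem (f : MvPolynomial (Fin 3) k) :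
    f - restrictLine k f ∈ Ideal.span {(X 2 : MvPolynomial (Fin 3) k)} := by
  rw [← Ideal.Quotient.eq]
  have : (Ideal.Quotient.mkₐ k (Ideal.span {(X 2 : MvPolynomial (Fin 3) k)})) =
      (Ideal.Quotient.mkₐ k _).comp (restrictLine k) := by
    ext j
    fin_cases j
    · simp [restrictLine]
    · simp [restrictLine]
    · simp [restrictLine]
  exact congrArg (fun φ => φ f) this

theorem eval_map_weightScale (f : MvPolynomial (Fin 3) k) (v : Fin 3 → k) (t : k) :
    ((weightScale 1 f).map (eval v)).eval t = eval (t • v) f := by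
  induction f using MvPolynomial.induction_on with
  | C a =>
    have : weightScale (1 : Fin 3 → ℕ) (C a) = Polynomial.C (C a) := by
      rw [weightScale, aeval_C]; rfl
    simp [this]
  | add f g hf hg => rw [map_add, Polynomial.map_add, Polynomial.eval_add, hf, hg, map_add]
  | mul_X f j hf =>
    have : weightScale (1 : Fin 3 → ℕ) (X j : MvPolynomial (Fin 3) k) =
        Polynomial.X ^ 1 * Polynomial.C (X j) := by
      rw [weightScale, aeval_X]; rfl
    rw [map_mul, Polynomial.map_mul, Polynomial.eval_mul, hf, map_mul, this]
    simp
    exact Or.inl (mul_comm _ _)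

theorem mem_pointsIdeal_components [Infinite k] {n : ℕ} {p : Fin n → Fin 3 → k}
    {f : MvPolynomial (Fin 3) k} (hf : f ∈ pointsIdeal p) (d : ℕ) (i : Fin n) :
    eval (p i) ((weightScale 1 f).coeff d) = 0 := by
  have h2 : (weightScale 1 f).map (eval (p i)) = 0 := by
    refine Polynomial.funext fun t => ?_
    rw [eval_map_weightScale, Polynomial.eval_zero]
    have := hf (t • p i) ⟨i, t, rfl⟩
    rwa [aeval_eq_eval] at this
  have h3 := congrArg (fun g => Polynomial.coeff g d) h2
  simpa using h3

theorem weightScale_coeff_isHomogeneous (f : MvPolynomial (Fin 3) k) (d : ℕ) :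
    ((weightScale 1 f).coeff d).IsHomogeneous d := by
  intro e he
  rw [coeff_weightScale] at he
  by_contra hne
  rw [if_neg hne] at he
  exact he rfl

theorem sum_weightScale_coeff (f : MvPolynomial (Fin 3) k) :
    f = ∑ d ∈ Finset.range ((weightScale 1 f).natDegree + 1), (weightScale 1 f).coeff d := by
  conv_lhs => rw [← weightScale_eval_one 1 f, Polynomial.eval_eq_sum_range]
  simp

variable [CharZero k]

/-- Let J be generated by the cubics of X × Q. In degrees at most 3 it agrees with the ideal of the
points by a dimension count. On the line X₂ = 0 the cubics become X₁Q₂, -X₀Q₂ and X₀Q₁ - X₁Q₀; as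
the resultant of Q₂ and the last one is nonzero, their multiples fill all binary quartics. So a form
of degree at least 4 lies in J up to a multiple X₂g. If it vanishes at the points, then so does g,
because no point is on the line, and induction on the degree applies. -/
theorem isHilbertBurchMatrix_of_sylvester {p : Fin 7 → Fin 3 → k} {q : Fin 15 → k}
    (hq : ∀ i j, ∑ m, fieldCubic q j m * cubicMonomials (p i) m = 0) (hz : ∀ i, p i 2 ≠ 0)
    (hW : LinearIndependent k fun i => cubicMonomials (p i)) (hconic : ¬ OnConic p)
    (hsyl : (sylvesterMatrix q).det ≠ 0) :
    IsHilbertBurchMatrix p X fun j => quadForm (fieldCoeff q j) := by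
  have hmin : ∀ a, maxMinors X (fun j => quadForm (fieldCoeff q j)) a =
      cubicForm (fieldCubic q a) := by
    obtain ⟨h0, h1, h2⟩ := cubicForm_fieldCubic q
    intro a
    fin_cases a
    · exact h0.symm
    · exact h1.symm
    · exact h2.symm
  refine ⟨fun j => isHomogeneous_X k j, fun j => quadForm_isHomogeneous _, ?_⟩
  refine (span_range_maxMinors X fun j => quadForm (fieldCoeff q j)).symm.trans ?_
  rw [funext hmin]
  set J := Ideal.span (Set.range fun a => cubicForm (fieldCubic q a)) with hJ
  have hCJ : ∀ a, cubicForm (fieldCubic q a) ∈ J := fun a => Ideal.subset_span ⟨a, rfl⟩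
  have hJI : J ≤ pointsIdeal p := by
    rw [hJ, Ideal.span_le]
    rintro _ ⟨a, rfl⟩
    refine (mem_pointsIdeal_iff (cubicForm_isHomogeneous _)).2 fun i => ?_
    rw [eval_cubicForm, hq]
  refine le_antisymm hJI ?_
  -- modulo the line, `J` contains all quartics
  set J' := J ⊔ Ideal.span {(X 2 : MvPolynomial (Fin 3) k)} with hJ'
  have hJJ' : J ≤ J' := le_sup_left
  have hsub : ∀ f, f - restrictLine k f ∈ J' := fun f => (le_sup_right : _ ≤ J')
      (sub_restrictLine_mem f)
  have hmon : ∀ s : Fin 5, (X 0 ^ (4 - (s : ℕ)) * X 1 ^ (s : ℕ) : MvPolynomial (Fin 3) k) ∈ J' := by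
    -- Restricted to the line these are X₀²Q₂, X₀X₁Q₂, X₁²Q₂ and X₀, X₁ times the binary cubic: the
    -- rows of the Sylvester matrix.
    let b : Fin 5 → MvPolynomial (Fin 3) k :=
      ![-X 0 * cubicForm (fieldCubic q 1), X 0 * cubicForm (fieldCubic q 0),
        X 1 * cubicForm (fieldCubic q 0), X 0 * cubicForm (fieldCubic q 2),
        X 1 * cubicForm (fieldCubic q 2)]
    have hb : ∀ r, b r ∈ J := by
      intro r
      fin_cases r <;> exact Ideal.mul_mem_left _ _ (hCJ _)
    have hb' : ∀ r, restrictLine k (b r) ∈ J' := fun r => by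
      have := Ideal.sub_mem _ (hJJ' (hb r)) (hsub (b r))
      simpa using this
    have hbs : ∀ r, restrictLine k (b r) = ∑ s : Fin 5, C (sylvesterMatrix q r s) *
        (X 0 ^ (4 - (s : ℕ)) * X 1 ^ (s : ℕ)) := by
      intro r
      fin_cases r <;>
      · simp [b, restrictLine, sylvesterMatrix, Fin.sum_univ_succ, cubicForm, cubicMonomials,
          fieldCubic, algebraMap_eq]
        ring
    intro s
    have h1 : (X 0 ^ (4 - (s : ℕ)) * X 1 ^ (s : ℕ) : MvPolynomial (Fin 3) k) =
        ∑ r, C ((sylvesterMatrix q)⁻¹ s r) * restrictLine k (b r) := by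
      simp only [hbs, Finset.mul_sum]
      rw [Finset.sum_comm]
      have h2 := Matrix.nonsing_inv_mul (sylvesterMatrix q) (isUnit_iff_ne_zero.2 hsyl)
      have h3 : ∀ s', ∑ r, (sylvesterMatrix q)⁻¹ s r * sylvesterMatrix q r s' =
          if s = s' then 1 else 0 := by
        intro s'
        rw [← Matrix.mul_apply, h2, Matrix.one_apply]
      have h4 : ∀ s' : Fin 5, ∑ r, C ((sylvesterMatrix q)⁻¹ s r) * (C (sylvesterMatrix q r s') *
          (X 0 ^ (4 - (s' : ℕ)) * X 1 ^ (s' : ℕ))) =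
          if s = s' then (X 0 ^ (4 - (s' : ℕ)) * X 1 ^ (s' : ℕ) : MvPolynomial (Fin 3) k) else 0 :=
              by
        intro s'
        simp only [← mul_assoc, ← C_mul]
        simp only [← Finset.sum_mul, ← map_sum, h3]
        split_ifs <;> simp
      simp only [h4]
      simp
    rw [h1]
    exact Ideal.sum_mem _ fun r _ => Ideal.mul_mem_left _ _ (hb' r)
  have hquart : ∀ n (f : MvPolynomial (Fin 3) k), f.IsHomogeneous (n + 4) → f ∈ J' := by
    intro n
    induction n with
    | zero =>
      intro f hf
      obtain ⟨g, hg, rfl⟩ := exists_sum_X_mul hf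
      choose c hc using fun j => exists_cubicForm (hg j)
      have h1 : restrictLine k (∑ j, X j * g j) =
          C (c 0 (.inl 0)) * (X 0 ^ 4 * X 1 ^ 0) +
          C (c 0 (.inl 3) + c 1 (.inl 0)) * (X 0 ^ 3 * X 1 ^ 1) +
          C (c 0 (.inr 0) + c 1 (.inl 3)) * (X 0 ^ 2 * X 1 ^ 2) +
          C (c 0 (.inl 1) + c 1 (.inr 0)) * (X 0 ^ 1 * X 1 ^ 3) +
          C (c 1 (.inl 1)) * (X 0 ^ 0 * X 1 ^ 4) := by
        simp [hc, restrictLine, Fin.sum_univ_succ, cubicForm, cubicMonomials, algebraMap_eq]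
        ring
      have h2 : restrictLine k (∑ j, X j * g j) ∈ J' := by
        rw [h1]
        exact Ideal.add_mem _ (Ideal.add_mem _ (Ideal.add_mem _ (Ideal.add_mem _
          (Ideal.mul_mem_left _ _ (hmon 0)) (Ideal.mul_mem_left _ _ (hmon 1)))
          (Ideal.mul_mem_left _ _ (hmon 2))) (Ideal.mul_mem_left _ _ (hmon 3)))
          (Ideal.mul_mem_left _ _ (hmon 4))
      have := Ideal.add_mem _ (hsub (∑ j, X j * g j)) h2
      simpa using this
    | succ n ih =>
      intro f hf
      obtain ⟨g, hg, rfl⟩ := exists_sum_X_mul (n := n + 4) (by convert hf using 1)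
      exact Ideal.sum_mem _ fun j _ => Ideal.mul_mem_left _ _ (ih _ (hg j))
  have hlow : ∀ d, d ≤ 2 → ∀ f : MvPolynomial (Fin 3) k, f.IsHomogeneous d →
      (∀ i, eval (p i) f = 0) → f = 0 := by
    intro d hd f hf hfp
    by_contra h0
    refine hconic ⟨X 0 ^ (2 - d) * f, mul_ne_zero (pow_ne_zero _ (X_ne_zero 0)) h0, ?_, ?_⟩
    · have := ((isHomogeneous_X k (0 : Fin 3)).pow (2 - d)).mul hf
      convert this using 1
      omega
    · intro i
      rw [map_mul, hfp, mul_zero]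
  have hcub : ∀ c : CubicIndex → k, (∀ i, ∑ e, c e * cubicMonomials (p i) e = 0) →
      cubicForm c ∈ J := by
    let ev : (CubicIndex → k) →ₗ[k] (Fin 7 → k) := Matrix.mulVecLin (Matrix.of fun i =>
        cubicMonomials (p i))
    have hevc : ∀ c i, ev c i = ∑ e, c e * cubicMonomials (p i) e := by
      intro c i
      simp only [ev, Matrix.mulVecLin_apply, Matrix.mulVec, dotProduct, Matrix.of_apply, mul_comm]
    have h1 := LinearMap.finrank_range_add_finrank_ker ev
    have h2 : Module.finrank k (LinearMap.range ev) = 7 := by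
      have := LinearIndependent.rank_matrix (M := Matrix.of fun i => cubicMonomials (p i)) hW
      rw [Matrix.rank] at this
      simpa using this
    have h3 : Module.finrank k (CubicIndex → k) = 10 := by simp
    have h4 : LinearIndependent k (fieldCubic q) := by
      rw [Fintype.linearIndependent_iff]
      intro n hn
      -- A relation among the three cubics, multiplied by X₀ and restricted to the line, is a
      -- relation among the rows of the Sylvester matrix.
      have h5 : Matrix.vecMul ![-n 1, n 0, 0, n 2, 0] (sylvesterMatrix q) = 0 := by
        have g0 := congrFun hn (.inl 0)
        have g1 := congrFun hn (.inl 3)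
        have g2 := congrFun hn (.inr 0)
        have g3 := congrFun hn (.inl 1)
        simp [Fin.sum_univ_three, fieldCubic] at g0 g1 g2 g3
        funext s
        fin_cases s <;> simp [Matrix.vecMul, dotProduct, Fin.sum_univ_succ, sylvesterMatrix]
        · linear_combination g0
        · linear_combination g1
        · linear_combination g2
        · linear_combination g3
      have h6 : ![-n 1, n 0, 0, n 2, 0] = 0 := by
        by_contra hne
        exact hsyl (Matrix.exists_vecMul_eq_zero_iff.1 ⟨_, hne, h5⟩)
      intro j
      fin_cases j
      · simpa using congrFun h6 1
      · simpa using congrFun h6 0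
      · simpa using congrFun h6 3
    have h5 : Submodule.span k (Set.range (fieldCubic q)) = LinearMap.ker ev := by
      refine Submodule.eq_of_le_of_finrank_eq ?_ ?_
      · rw [Submodule.span_le]
        rintro _ ⟨j, rfl⟩
        refine LinearMap.mem_ker.2 (funext fun i => ?_)
        rw [hevc, hq]
        rfl
      · rw [finrank_span_eq_card h4]
        simp only [Fintype.card_fin]
        omega
    intro c hc
    have h6 : c ∈ LinearMap.ker ev := LinearMap.mem_ker.2 (funext fun i => by rw [hevc, hc]; rfl)
    rw [← h5, Submodule.mem_span_range_iff_exists_fun] at h6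
    obtain ⟨n, rfl⟩ := h6
    simp only [Fin.sum_univ_three, cubicForm_add, cubicForm_smul]
    exact Ideal.add_mem _ (Ideal.add_mem _ (Ideal.mul_mem_left _ _ (hCJ 0))
      (Ideal.mul_mem_left _ _ (hCJ 1))) (Ideal.mul_mem_left _ _ (hCJ 2))
  have hall : ∀ d (f : MvPolynomial (Fin 3) k), f.IsHomogeneous d →
      (∀ i, eval (p i) f = 0) → f ∈ J := by
    intro d
    induction d using Nat.strong_induction_on with
    | _ d ih =>
      intro f hf hfp
      rcases Nat.lt_or_ge d 3 with hd | hd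
      · rw [hlow d (by omega) f hf hfp]
        exact J.zero_mem
      rcases Nat.lt_or_ge d 4 with hd4 | hd4
      · obtain rfl : d = 3 := by omega
        obtain ⟨c, rfl⟩ := exists_cubicForm hf
        refine hcub c fun i => ?_
        rw [← eval_cubicForm, hfp]
      · obtain ⟨n, rfl⟩ : ∃ n, d = n + 4 := ⟨d - 4, by omega⟩
        obtain ⟨a, ha, b, hb, hab⟩ := Submodule.mem_sup.1 (hquart n f hf)
        obtain ⟨c, rfl⟩ := Ideal.mem_span_range_iff_exists_fun.1 ha
        obtain ⟨g, rfl⟩ := Ideal.mem_span_singleton.1 hb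
        have h1 := congrArg (fun g => (weightScale (1 : Fin 3 → ℕ) g).coeff (n + 4)) hab
        simp only [map_add, map_sum, map_mul] at h1
        rw [weightScale_eq_iff.1 hf, Polynomial.coeff_C_mul_X_pow, if_pos rfl,
          Polynomial.coeff_add, Polynomial.finsetSum_coeff,
          weightScale_eq_iff.1 (isHomogeneous_X k (2 : Fin 3)), pow_one] at h1
        have h2 : ∀ j, (weightScale 1 (c j) * weightScale 1 (cubicForm (fieldCubic q j))).coeff (n +
            4) =
            (weightScale 1 (c j)).coeff (n + 1) * cubicForm (fieldCubic q j) := by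
          intro j
          rw [weightScale_eq_iff.1 (cubicForm_isHomogeneous (fieldCubic q j)), ← mul_assoc,
            show n + 4 = n + 1 + 3 by omega, Polynomial.coeff_mul_X_pow, Polynomial.coeff_mul_C]
        have h3 : (Polynomial.C (X 2) * Polynomial.X * weightScale (1 : Fin 3 → ℕ) g).coeff (n +
            4) =
            X 2 * (weightScale 1 g).coeff (n + 3) := by
          rw [mul_assoc, Polynomial.coeff_C_mul, show n + 4 = n + 3 + 1 by omega,
            Polynomial.coeff_X_mul]
        simp only [h2] at h1
        rw [h3] at h1
        have hj : ∑ j, (weightScale 1 (c j)).coeff (n + 1) * cubicForm (fieldCubic q j) ∈ J :=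
          Ideal.sum_mem _ fun j _ => Ideal.mul_mem_left _ _ (hCJ j)
        rw [← h1]
        refine Ideal.add_mem _ hj (Ideal.mul_mem_left _ _ (ih (n + 3) (by omega) _
          (weightScale_coeff_isHomogeneous g (n + 3)) fun i => ?_))
        have h4 := congrArg (eval (p i)) h1
        rw [map_add, map_mul, eval_X, hfp i, map_sum] at h4
        simp only [map_mul, eval_cubicForm, hq, mul_zero, Finset.sum_const_zero, zero_add] at h4
        exact (mul_eq_zero.1 h4).resolve_left (hz i)
  intro f hf
  rw [sum_weightScale_coeff f]
  exact Ideal.sum_mem _ fun d _ => hall d _ (weightScale_coeff_isHomogeneous f d)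
    fun i => mem_pointsIdeal_components hf d i

end Generic

/-! ### Conics -/

section Conic

variable {R : Type*} [CommRing R]

/-- The exponents of the six quadratic monomials. -/
def quadExponents (h : Fin 6) (j : Fin 3) : ℕ :=
  (if (quadIndex h).1 = j then 1 else 0) + if (quadIndex h).2 = j then 1 else 0

theorem quadExponents_injective : Function.Injective quadExponents := by
  decide

theorem quadForm_injective : Function.Injective (quadForm (R := R)) := by
  have h1 : ∀ (c : Fin 6 → R) h,
      coeff (Finsupp.equivFunOnFinite.symm (quadExponents h)) (quadForm c) = c h := by
    intro c h
    have h2 : ∀ h : Fin 6, (∏ s, X s ^ quadExponents h s : MvPolynomial (Fin 3) R) =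
        quadMonomials X h := by
      intro h
      simp only [quadExponents, pow_add, Finset.prod_mul_distrib, Finset.prod_pow_boole]
      simp [quadMonomials]
    have h3 := coeff_sum_monomials quadExponents_injective c h
    simp only [h2] at h3
    exact h3
  intro c d h
  funext m
  rw [← h1 c m, h, h1]

variable {k : Type*} [Field k]

theorem conicForm_eq_quadForm (A : Matrix (Fin 3) (Fin 3) k) : conicForm A =
    quadForm ![A 0 0, A 1 1, A 2 2, A 0 1 + A 1 0, A 0 2 + A 2 0, A 1 2 + A 2 1] := by
  simp [conicForm, quadForm, Fin.sum_univ_succ, quadMonomials, quadIndex]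
  ring

theorem conicForm_isHomogeneous (A : Matrix (Fin 3) (Fin 3) k) : (conicForm A).IsHomogeneous 2 := by
  rw [conicForm_eq_quadForm]
  exact quadForm_isHomogeneous _

variable [CharZero k]

/-- In degree at most 3, one of two nonconstant factors is linear. -/
theorem exists_linear_factor {n : ℕ} (hn : 0 < n) (hn3 : n ≤ 3) {f : MvPolynomial (Fin 3) k}
    (hf : f.IsHomogeneous n) (hf0 : f ≠ 0) (hirr : ¬ Irreducible f) :
    ∃ l g, g.IsHomogeneous (n - 1) ∧ f = linForm l * g := by
  rw [irreducible_iff] at hirr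
  push Not at hirr
  have hu : ¬ IsUnit f := fun h => by
    have := isHomogeneous_unit hf h
    omega
  obtain ⟨a, b, rfl, ha, hb⟩ := hirr hu
  obtain ⟨r, s, hrs, har, hbs⟩ := isHomogeneous_factor hf hf0
  have hr : r ≠ 0 := by
    rintro rfl
    exact ha (isUnit_of_isHomogeneous_zero har (left_ne_zero_of_mul hf0))
  have hs : s ≠ 0 := by
    rintro rfl
    exact hb (isUnit_of_isHomogeneous_zero hbs (right_ne_zero_of_mul hf0))
  rcases (by omega : r = 1 ∨ s = 1) with rfl | rfl
  · obtain ⟨l, rfl⟩ := exists_linForm har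
    exact ⟨l, b, by convert hbs using 1; omega, rfl⟩
  · obtain ⟨l, rfl⟩ := exists_linForm hbs
    exact ⟨l, a, by convert har using 1; omega, mul_comm _ _⟩

/-- The symmetric matrix of a product of two linear forms has rank at most 2. -/
theorem conicForm_irreducible {A : Matrix (Fin 3) (Fin 3) k} (hA : A.IsSymm) (hdet : A.det ≠ 0) :
    Irreducible (conicForm A) := by
  have s1 := hA.apply 0 1
  have s2 := hA.apply 0 2
  have s3 := hA.apply 1 2
  have h0 : conicForm A ≠ 0 := by
    intro h
    have h1 : quadForm (0 : Fin 6 → k) = 0 := by simp [quadForm]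
    rw [conicForm_eq_quadForm, ← h1] at h
    have h2 := quadForm_injective h
    have g0 : A 0 0 = 0 := congrFun h2 0
    have g1 : A 1 1 = 0 := congrFun h2 1
    have g3 : A 0 1 + A 1 0 = 0 := congrFun h2 3
    have g4 : A 0 2 + A 2 0 = 0 := congrFun h2 4
    rw [s1] at g3
    rw [s2] at g4
    have g3' : A 0 1 = 0 := by linear_combination (1 / 2 : k) * g3
    have g4' : A 0 2 = 0 := by linear_combination (1 / 2 : k) * g4
    exact hdet (by rw [Matrix.det_fin_three, g0, g3', g4']; ring)
  by_contra hirr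
  obtain ⟨l, g, hg, hlg⟩ := exists_linear_factor (by norm_num) (by norm_num)
    (conicForm_isHomogeneous A) h0 hirr
  obtain ⟨m, rfl⟩ := exists_linForm hg
  have h1 : linForm l * linForm m = quadForm ![l 0 * m 0, l 1 * m 1, l 2 * m 2,
      l 0 * m 1 + l 1 * m 0, l 0 * m 2 + l 2 * m 0, l 1 * m 2 + l 2 * m 1] := by
    simp [linForm, quadForm, Fin.sum_univ_succ, quadMonomials, quadIndex]
    ring
  rw [conicForm_eq_quadForm, h1] at hlg
  have h2 := quadForm_injective hlg
  have g0 : A 0 0 = l 0 * m 0 := congrFun h2 0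
  have g1 : A 1 1 = l 1 * m 1 := congrFun h2 1
  have g2 : A 2 2 = l 2 * m 2 := congrFun h2 2
  have g3 : A 0 1 + A 1 0 = l 0 * m 1 + l 1 * m 0 := congrFun h2 3
  have g4 : A 0 2 + A 2 0 = l 0 * m 2 + l 2 * m 0 := congrFun h2 4
  have g5 : A 1 2 + A 2 1 = l 1 * m 2 + l 2 * m 1 := congrFun h2 5
  rw [s1] at g3
  rw [s2] at g4
  rw [s3] at g5
  have g3' : A 0 1 = (l 0 * m 1 + l 1 * m 0) / 2 := by linear_combination (1 / 2 : k) * g3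
  have g4' : A 0 2 = (l 0 * m 2 + l 2 * m 0) / 2 := by linear_combination (1 / 2 : k) * g4
  have g5' : A 1 2 = (l 1 * m 2 + l 2 * m 1) / 2 := by linear_combination (1 / 2 : k) * g5
  refine hdet ?_
  rw [Matrix.det_fin_three, s1, s2, s3, g0, g1, g2, g3', g4', g5']
  ring

end Conic

/-! ### Six points on a conic -/

section SixPoints

variable {R : Type*} [CommRing R]

/-- The matrix of the quadratic monomials of six points. -/
def veroneseMatrix (p : Fin 6 → Fin 3 → R) : Matrix (Fin 6) (Fin 6) R :=
  Matrix.of fun l => quadMonomials (p l)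

/-- This expansion and the next two keep the 6 × 6 determinant within reach of `ring`. -/
theorem det_fin_four (a : Matrix (Fin 4) (Fin 4) R) : a.det =
   a 0 0 * (a 1 1 * (a 2 2 * a 3 3 - a 2 3 * a 3 2) - a 1 2 * (a 2 1 * a 3 3 - a 2 3 * a 3 1) +
       a 1 3 * (a 2 1 * a 3 2 - a 2 2 * a 3 1))
   - a 0 1 * (a 1 0 * (a 2 2 * a 3 3 - a 2 3 * a 3 2) - a 1 2 * (a 2 0 * a 3 3 - a 2 3 * a 3 0) +
       a 1 3 * (a 2 0 * a 3 2 - a 2 2 * a 3 0))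
   + a 0 2 * (a 1 0 * (a 2 1 * a 3 3 - a 2 3 * a 3 1) - a 1 1 * (a 2 0 * a 3 3 - a 2 3 * a 3 0) +
       a 1 3 * (a 2 0 * a 3 1 - a 2 1 * a 3 0))
   - a 0 3 * (a 1 0 * (a 2 1 * a 3 2 - a 2 2 * a 3 1) - a 1 1 * (a 2 0 * a 3 2 - a 2 2 * a 3 0) +
       a 1 2 * (a 2 0 * a 3 1 - a 2 1 * a 3 0)) := by
  simp only [Matrix.det_succ_row_zero (n := 3), Matrix.det_fin_three, Fin.sum_univ_four,
    Matrix.submatrix_apply]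
  simp [Fin.succAbove]
  ring

theorem det_fin_five (a : Matrix (Fin 5) (Fin 5) R) : a.det =
    a 0 0 * (a.submatrix ![1, 2, 3, 4] ![1, 2, 3, 4]).det
    - a 0 1 * (a.submatrix ![1, 2, 3, 4] ![0, 2, 3, 4]).det
    + a 0 2 * (a.submatrix ![1, 2, 3, 4] ![0, 1, 3, 4]).det
    - a 0 3 * (a.submatrix ![1, 2, 3, 4] ![0, 1, 2, 4]).det
    + a 0 4 * (a.submatrix ![1, 2, 3, 4] ![0, 1, 2, 3]).det := by
  have h : (Fin.succ : Fin 4 → Fin 5) = ![1, 2, 3, 4] := by decide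
  have h0 : (Fin.succAbove 0 : Fin 4 → Fin 5) = ![1, 2, 3, 4] := by decide
  have h1 : (Fin.succAbove 1 : Fin 4 → Fin 5) = ![0, 2, 3, 4] := by decide
  have h2 : (Fin.succAbove 2 : Fin 4 → Fin 5) = ![0, 1, 3, 4] := by decide
  have h3 : (Fin.succAbove 3 : Fin 4 → Fin 5) = ![0, 1, 2, 4] := by decide
  have h4 : (Fin.succAbove 4 : Fin 4 → Fin 5) = ![0, 1, 2, 3] := by decide
  rw [Matrix.det_succ_row_zero, Fin.sum_univ_five, h, h0, h1, h2, h3, h4]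
  norm_num
  ring

theorem det_fin_six (a : Matrix (Fin 6) (Fin 6) R) : a.det =
    a 0 0 * (a.submatrix ![1, 2, 3, 4, 5] ![1, 2, 3, 4, 5]).det
    - a 0 1 * (a.submatrix ![1, 2, 3, 4, 5] ![0, 2, 3, 4, 5]).det
    + a 0 2 * (a.submatrix ![1, 2, 3, 4, 5] ![0, 1, 3, 4, 5]).det
    - a 0 3 * (a.submatrix ![1, 2, 3, 4, 5] ![0, 1, 2, 4, 5]).det
    + a 0 4 * (a.submatrix ![1, 2, 3, 4, 5] ![0, 1, 2, 3, 5]).det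
    - a 0 5 * (a.submatrix ![1, 2, 3, 4, 5] ![0, 1, 2, 3, 4]).det := by
  have h : (Fin.succ : Fin 5 → Fin 6) = ![1, 2, 3, 4, 5] := by decide
  have h0 : (Fin.succAbove 0 : Fin 5 → Fin 6) = ![1, 2, 3, 4, 5] := by decide
  have h1 : (Fin.succAbove 1 : Fin 5 → Fin 6) = ![0, 2, 3, 4, 5] := by decide
  have h2 : (Fin.succAbove 2 : Fin 5 → Fin 6) = ![0, 1, 3, 4, 5] := by decide
  have h3 : (Fin.succAbove 3 : Fin 5 → Fin 6) = ![0, 1, 2, 4, 5] := by decide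
  have h4 : (Fin.succAbove 4 : Fin 5 → Fin 6) = ![0, 1, 2, 3, 5] := by decide
  have h5 : (Fin.succAbove 5 : Fin 5 → Fin 6) = ![0, 1, 2, 3, 4] := by decide
  rw [Matrix.det_succ_row_zero, Fin.sum_univ_six, h, h0, h1, h2, h3, h4, h5]
  norm_num
  ring

-- The determinant makes visible what the bracket expression hides: its sign under permutations, its
-- vanishing when points coincide, and its meaning as the condition for a conic.
set_option maxHeartbeats 4000000 in
set_option maxRecDepth 100000 in
theorem det_veroneseMatrix (p : Fin 6 → Fin 3 → R) :
    (veroneseMatrix p).det = -conicInvariant p := by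
  have hq : ∀ v : Fin 3 → R, quadMonomials v =
      ![v 0 * v 0, v 1 * v 1, v 2 * v 2, v 0 * v 1, v 0 * v 2, v 1 * v 2] := by
    intro v; funext h; fin_cases h <;> rfl
  have hp : veroneseMatrix p = Matrix.of fun l => 
      ![p l 0 * p l 0, p l 1 * p l 1, p l 2 * p l 2, p l 0 * p l 1, p l 0 * p l 2,
          p l 1 * p l 2] := by
    ext l m; simp [veroneseMatrix, hq]
  rw [hp]
  simp only [det_fin_six, det_fin_five, det_fin_four, Matrix.submatrix_apply, Matrix.of_apply,
    Matrix.cons_val, conicInvariant, bracket, Matrix.det_fin_three]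
  ring

theorem map_conicInvariant {S : Type*} [CommRing S] (f : R →+* S) (p : Fin 6 → Fin 3 → R) :
    f (conicInvariant p) = conicInvariant fun l j => f (p l j) := by
  simp only [conicInvariant, bracket, Matrix.det_fin_three, map_sub, map_mul, map_add,
    Matrix.of_apply, Matrix.cons_val]

theorem conicInvariant_perm (p : Fin 6 → Fin 3 → R) (s : Equiv.Perm (Fin 6)) :
    conicInvariant (fun l => p (s l)) = (Equiv.Perm.sign s : ℤ) * conicInvariant p := by
  have h := Matrix.det_permute s (veroneseMatrix p)
  have h1 : (veroneseMatrix p).submatrix s id = veroneseMatrix fun l => p (s l) := rfl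
  rw [h1, det_veroneseMatrix, det_veroneseMatrix] at h
  linear_combination -h

theorem conicInvariant_eq_zero_of_eq (p : Fin 6 → Fin 3 → R) {i j : Fin 6} (hij : i ≠ j)
    (h : p i = p j) : conicInvariant p = 0 := by
  rw [← neg_eq_zero, ← det_veroneseMatrix]
  exact Matrix.det_zero_of_row_eq hij (by
    funext m
    simp [veroneseMatrix, h])

variable {k : Type*} [Field k]

theorem exists_conic_of_conicInvariant_eq_zero {p : Fin 6 → Fin 3 → k}
    (h : conicInvariant p = 0) :
    ∃ c : Fin 6 → k, c ≠ 0 ∧ ∀ l, ∑ m, c m * quadMonomials (p l) m = 0 := by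
  have h1 : (veroneseMatrix p).det = 0 := by rw [det_veroneseMatrix, h, neg_zero]
  obtain ⟨c, hc, h2⟩ := Matrix.exists_mulVec_eq_zero_iff.2 h1
  refine ⟨c, hc, fun l => ?_⟩
  have h3 := congrFun h2 l
  simpa [Matrix.mulVec, dotProduct, veroneseMatrix, mul_comm] using h3

theorem eq_zero_of_conicInvariant_ne_zero {p : Fin 6 → Fin 3 → k} (h : conicInvariant p ≠ 0)
    {c : Fin 6 → k} (hc : ∀ l, ∑ m, c m * quadMonomials (p l) m = 0) : c = 0 := by
  by_contra h0
  apply h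
  rw [← neg_eq_zero, ← det_veroneseMatrix, ← Matrix.exists_mulVec_eq_zero_iff]
  refine ⟨c, h0, funext fun l => ?_⟩
  simpa [Matrix.mulVec, dotProduct, veroneseMatrix, mul_comm] using hc l

/-- The conic invariant of the generic six points. -/
def genericConicInvariant (k : Type*) [Field k] : MvPolynomial (Fin 6 × Fin 3) k :=
  conicInvariant fun l j => X (l, j)

theorem genericConicInvariant_isMultihomogeneous :
    IsMultihomogeneous (genericConicInvariant k) fun _ => 2 := by
  intro i
  rw [genericConicInvariant, ← neg_neg (conicInvariant _), ← det_veroneseMatrix, ← neg_one_mul,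
    ← C_1, ← C_neg]
  refine IsWeightedHomogeneous.C_mul (det_isWeightedHomogeneous
    (a := fun l => if l = i then 2 else 0) (b := fun _ => 0) (fun r c => Or.inr
      ⟨if r = i then 2 else 0, by simp, ?_⟩) (by simp)) _
  have h : ∀ j, IsWeightedHomogeneous (fun a : Fin 6 × Fin 3 => if a.1 = i then 1 else 0)
      (X (r, j) : MvPolynomial (Fin 6 × Fin 3) k) (if r = i then 1 else 0) :=
    fun j => isWeightedHomogeneous_X k _ (r, j)
  have h2 := (h (quadIndex c).1).mul (h (quadIndex c).2)
  rw [show (if r = i then 2 else 0) = (if r = i then 1 else 0) + if r = i then 1 else 0 by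
    split_ifs <;> rfl]
  exact h2

theorem genericConicInvariant_irreducible [CharZero k] : Irreducible (genericConicInvariant k) := by
  refine irreducible_of_specializations two_ne_zero genericConicInvariant_isMultihomogeneous
    (fun i => ?_) fun i j hij p hp => ?_
  · let c : Fin 6 → Fin 3 → k :=
      ![![1, 0, 0], ![1, 1, 1], ![1, -1, 1], ![1, 2, 4], ![0, 0, 1], 0]
    let b : Fin 6 → Fin 3 → MvPolynomial (Fin 3) k :=
      ![![1, 0, 0], ![1, 1, 1], ![1, -1, 1], ![1, 2, 4], ![0, 0, 1], X]
    have hb : ∀ l, b l = if l = 5 then X else fun j => C (c l j) := by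
      intro l
      fin_cases l <;> simp [b, c] <;> funext j <;> fin_cases j <;>
        simp [← map_ofNat (C (σ := Fin 3) (R := k))]
    refine ⟨fun l => c (Equiv.swap i 5 l), ?_⟩
    have h1 : specializeAt i (fun l => c (Equiv.swap i 5 l)) (genericConicInvariant k) =
        conicInvariant fun l => b (Equiv.swap i 5 l) := by
      rw [genericConicInvariant, ← AlgHom.coe_toRingHom, map_conicInvariant]
      congr 1
      funext l j
      have h2 : Equiv.swap i 5 l = 5 ↔ l = i := by
        rw [Equiv.swap_apply_eq_iff, Equiv.swap_apply_right]
      simp only [AlgHom.coe_toRingHom, specializeAt, aeval_X, hb, h2]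
      split_ifs <;> rfl
    have h3 : conicInvariant b = C (-6) * conicForm !![0, 0, 1; 0, -2, 0; 1, 0, 0] := by
      simp only [conicInvariant, bracket, Matrix.det_fin_three, Matrix.of_apply, Matrix.cons_val, b,
        conicForm, Fin.sum_univ_three, map_zero, map_one, map_neg, map_ofNat]
      ring
    rw [h1, conicInvariant_perm, h3]
    have hu : IsUnit (((Equiv.Perm.sign (Equiv.swap i 5) : ℤˣ) : ℤ) : MvPolynomial (Fin 3) k) :=
      (Equiv.Perm.sign (Equiv.swap i 5)).isUnit.map (Int.castRingHom _)
    have hu6 : IsUnit (C (-6) : MvPolynomial (Fin 3) k) :=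
      (IsUnit.mk0 (-6 : k) (by norm_num)).map C
    rw [irreducible_isUnit_mul hu, irreducible_isUnit_mul hu6]
    refine conicForm_irreducible ?_ ?_
    · ext i j
      fin_cases i <;> fin_cases j <;> rfl
    · simp [Matrix.det_fin_three]
  · rw [genericConicInvariant, map_conicInvariant]
    refine conicInvariant_eq_zero_of_eq _ hij ?_
    funext l
    simp [hp]

theorem prime_rename_of_injective {σ τ : Type*} {f : σ → τ} (hf : Function.Injective f)
    {G : MvPolynomial σ k} (hG : Prime G) : Prime (rename f G) := by
  have h : rename f G = rename ((↑) : Set.range f → τ)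
      (renameEquiv k (Equiv.ofInjective f hf) G) := by
    rw [renameEquiv_apply, rename_rename]
    rfl
  rw [h, prime_rename_iff]
  exact (MulEquiv.prime_iff (renameEquiv k (Equiv.ofInjective f hf))).2 hG

/-- The conic invariant of the generic seven points without the `i`-th one. -/
def omitConicInvariant (k : Type*) [Field k] (i : Fin 7) : CoordRing k :=
  conicInvariant fun l : Fin 6 => genericPoint k (i.succAbove l)

theorem omitConicInvariant_prime [CharZero k] (i : Fin 7) : Prime (omitConicInvariant k i) := by
  have h := prime_rename_of_injective
    (f := Prod.map (i.succAbove) (id : Fin 3 → Fin 3))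
    ((Fin.succAbove_right_injective).prodMap Function.injective_id)
    (genericConicInvariant_irreducible (k := k)).prime
  convert h using 1
  rw [genericConicInvariant, ← AlgHom.coe_toRingHom, map_conicInvariant, omitConicInvariant]
  congr 1
  funext l j
  simp [genericPoint]

theorem eval_omitConicInvariant (i : Fin 7) (p : Fin 7 → Fin 3 → k) :
    eval (fun a : Fin 7 × Fin 3 => p a.1 a.2) (omitConicInvariant k i) =
      conicInvariant fun l => p (i.succAbove l) := by
  rw [omitConicInvariant, map_conicInvariant]
  simp [genericPoint]

/-- Put P_j on a third point. The invariant without P_i then has a repeated point and vanishes; the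
one without P_j is unaffected. -/
theorem omitConicInvariant_not_dvd [CharZero k] {i j : Fin 7} (hij : i ≠ j) :
    ¬ omitConicInvariant k i ∣ omitConicInvariant k j := by
  intro h
  obtain ⟨q, hq⟩ := exists_eval_ne_zero (omitConicInvariant_prime (k := k) j).ne_zero
  obtain ⟨l, hl⟩ : ∃ l, l ∉ ({i, j} : Finset (Fin 7)) := by
    by_contra! hc
    have h1 := Finset.card_le_card (fun l _ => hc l : (Finset.univ : Finset (Fin 7)) ⊆ {i, j})
    have h2 : ({i, j} : Finset (Fin 7)).card ≤ 2 := Finset.card_le_two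
    simp at h1
    omega
  simp only [Finset.mem_insert, Finset.mem_singleton, not_or] at hl
  let p : Fin 7 → Fin 3 → k := fun a => if a = j then fun b => q (l, b) else fun b => q (a, b)
  have h1 : eval (fun a : Fin 7 × Fin 3 => p a.1 a.2) (omitConicInvariant k i) = 0 := by
    rw [eval_omitConicInvariant]
    obtain ⟨a, ha⟩ := Fin.exists_succAbove_eq hij.symm
    obtain ⟨b, hb⟩ := Fin.exists_succAbove_eq hl.1
    refine conicInvariant_eq_zero_of_eq _ (i := a) (j := b) ?_ ?_
    · rintro rfl
      exact hl.2 (hb.symm.trans ha)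
    · simp only [ha, hb, p, if_neg hl.2, if_true]
  have h2 : eval (fun a : Fin 7 × Fin 3 => p a.1 a.2) (omitConicInvariant k j) = 0 := by
    obtain ⟨r, hr⟩ := h
    rw [hr, map_mul, h1, zero_mul]
  apply hq
  rw [← h2, eval_omitConicInvariant]
  refine (eval_omitConicInvariant j fun a b => q (a, b)).trans ?_
  congr 1
  funext a
  simp [p, Fin.succAbove_ne]

end SixPoints

/-! ### The universal form `S(ξ, X)` and its pfaffian -/

section UniversalForm

variable {k : Type*} [Field k]

/-- The form `S(ξ, X)` of the generic seven points. -/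
def universalS (k : Type*) [Field k] : MvPolynomial (Fin 3 ⊕ Fin 3) (CoordRing k) :=
  fieldForm (universalField (genericPoint k))

theorem coeff_fieldForm {R : Type*} [CommRing R] [Algebra k R] (q : Fin 15 → R)
    (m : Fin 3 ⊕ Fin 3 →₀ ℕ) : coeff m (fieldForm q) = ∑ j, ∑ n, fieldCubic q j n *
      algebraMap k R (coeff m (X (Sum.inl j) * cubicMonomials (fun j => X (Sum.inr j)) n)) := by
  rw [fieldForm_eq, coeff_sum]
  refine Finset.sum_congr rfl fun j _ => ?_
  rw [cubicForm, map_sum, Finset.mul_sum, coeff_sum]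
  refine Finset.sum_congr rfl fun n _ => ?_
  rw [map_mul, rename_C, mul_left_comm, coeff_C_mul, ← coeff_map, map_mul, map_X]
  congr 3
  rw [map_cubicMonomials, ← AlgHom.coe_toRingHom, map_cubicMonomials]
  simp

theorem fieldCubic_mem {R : Type*} [CommRing R] (V : AddSubgroup R) {q : Fin 15 → R}
    (hq : ∀ b, q b ∈ V) (j : Fin 3) (n : CubicIndex) : fieldCubic q j n ∈ V := by
  have h0 := V.zero_mem
  have hn := fun b => V.neg_mem (hq b)
  have hs := fun a b => V.sub_mem (hq a) (hq b)
  fin_cases j <;> rcases n with n | n <;> fin_cases n <;>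
    first | exact h0 | exact hq _ | exact hn _ | exact hs _ _

theorem fieldForm_injective {R : Type*} [CommRing R] : Function.Injective (fieldForm (R := R)) := by
  intro q r h
  apply fieldCubic_injective
  funext j
  apply cubicForm_injective
  have h1 : ∀ q : Fin 15 → R, aeval (Sum.elim (Pi.single j 1) X) (fieldForm q) =
      cubicForm (fieldCubic q j) := by
    intro q
    rw [fieldForm_eq, map_sum, Finset.sum_eq_single j]
    · rw [map_mul, aeval_X, aeval_rename, Sum.elim_inl, Pi.single_eq_same, one_mul]
      exact aeval_X_left_apply _
    · intro i _ hi
      rw [map_mul, aeval_X, Sum.elim_inl, Pi.single_eq_of_ne hi, zero_mul]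
    · simp
  rw [← h1, h, h1]

theorem map_universalS (p : Fin 7 → Fin 3 → k) :
    map (eval fun a : Fin 7 × Fin 3 => p a.1 a.2) (universalS k) = fieldForm (universalField p) :=
        by
  rw [universalS, map_fieldForm]
  congr 1
  funext b
  rw [map_universalField]
  simp [genericPoint]

theorem isUniversalS_universalS [CharZero k] : IsUniversalS (universalS k) := by
  refine ⟨fun m i => ?_, fun p hp _ L θ h => ?_⟩
  · have h1 := fieldCubic_mem (weightedHomogeneousSubmodule k
      (fun a : Fin 7 × Fin 3 => if a.1 = i then 1 else 0) 5).toAddSubgroup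
      (fun b => universalField_isMultihomogeneous k b i)
    rw [universalS, coeff_fieldForm (k := k)]
    refine Submodule.sum_mem (weightedHomogeneousSubmodule k _ _) fun j _ =>
      Submodule.sum_mem _ fun n _ => ?_
    rw [mul_comm, ← Algebra.smul_def]
    exact Submodule.smul_mem _ _ (h1 j n)
  · rw [map_universalS]
    exact universalField_eq_detForm hp.1 h

/-- The pfaffian of the Morley form of the generic seven points, up to sign. -/
def netInvariantS (k : Type*) [Field k] : CoordRing k :=
  netInvariant (fieldCubic (universalField (genericPoint k)))

theorem pfaffian6_universalS :
    pfaffian6 (coeffMatrix (morleyForm (universalS k))) = -netInvariantS k :=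
  pfaffian6_fieldForm _

theorem map_netInvariant {R S : Type*} [CommRing R] [CommRing S] (f : R →+* S)
    (G : Fin 3 → CubicIndex → R) : f (netInvariant G) = netInvariant fun j m => f (G j m) := by
  simp only [netInvariant, map_sum, map_mul, RingHom.map_det]
  refine Finset.sum_congr rfl fun t _ => ?_
  congr 1
  fin_cases t <;> simp [invariantWeights] <;> exact map_ofNat f _

theorem map_fieldCubic {R S : Type*} [CommRing R] [CommRing S] (f : R →+* S) (q : Fin 15 → R)
    (j : Fin 3) (m : CubicIndex) : f (fieldCubic q j m) = fieldCubic (fun b => f (q b)) j m := by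
  fin_cases j <;> rcases m with m | m <;> fin_cases m <;> simp [fieldCubic]

theorem eval_netInvariantS (p : Fin 7 → Fin 3 → k) :
    eval (fun a : Fin 7 × Fin 3 => p a.1 a.2) (netInvariantS k) =
      netInvariant (fieldCubic (universalField p)) := by
  rw [netInvariantS, map_netInvariant]
  congr 1
  funext j m
  rw [map_fieldCubic]
  congr 1
  funext b
  rw [map_universalField]
  simp [genericPoint]

theorem netInvariant_smul {R : Type*} [CommRing R] (t : R) (G : Fin 3 → CubicIndex → R) :
    netInvariant (fun j m => t * G j m) = t ^ 3 * netInvariant G := by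
  simp only [netInvariant, Finset.mul_sum]
  refine Finset.sum_congr rfl fun s _ => ?_
  rw [mul_left_comm]
  congr 1
  exact (Matrix.det_smul (Matrix.of fun i a => G i (invariantTriples s a)) t).trans (by simp)

/-- The coefficients, in normal form, of the vector field `C(X) u`, for a conic `C` and a
point `u`. -/
def conicField {R : Type*} [CommRing R] (c : Fin 6 → R) (u : Fin 3 → R) : Fin 15 → R :=
  ![c 0 * u 0 - c 4 * u 2, c 1 * u 0, c 2 * u 0, c 3 * u 0 - c 5 * u 2, c 4 * u 0 - c 2 * u 2,
    c 5 * u 0, c 0 * u 1, c 1 * u 1 - c 5 * u 2, c 2 * u 1, c 3 * u 1 - c 4 * u 2, c 4 * u 1,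
    c 5 * u 1 - c 2 * u 2, c 0 * u 2, c 1 * u 2, c 3 * u 2]

/-- The subtracted multiple of X brings the field C(X) u into normal form: it cancels the terms with
X₂ in the third component. -/
theorem conicField_eval {R : Type*} [CommRing R] (c : Fin 6 → R) (u v : Fin 3 → R) (j : Fin 3) :
    ∑ h, fieldCoeff (conicField c u) j h * quadMonomials v h =
      (∑ h, c h * quadMonomials v h) * u j - u 2 * (c 4 * v 0 + c 5 * v 1 + c 2 * v 2) * v j := by
  fin_cases j <;> simp [Fin.sum_univ_six, fieldCoeff, conicField, quadMonomials, quadIndex] <;> ring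

-- The three cubics are the components of C(X) (X × u), which are orthogonal to u. If u ≠ 0 they are
-- linearly dependent, and the invariant is alternating.
set_option maxHeartbeats 1000000 in
theorem netInvariant_conicField {R : Type*} [CommRing R] (c : Fin 6 → R) (u : Fin 3 → R) :
    netInvariant (fieldCubic (conicField c u)) = 0 := by
  simp [netInvariant, Fin.sum_univ_succ, invariantWeights, invariantTriples, fieldCubic,
    conicField, Matrix.det_fin_three]
  ring

theorem conicField_ne_zero {c : Fin 6 → k} (hc : c ≠ 0) {u : Fin 3 → k} (hu : u ≠ 0) :
    conicField c u ≠ 0 := by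
  intro h
  have g0 : c 0 * u 0 - c 4 * u 2 = 0 := congrFun h 0
  have g1 : c 1 * u 0 = 0 := congrFun h 1
  have g2 : c 2 * u 0 = 0 := congrFun h 2
  have g3 : c 3 * u 0 - c 5 * u 2 = 0 := congrFun h 3
  have g4 : c 4 * u 0 - c 2 * u 2 = 0 := congrFun h 4
  have g5 : c 5 * u 0 = 0 := congrFun h 5
  have g6 : c 0 * u 1 = 0 := congrFun h 6
  have g7 : c 1 * u 1 - c 5 * u 2 = 0 := congrFun h 7
  have g8 : c 2 * u 1 = 0 := congrFun h 8
  have g9 : c 3 * u 1 - c 4 * u 2 = 0 := congrFun h 9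
  have g10 : c 4 * u 1 = 0 := congrFun h 10
  have g11 : c 5 * u 1 - c 2 * u 2 = 0 := congrFun h 11
  have g12 : c 0 * u 2 = 0 := congrFun h 12
  have g13 : c 1 * u 2 = 0 := congrFun h 13
  have g14 : c 3 * u 2 = 0 := congrFun h 14
  have key : c 0 = 0 ∧ c 1 = 0 ∧ c 2 = 0 ∧ c 3 = 0 ∧ c 4 = 0 ∧ c 5 = 0 := by
    by_cases h2 : u 2 = 0
    · by_cases h1 : u 1 = 0
      · have h0 : u 0 ≠ 0 := fun h0 => hu (by funext j; fin_cases j <;> assumption)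
        simp_all
      · simp_all
    · simp_all
  apply hc
  funext h
  fin_cases h <;> simp [key]

/-- If C is a conic through the six other points, the field C(X) p_i vanishes at these and is
parallel to p_i at p_i. It solves the linear equations, so by Cramer's rule the universal field is a
multiple of it. -/
theorem netInvariant_universalField_eq_zero {p : Fin 7 → Fin 3 → k} {i : Fin 7}
    (h : conicInvariant (fun l => p (i.succAbove l)) = 0) :
    netInvariant (fieldCubic (universalField p)) = 0 := by
  by_cases hp : p i = 0
  -- For `p i = 0` the scalar λ_i is unconstrained, so its unit vector is a solution and Cramer's
  -- rule makes the universal field zero.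
  · have h1 : universalField p = fun b => 0 * universalField p b := by
      funext b
      have h2 := signedMinors_proportional fieldEquiv (fieldEquations p) (Pi.single (.inr i) 1)
        (fun r => by
          rw [fieldEquations_iff]
          by_cases hr : r.1 = i
          · simp [hr, hp, quadMonomials]
          · have h3 : ∀ j h, fieldCoeff (fun _ => (0 : k)) j h = 0 := fun j h => by
              simpa using fieldCoeff_smul 0 (fun _ => (0 : k)) j h
            simp [hr, h3]) (.inl b) (.inr i)
      simpa [universalField] using h2
    have h2 : fieldCubic (universalField p) = fun j m => 0 * fieldCubic (universalField p) j m := by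
      funext j m
      rw [← fieldCubic_smul, ← h1]
    rw [h2, netInvariant_smul]
    simp
  · obtain ⟨c, hc, hz⟩ := exists_conic_of_conicInvariant_eq_zero h
    have h0 := conicField_ne_zero hc hp
    obtain ⟨a, ha⟩ := Function.ne_iff.1 h0
    have h3 : ∀ b, universalField p b * conicField c (p i) a =
        conicField c (p i) b * universalField p a := fun b =>
      signedMinors_proportional fieldEquiv (fieldEquations p)
        -- The scalars λ_l: the value of C at p_i for l = i and zero otherwise, corrected by the
        -- normalizing multiple of X.
        (Sum.elim (conicField c (p i)) fun l => (if l = i then ∑ h,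
            c h * quadMonomials (p i) h else 0)
          - p i 2 * (c 4 * p l 0 + c 5 * p l 1 + c 2 * p l 2)) (fun r => by
          rw [fieldEquations_iff]
          simp only [Sum.elim_inl, Sum.elim_inr]
          rw [conicField_eval]
          by_cases hr : r.1 = i
          · rw [if_pos hr, hr]
            ring
          · rw [if_neg hr]
            obtain ⟨l, hl⟩ := Fin.exists_succAbove_eq hr
            rw [← hl, hz l]
            ring) (.inl b) (.inl a)
    have h4 : universalField p =
        fun b => universalField p a / conicField c (p i) a * conicField c (p i) b := by
      funext b
      rw [div_mul_eq_mul_div, eq_div_iff ha, h3, mul_comm]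
    have h5 : fieldCubic (universalField p) = fun j m =>
        universalField p a / conicField c (p i) a * fieldCubic (conicField c (p i)) j m := by
      funext j m
      rw [← fieldCubic_smul, ← h4]
    rw [h5, netInvariant_smul, netInvariant_conicField, mul_zero]

theorem prod_omitConicInvariant_dvd [IsAlgClosed k] [CharZero k] :
    ∏ i, omitConicInvariant k i ∣ netInvariantS k := by
  refine Finset.prod_dvd_of_isRelPrime (fun i _ j _ hij => ?_) fun i _ => ?_
  · exact ((omitConicInvariant_prime i).irreducible.isRelPrime_iff_not_dvd).2
      (omitConicInvariant_not_dvd hij)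
  · refine dvd_of_forall_eval_eq_zero (omitConicInvariant_prime i) fun p hp => ?_
    have h1 := eval_omitConicInvariant i fun a b => p (a, b)
    have h2 := eval_netInvariantS fun a b => p (a, b)
    rw [hp] at h1
    exact h2.trans (netInvariant_universalField_eq_zero h1.symm)

end UniversalForm

/-! ### General seven points -/

section GeneralPoints

/-- The matrix of the first seven of the cubic monomials of seven points. -/
def inlMatrix {R : Type*} [CommRing R] (p : Fin 7 → Fin 3 → R) : Matrix (Fin 7) (Fin 7) R :=
  Matrix.of fun i m => cubicMonomials (p i) (.inl m)

theorem map_det_inlMatrix {R S : Type*} [CommRing R] [CommRing S] (f : R →+* S)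
    (p : Fin 7 → Fin 3 → R) : f (inlMatrix p).det = (inlMatrix fun i j => f (p i j)).det := by
  rw [RingHom.map_det]
  congr 1
  ext i m
  simp only [inlMatrix, RingHom.mapMatrix_apply, Matrix.map_apply, Matrix.of_apply,
    map_cubicMonomials]

variable {k : Type*} [Field k]

theorem linearIndependent_of_inlMatrix {p : Fin 7 → Fin 3 → k} (h : (inlMatrix p).det ≠ 0) :
    LinearIndependent k fun i => cubicMonomials (p i) := by
  refine LinearIndependent.of_comp (LinearMap.funLeft k k Sum.inl) ?_
  exact Matrix.linearIndependent_rows_iff_isUnit.2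
    ((Matrix.isUnit_iff_isUnit_det _).2 (isUnit_iff_ne_zero.2 h))

theorem cubicMonomials_smul {R : Type*} [CommRing R] (r : R) (v : Fin 3 → R) :
    cubicMonomials (r • v) = r ^ 3 • cubicMonomials v := by
  funext m
  rcases m with m | m <;> fin_cases m <;> simp [cubicMonomials] <;> ring

theorem distinctPoints_of_linearIndependent {p : Fin 7 → Fin 3 → k}
    (hW : LinearIndependent k fun i => cubicMonomials (p i)) : DistinctPoints p := by
  have h0 : ∀ i, p i ≠ 0 := by
    intro i h
    apply hW.ne_zero i
    funext m
    rw [h, cubicMonomials_eq_prod]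
    rcases m with m | m <;> fin_cases m <;> simp [cubicExponents, Fin.prod_univ_three]
  refine ⟨h0, fun i j hij => (LinearIndependent.pair_iff' (h0 i)).2 fun a ha => ?_⟩
  have h1 : cubicMonomials (p j) = a ^ 3 • cubicMonomials (p i) := by
    rw [← ha, cubicMonomials_smul]
  have h2 := Fintype.linearIndependent_iff.1 hW (fun l => (if l = i then a ^ 3 else 0) -
    if l = j then 1 else 0) (by simp [sub_smul, Finset.sum_sub_distrib, ite_smul, h1]) j
  simp [hij.symm] at h2

theorem not_onConic_of_conicInvariant_ne_zero [CharZero k] {p : Fin 7 → Fin 3 → k} {i : Fin 7}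
    (h : conicInvariant (fun l => p (i.succAbove l)) ≠ 0) : ¬ OnConic p := by
  rintro ⟨f, hf0, hf, hz⟩
  obtain ⟨c, rfl⟩ := exists_quadForm hf
  have h1 := eq_zero_of_conicInvariant_ne_zero h (c := c) fun l => by
    rw [← eval_quadForm]
    exact hz _
  exact hf0 (by simp [h1, quadForm])

/-- Seven points with a Hilbert–Burch matrix whose first row is `X`. -/
def basePoints (k : Type*) [Field k] : Fin 7 → Fin 3 → k :=
  ![![1, 0, 1], ![0, 1, 1], ![0, 0, 1], ![1, 1, 2], ![1, 0, 2], ![0, 1, 2], ![3, 4, 5]]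

/-- The second row of the Hilbert–Burch matrix of `basePoints`. -/
def baseField (k : Type*) [Field k] : Fin 15 → k :=
  ![12, 0, 0, 0, -4, 0, 0, 3, 0, 3, 0, -1, 8, 2, -2]

theorem det_inlMatrix_basePoints [CharZero k] : (inlMatrix (basePoints k)).det ≠ 0 := by
  intro h
  obtain ⟨g, hg, h⟩ := Matrix.exists_vecMul_eq_zero_iff.2 h
  have e : ∀ m, ∑ i, g i * inlMatrix (basePoints k) i m = 0 := fun m => congrFun h m
  have e0 := e 0
  have e1 := e 1
  have e2 := e 2
  have e3 := e 3
  have e4 := e 4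
  have e5 := e 5
  have e6 := e 6
  simp only [inlMatrix, basePoints, cubicMonomials, Fin.sum_univ_seven, Matrix.of_apply,
    Sum.elim_inl, Matrix.cons_val] at e0 e1 e2 e3 e4 e5 e6
  -- The coefficients here and below are those of interpolating cubics in the first seven monomials,
  -- equal to 1 at one of the points and to 0 at the other six.
  have r0 : g 0 = 0 := by
    linear_combination (2 : k) * e0 + (-3/2) * e3 + (-1) * e4 + (3/4) * e6
  have r1 : g 1 = 0 := by
    linear_combination (2 : k) * e1 + (-8) * e3 + (-1) * e5 + (4) * e6
  have r2 : g 2 = 0 := by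
    linear_combination (6 : k) * e0 + 6 * e1 + e2 + (-6) * e3 + (-7) * e4 + (-7) * e5 + 7 * e6
  have r3 : g 3 = 0 := by
    linear_combination (-5 : k) * e3 + 3 * e6
  have r4 : g 4 = 0 := by
    linear_combination (-1 : k) * e0 + 2 * e3 + e4 + (-3/2) * e6
  have r5 : g 5 = 0 := by
    linear_combination (-1 : k) * e1 + (7/3) * e3 + e5 + (-5/3) * e6
  have r6 : g 6 = 0 := by
    linear_combination (1/6 : k) * e3 + (-1/12) * e6
  apply hg
  funext i
  fin_cases i <;> assumption

theorem conicInvariant_basePoints :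
    conicInvariant (fun l => basePoints k (Fin.succAbove 6 l)) = -1 := by
  have h : (fun l => basePoints k (Fin.succAbove 6 l)) =
      ![![1, 0, 1], ![0, 1, 1], ![0, 0, 1], ![1, 1, 2], ![1, 0, 2], ![0, 1, 2]] := by
    funext l
    fin_cases l <;> rfl
  rw [h]
  simp only [conicInvariant, bracket, Matrix.det_fin_three, Matrix.of_apply, Matrix.cons_val]
  ring

theorem basePoints_two_ne_zero [CharZero k] (i : Fin 7) : basePoints k i 2 ≠ 0 := by
  fin_cases i <;> simp [basePoints]

theorem det_sylvesterMatrix_baseField [CharZero k] : (sylvesterMatrix (baseField k)).det ≠ 0 := by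
  rw [det_fin_five]
  simp only [det_fin_four, Matrix.submatrix_apply, Matrix.of_apply, Matrix.cons_val,
    sylvesterMatrix, baseField]
  norm_num

theorem netInvariant_baseField [CharZero k] : netInvariant (fieldCubic (baseField k)) ≠ 0 := by
  simp [netInvariant, Fin.sum_univ_succ, invariantWeights, invariantTriples, fieldCubic,
    baseField, Matrix.det_fin_three]
  norm_num

/-- The row X and `baseField` form a Hilbert–Burch matrix, so the universal field is known up to a
factor without evaluating a determinant of size 22. -/
theorem exists_universalField_basePoints [CharZero k] : ∃ c : k, c ≠ 0 ∧
    universalField (basePoints k) = fun b => c * baseField k b := by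
  have hW := linearIndependent_of_inlMatrix (det_inlMatrix_basePoints (k := k))
  have h := isHilbertBurchMatrix_of_sylvester (p := basePoints k) (q := baseField k) (fun i j => by
    fin_cases i <;> fin_cases j <;>
    · simp [basePoints, baseField, fieldCubic, cubicMonomials, Fin.sum_univ_succ]
      try norm_num) basePoints_two_ne_zero hW
    (not_onConic_of_conicInvariant_ne_zero (i := 6) (by rw [conicInvariant_basePoints]; simp))
    det_sylvesterMatrix_baseField
  obtain ⟨c, hc, h1⟩ := universalField_eq_detForm (distinctPoints_of_linearIndependent hW).1 h
  refine ⟨c, hc, fieldForm_injective ?_⟩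
  rw [fieldForm_smul]
  exact h1

theorem netInvariantS_ne_zero [CharZero k] : netInvariantS k ≠ 0 := by
  intro h
  obtain ⟨c, hc, h1⟩ := exists_universalField_basePoints (k := k)
  have h2 := eval_netInvariantS (basePoints k)
  have h3 : fieldCubic (universalField (basePoints k)) = fun j m =>
      c * fieldCubic (baseField k) j m := by
    funext j m
    rw [← fieldCubic_smul, ← h1]
  rw [h, map_zero, h3, netInvariant_smul] at h2
  exact mul_ne_zero (pow_ne_zero 3 hc) netInvariant_baseField h2.symm

/-- On the complement of the zero locus of this polynomial `X` is the first row of a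
Hilbert–Burch matrix. -/
def generalLocus (k : Type*) [Field k] : CoordRing k :=
  (inlMatrix (genericPoint k)).det * (∏ i, X (i, 2)) *
    (sylvesterMatrix (universalField (genericPoint k))).det * omitConicInvariant k 6

theorem map_det_sylvesterMatrix {R S : Type*} [CommRing R] [CommRing S] (f : R →+* S)
    (q : Fin 15 → R) :
    f (sylvesterMatrix q).det = (sylvesterMatrix fun b => f (q b)).det := by
  rw [RingHom.map_det]
  congr 1
  ext i m
  fin_cases i <;> fin_cases m <;> simp [sylvesterMatrix]

theorem eval_generalLocus (p : Fin 7 → Fin 3 → k) :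
    eval (fun a : Fin 7 × Fin 3 => p a.1 a.2) (generalLocus k) =
      (inlMatrix p).det * (∏ i, p i 2) * (sylvesterMatrix (universalField p)).det *
        conicInvariant fun l => p (Fin.succAbove 6 l) := by
  rw [generalLocus, map_mul, map_mul, map_mul, eval_omitConicInvariant, map_det_inlMatrix,
    map_det_sylvesterMatrix, map_prod]
  simp only [map_universalField, genericPoint, eval_X]

theorem generalLocus_ne_zero [CharZero k] : generalLocus k ≠ 0 := by
  intro h
  obtain ⟨c, hc, h1⟩ := exists_universalField_basePoints (k := k)
  have h2 := eval_generalLocus (basePoints k)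
  have h3 : (sylvesterMatrix fun b => c * baseField k b) = c • sylvesterMatrix (baseField k) := by
    ext i m
    fin_cases i <;> fin_cases m <;> simp [sylvesterMatrix] <;> ring
  rw [h, map_zero, h1, h3, Matrix.det_smul, conicInvariant_basePoints] at h2
  refine mul_ne_zero (mul_ne_zero (mul_ne_zero det_inlMatrix_basePoints
    (Finset.prod_ne_zero_iff.2 fun i _ => basePoints_two_ne_zero i))
    (mul_ne_zero (pow_ne_zero _ hc) det_sylvesterMatrix_baseField))
    (by simp : (-1 : k) ≠ 0) h2.symm

/-- The definition of `IsUniversalS` constrains S only where a Hilbert–Burch matrix exists. On this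
open set, X and the universal field itself provide one. -/
theorem IsUniversalS.eval_eq [CharZero k] {S : MvPolynomial (Fin 3 ⊕ Fin 3) (CoordRing k)}
    (hS : IsUniversalS S) {p : Fin 7 → Fin 3 → k}
    (hp : eval (fun a : Fin 7 × Fin 3 => p a.1 a.2) (generalLocus k) ≠ 0) :
    ∃ c : k, c ≠ 0 ∧ map (eval fun a : Fin 7 × Fin 3 => p a.1 a.2) S =
      C c * fieldForm (universalField p) := by
  rw [eval_generalLocus] at hp
  have h1 := right_ne_zero_of_mul hp
  have h2 := right_ne_zero_of_mul (left_ne_zero_of_mul hp)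
  have h3 := left_ne_zero_of_mul (left_ne_zero_of_mul hp)
  have hW := linearIndependent_of_inlMatrix (left_ne_zero_of_mul h3)
  have hz := fun i => Finset.prod_ne_zero_iff.1 (right_ne_zero_of_mul h3) i (Finset.mem_univ i)
  have hc := not_onConic_of_conicInvariant_ne_zero h1
  exact hS.2 p (distinctPoints_of_linearIndependent hW) hc _ _
    (isHilbertBurchMatrix_of_sylvester (universalField_eval_eq_zero p) hz hW hc h2)

theorem eq_of_forall_eval_eq {σ : Type*} [Infinite k] {G G' H : MvPolynomial σ k} (hH : H ≠ 0)
    (h : ∀ p, eval p H ≠ 0 → eval p G = eval p G') : G = G' := by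
  have h1 : (G - G') * H = 0 := by
    by_contra h0
    obtain ⟨p, hp⟩ := exists_eval_ne_zero h0
    rw [map_mul, map_sub] at hp
    exact left_ne_zero_of_mul hp (sub_eq_zero.2 (h p (right_ne_zero_of_mul hp)))
  exact sub_eq_zero.1 ((mul_eq_zero.1 h1).resolve_right hH)

/-- Proportionality over the function field, from proportionality at general points. The factor may
vary with the point. -/
theorem IsUniversalS.coeff_mul_coeff [CharZero k] {S : MvPolynomial (Fin 3 ⊕ Fin 3) (CoordRing k)}
    (hS : IsUniversalS S) (m n : Fin 3 ⊕ Fin 3 →₀ ℕ) :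
    coeff m S * coeff n (universalS k) = coeff n S * coeff m (universalS k) := by
  refine eq_of_forall_eval_eq generalLocus_ne_zero fun p hp => ?_
  obtain ⟨c, -, h⟩ := hS.eval_eq (p := fun a b => p (a, b)) hp
  have h1 := map_universalS fun a b => p (a, b)
  rw [← h1] at h
  have h2 : ∀ m, eval p (coeff m S) = c * eval p (coeff m (universalS k)) := by
    intro m
    have h3 := congrArg (coeff m) h
    rwa [coeff_C_mul, coeff_map, coeff_map] at h3
  rw [map_mul, map_mul, h2, h2]
  ring

theorem IsUniversalS.ne_zero [CharZero k] {S : MvPolynomial (Fin 3 ⊕ Fin 3) (CoordRing k)}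
    (hS : IsUniversalS S) : S ≠ 0 := by
  rintro rfl
  obtain ⟨p, hp⟩ := exists_eval_ne_zero
    (mul_ne_zero (generalLocus_ne_zero (k := k)) netInvariantS_ne_zero)
  rw [map_mul] at hp
  obtain ⟨c, hc, h⟩ := hS.eval_eq (p := fun a b => p (a, b)) (left_ne_zero_of_mul hp)
  rw [map_zero] at h
  have h1 := (mul_eq_zero.1 h.symm).resolve_left (by simpa using hc)
  have h2 := pfaffian6_fieldForm (universalField fun a b => p (a, b))
  rw [h1, ← eval_netInvariantS] at h2
  apply right_ne_zero_of_mul hp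
  have h3 : pfaffian6 (coeffMatrix (morleyForm (0 : MvPolynomial (Fin 3 ⊕ Fin 3) k))) = 0 := by
    simp [pfaffian6, coeffMatrix, morleyForm]
  rw [h3] at h2
  exact neg_eq_zero.1 h2.symm

end GeneralPoints

/-! ### The explicit invariant of seven points -/

section ExplicitInvariant

variable {k : Type*} [Field k]

/-- The explicit form of the Morley invariant. -/
def explicitPsi (k : Type*) [Field k] : CoordRing k :=
  dualInvariant fun i => cubicMonomials (genericPoint k i)

theorem aeval_explicitPsi {R : Type*} [CommRing R] [Algebra k R] (p : Fin 7 × Fin 3 → R) :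
    aeval p (explicitPsi k) = dualInvariant fun i => cubicMonomials fun j => p (i, j) := by
  rw [explicitPsi, ← AlgHom.coe_toRingHom, map_dualInvariant]
  congr 1
  funext i m
  rw [map_cubicMonomials]
  simp [genericPoint]

theorem eval_explicitPsi (p : Fin 7 → Fin 3 → k) :
    eval (fun a : Fin 7 × Fin 3 => p a.1 a.2) (explicitPsi k) =
      dualInvariant fun i => cubicMonomials (p i) := by
  rw [← aeval_eq_eval]
  exact aeval_explicitPsi _

theorem dualInvariant_isWeightedHomogeneous {σ : Type*} {w : σ → ℕ}
    {W : Fin 7 → CubicIndex → MvPolynomial σ k} {d : Fin 7 → ℕ}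
    (hW : ∀ i m, IsWeightedHomogeneous w (W i m) (d i)) :
    IsWeightedHomogeneous w (dualInvariant W) (∑ i, d i) := by
  refine Submodule.sum_mem (weightedHomogeneousSubmodule k _ _) fun t _ => ?_
  have h : (invariantWeights t : MvPolynomial σ k) = C (invariantWeights t) := by
    fin_cases t <;> simp [invariantWeights, ← map_ofNat (C (σ := σ) (R := k))]
  rw [h]
  refine IsWeightedHomogeneous.C_mul (det_isWeightedHomogeneous
    (a := Sum.elim d fun _ => 0) (b := fun _ => 0)
    (fun r c => ?_) (by simp [Fintype.sum_sum_type])) _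
  rcases r with r | r
  · exact Or.inr ⟨d r, rfl, hW r c⟩
  · simp only [Matrix.of_apply, Sum.elim_inr, Pi.single_apply]
    split_ifs
    · exact Or.inr ⟨0, rfl, isWeightedHomogeneous_one _ _⟩
    · exact Or.inl rfl

/-- The cubic monomials as triples of indices. -/
def cubicTriple : CubicIndex → Fin 3 → Fin 3 :=
  Sum.elim ![![0, 0, 0], ![1, 1, 1], ![2, 2, 2], ![0, 0, 1], ![0, 0, 2], ![1, 1, 2], ![0, 1, 2]]
    ![![0, 1, 1], ![0, 2, 2], ![1, 2, 2]]

theorem cubicMonomials_eq_triple {R : Type*} [CommRing R] (v : Fin 3 → R) (m : CubicIndex) :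
    cubicMonomials v m = v (cubicTriple m 0) * v (cubicTriple m 1) * v (cubicTriple m 2) := by
  rcases m with m | m <;> fin_cases m <;> simp [cubicMonomials, cubicTriple] <;> ring

theorem cubicMonomials_isWeightedHomogeneous {σ : Type*} {w : σ → ℕ}
    {v : Fin 3 → MvPolynomial σ k} {e : ℕ} (hv : ∀ j, IsWeightedHomogeneous w (v j) e)
    (m : CubicIndex) : IsWeightedHomogeneous w (cubicMonomials v m) (e + e + e) := by
  rw [cubicMonomials_eq_triple]
  exact ((hv _).mul (hv _)).mul (hv _)

theorem explicitPsi_isMultihomogeneous : IsMultihomogeneous (explicitPsi k) fun _ => 3 := by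
  intro i
  have h := dualInvariant_isWeightedHomogeneous
    (w := fun a : Fin 7 × Fin 3 => if a.1 = i then 1 else 0)
    (W := fun l => cubicMonomials (genericPoint k l))
    (fun l m => cubicMonomials_isWeightedHomogeneous (e := if l = i then 1 else 0)
      (fun j => isWeightedHomogeneous_X k _ (l, j)) m)
  rw [explicitPsi]
  simpa [Finset.sum_add_distrib] using h

theorem explicitPsi_isHomogeneous : (explicitPsi k).IsHomogeneous 21 := by
  simpa using isHomogeneous_sum_of_isMultihomogeneous (explicitPsi_isMultihomogeneous (k := k))

theorem det_inlMatrix_eq {R : Type*} [CommRing R] (p : Fin 7 → Fin 3 → R) :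
    Matrix.det (Matrix.of fun i b => ∑ m, cubicMonomials (p i) m *
      (if m = Sum.inl b then 1 else 0)) = (inlMatrix p).det := by
  congr 1
  ext i b
  simp [inlMatrix]

/-- Complementary minors, with `K` the inclusion of the first seven monomials, so that `W K` is
`inlMatrix`. -/
theorem explicitPsi_dvd_det_mul : explicitPsi k ∣ (inlMatrix (genericPoint k)).det * netInvariantS k
    := by
  have h := dualInvariant_mul_det (fun i => cubicMonomials (genericPoint k i))
    (fieldCubic (universalField (genericPoint k))) (fun i j => by
      rw [← universalField_eval_eq_zero (genericPoint k) i j]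
      exact Finset.sum_congr rfl fun m _ => mul_comm _ _)
    fun m b => if m = Sum.inl b then 1 else 0
  rw [det_inlMatrix_eq] at h
  exact Dvd.intro _ h

/-- The points of the Fano plane. -/
def fanoPoints (k : Type*) [Field k] : Fin 7 → Fin 3 → k :=
  ![![1, 0, 0], ![0, 1, 0], ![0, 0, 1], ![1, 1, 0], ![1, 0, 1], ![0, 1, 1], ![1, 1, 1]]

theorem det_inlMatrix_fanoPoints : (inlMatrix (fanoPoints k)).det ≠ 0 := by
  intro h
  obtain ⟨g, hg, h⟩ := Matrix.exists_vecMul_eq_zero_iff.2 h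
  have e : ∀ m, ∑ i, g i * inlMatrix (fanoPoints k) i m = 0 := fun m => congrFun h m
  have e0 := e 0
  have e1 := e 1
  have e2 := e 2
  have e3 := e 3
  have e4 := e 4
  have e5 := e 5
  have e6 := e 6
  simp only [inlMatrix, fanoPoints, cubicMonomials, Fin.sum_univ_seven, Matrix.of_apply,
    Sum.elim_inl, Matrix.cons_val] at e0 e1 e2 e3 e4 e5 e6
  have r0 : g 0 = 0 := by linear_combination e0 - e3 - e4 + e6
  have r1 : g 1 = 0 := by linear_combination e1 - e3 - e5 + e6
  have r2 : g 2 = 0 := by linear_combination e2 - e4 - e5 + e6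
  have r3 : g 3 = 0 := by linear_combination e3 - e6
  have r4 : g 4 = 0 := by linear_combination e4 - e6
  have r5 : g 5 = 0 := by linear_combination e5 - e6
  have r6 : g 6 = 0 := by linear_combination e6
  apply hg
  funext i
  fin_cases i <;> assumption

theorem det_sumElim_single (c : Fin 3 → Fin 7 → k) :
    Matrix.det (Matrix.of fun m : CubicIndex => Sum.elim (fun b => if m = Sum.inl b then 1 else 0)
      fun j => Sum.elim (c j) (fun l => if l = j then 1 else 0) m) = 1 := by
  have h : (Matrix.of fun m : CubicIndex => Sum.elim (fun b => if m = Sum.inl b then 1 else 0)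
      fun j => Sum.elim (c j) (fun l => if l = j then 1 else 0) m : Matrix CubicIndex CubicIndex k)
          =
      Matrix.fromBlocks 1 (Matrix.of fun m j => c j m) 0 1 := by
    ext m b
    rcases m with m | m <;> rcases b with b | b <;> simp [Matrix.one_apply]
  rw [h, Matrix.det_fromBlocks_zero₂₁]
  simp

theorem explicitPsi_fanoPoints :
    eval (fun a : Fin 7 × Fin 3 => fanoPoints k a.1 a.2) (explicitPsi k) = 0 := by
  -- The net of cubics X_i X_j² - X_i² X_j through the points. Only the second and third triples of
  -- the invariant contribute, with opposite signs.
  let c : Fin 3 → Fin 7 → k := ![![0, 0, 0, -1, 0, 0, 0], ![0, 0, 0, 0, -1, 0, 0], ![0, 0, 0, 0, 0,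
      -1, 0]]
  have h := dualInvariant_mul_det (fun i => cubicMonomials (fanoPoints k i))
    (fun j => Sum.elim (c j) fun l => if l = j then 1 else 0) (fun i j => by
      fin_cases i <;> fin_cases j <;>
        simp [Fintype.sum_sum_type, fanoPoints, cubicMonomials, c, Fin.sum_univ_succ])
    fun m b => if m = Sum.inl b then 1 else 0
  have h1 : netInvariant (fun j => Sum.elim (c j) fun l => if l = j then (1 : k) else 0) = 0 := by
    simp [netInvariant, Fin.sum_univ_succ, invariantWeights, invariantTriples, c,
      Matrix.det_fin_three]
  rw [h1, mul_zero, det_sumElim_single, mul_one] at h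
  rw [eval_explicitPsi, h]

theorem explicitPsi_not_dvd_det : ¬ explicitPsi k ∣ (inlMatrix (genericPoint k)).det := by
  rintro ⟨r, hr⟩
  have h := congrArg (eval fun a : Fin 7 × Fin 3 => fanoPoints k a.1 a.2) hr
  rw [map_mul, explicitPsi_fanoPoints, zero_mul, map_det_inlMatrix] at h
  simp only [genericPoint, eval_X] at h
  exact det_inlMatrix_fanoPoints h

theorem omitConicInvariant_isHomogeneous (i : Fin 7) : (omitConicInvariant k i).IsHomogeneous 12 :=
    by
  have h := isHomogeneous_sum_of_isMultihomogeneous (genericConicInvariant_isMultihomogeneous (k :=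
      k))
  have h1 := h.rename_isHomogeneous (f := Prod.map i.succAbove (id : Fin 3 → Fin 3))
  rw [genericConicInvariant, ← AlgHom.coe_toRingHom, map_conicInvariant] at h1
  simp only [AlgHom.coe_toRingHom, rename_X, Prod.map_apply, id, Finset.sum_const,
    Finset.card_univ, Fintype.card_fin, smul_eq_mul] at h1
  exact h1

theorem netInvariantS_isHomogeneous : (netInvariantS k).IsHomogeneous 105 := by
  have h1 := fieldCubic_mem (homogeneousSubmodule (Fin 7 × Fin 3) k 35).toAddSubgroup
      (fun b => by
        simpa using isHomogeneous_sum_of_isMultihomogeneous (universalField_isMultihomogeneous k b))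
  refine Submodule.sum_mem (homogeneousSubmodule _ k 105) fun t _ => ?_
  have h : (invariantWeights t : CoordRing k) = C (invariantWeights t) := by
    fin_cases t <;> simp [invariantWeights, ← map_ofNat (C (σ := Fin 7 × Fin 3) (R := k))]
  rw [h]
  refine IsHomogeneous.C_mul (det_isWeightedHomogeneous (w := 1)
    (a := fun _ => 35) (b := fun _ => 0) (fun r c => Or.inr ⟨35, rfl, h1 _ _⟩) (by simp)) _

/-- The prime `explicitPsi` divides `netInvariantS` because it does not divide the determinant of
`inlMatrix`. Having degree 21, it divides none of the conic invariants, of degree 12. The product of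
all these has degree 21 + 84 = 105, the degree of `netInvariantS`. -/
theorem exists_netInvariantS_eq [IsAlgClosed k] [CharZero k] (hΨ : Irreducible (explicitPsi k)) :
    ∃ c : k, c ≠ 0 ∧ netInvariantS k = C c * explicitPsi k * ∏ i, omitConicInvariant k i := by
  have hp := hΨ.prime
  have h1 := (hp.dvd_or_dvd explicitPsi_dvd_det_mul).resolve_left explicitPsi_not_dvd_det
  have h2 : IsRelPrime (explicitPsi k) (∏ i, omitConicInvariant k i) := by
    rw [hΨ.isRelPrime_iff_not_dvd, hp.dvd_finsetProd_iff]
    rintro ⟨i, -, hi⟩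
    obtain ⟨r, hr⟩ := hi
    have h0 := (omitConicInvariant_prime (k := k) i).ne_zero
    have h3 := (omitConicInvariant_isHomogeneous (k := k) i).totalDegree h0
    rw [hr] at h0 h3
    rw [totalDegree_mul_of_isDomain (left_ne_zero_of_mul h0) (right_ne_zero_of_mul h0),
      explicitPsi_isHomogeneous.totalDegree hp.ne_zero] at h3
    omega
  obtain ⟨r, hr⟩ := h2.mul_dvd h1 prod_omitConicInvariant_dvd
  have h0 := netInvariantS_ne_zero (k := k)
  have h3 := netInvariantS_isHomogeneous.totalDegree h0
  have h4 : (∏ i, omitConicInvariant k i).IsHomogeneous 84 :=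
    IsHomogeneous.prod Finset.univ _ (fun _ => 12) fun i _ => omitConicInvariant_isHomogeneous i
  rw [hr] at h0 h3
  have h5 := left_ne_zero_of_mul h0
  rw [totalDegree_mul_of_isDomain h5 (right_ne_zero_of_mul h0),
    totalDegree_mul_of_isDomain (left_ne_zero_of_mul h5) (right_ne_zero_of_mul h5),
    explicitPsi_isHomogeneous.totalDegree hp.ne_zero,
    h4.totalDegree (right_ne_zero_of_mul h5)] at h3
  obtain ⟨c, hc⟩ : ∃ c, r = C c := ⟨_, totalDegree_eq_zero_iff_eq_C.1 (by omega)⟩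
  refine ⟨c, ?_, ?_⟩
  · rintro rfl
    simp [hc] at h0
  · rw [hr, hc]
    ring

theorem pfaffian6_C_mul {R : Type*} [CommRing R] (b : R) (S : MvPolynomial (Fin 3 ⊕ Fin 3) R) :
    pfaffian6 (coeffMatrix (morleyForm (C b * S))) =
      b ^ 3 * pfaffian6 (coeffMatrix (morleyForm S)) := by
  have h : ∀ i j, coeffMatrix (morleyForm (C b * S)) i j = b * coeffMatrix (morleyForm S) i j := by
    intro i j
    have h1 : morleyForm (C b * S) = C b * morleyForm S := by
      simp only [morleyForm, pderiv_C_mul, Finset.mul_sum]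
      exact Finset.sum_congr rfl fun j _ => by ring
    rw [coeffMatrix, coeffMatrix, Matrix.of_apply, Matrix.of_apply, h1, coeff_C_mul]
  simp only [pfaffian6, pfaffian4, h]
  ring

theorem exists_isMorleyInvariant [IsAlgClosed k] [CharZero k] :
    ∃ Ψ : CoordRing k, IsMorleyInvariant Ψ := by
  obtain ⟨r, hr⟩ := prod_omitConicInvariant_dvd (k := k)
  refine ⟨-r, universalS k, isUniversalS_universalS, ?_⟩
  rw [pfaffian6_universalS, hr, neg_mul, mul_comm]
  rfl

/-- Write S as a/b times the universal form, in lowest terms. The pfaffian is cubic in S, so b³Ψ =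
-c a³ `explicitPsi`. Thus b³ divides an irreducible polynomial, and b is a unit. The coefficients of
both forms have the same degree, so a/b is a constant. -/
theorem IsMorleyInvariant.eq_explicitPsi [IsAlgClosed k] [CharZero k]
    (hΨ : Irreducible (explicitPsi k)) {Ψ : CoordRing k} (h : IsMorleyInvariant Ψ) :
    ∃ c : k, c ≠ 0 ∧ Ψ = C c * explicitPsi k := by
  obtain ⟨S, hS, hpf⟩ := h
  obtain ⟨c, hc, hF⟩ := exists_netInvariantS_eq hΨ
  have hS0 := (isUniversalS_universalS (k := k)).ne_zero
  obtain ⟨n, hn⟩ := MvPolynomial.ne_zero_iff.1 hS0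
  obtain ⟨a, b, g, hab, ha, hb⟩ : ∃ a b g, IsRelPrime a b ∧ a * g = coeff n S ∧
      b * g = coeff n (universalS k) := by
    obtain ⟨b, a, g, h1, h2, h3⟩ := UniqueFactorizationMonoid.exists_reduced_factors (coeff n
        (universalS k)) hn (coeff n S)
    exact ⟨a, b, g, h1.symm, by rw [mul_comm, h3], by rw [mul_comm, h2]⟩
  have hg : g ≠ 0 := right_ne_zero_of_mul (hb.trans_ne hn)
  have hcoeff : ∀ m, b * coeff m S = a * coeff m (universalS k) := by
    intro m
    have h1 := hS.coeff_mul_coeff m n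
    rw [← ha, ← hb] at h1
    refine mul_left_cancel₀ hg ?_
    linear_combination h1
  have hforms : C b * S = C a * universalS k := by
    ext m : 1
    rw [coeff_C_mul, coeff_C_mul, hcoeff]
  have h1 := pfaffian6_C_mul b S
  rw [hforms, pfaffian6_C_mul, pfaffian6_universalS, hF, hpf] at h1
  have hQ : ∏ i, omitConicInvariant k i ≠ 0 :=
    Finset.prod_ne_zero_iff.2 fun i _ => (omitConicInvariant_prime i).ne_zero
  have h2 : a ^ 3 * (C (-c) * explicitPsi k) = b ^ 3 * Ψ := by
    refine mul_right_cancel₀ hQ ?_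
    rw [map_neg]
    refine Eq.trans ?_ (h1.trans (mul_assoc _ _ _).symm)
    ring
  have hu : IsUnit (C (-c) : CoordRing k) := (IsUnit.mk0 (-c) (neg_ne_zero.2 hc)).map C
  have h3 : b ^ 3 ∣ explicitPsi k := by
    have h4 : b ^ 3 ∣ a ^ 3 * (C (-c) * explicitPsi k) := Dvd.intro _ h2.symm
    have h5 := (IsRelPrime.pow (m := 3) (n := 3) hab).symm.dvd_of_dvd_mul_left h4
    exact hu.dvd_mul_left.1 h5
  have hbu : IsUnit b := by
    obtain ⟨r, hr⟩ := h3
    rcases hΨ.isUnit_or_isUnit (show explicitPsi k = b * (b ^ 2 * r) by rw [hr]; ring) with h4 | h4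
    · exact h4
    · exact (isUnit_pow_iff two_ne_zero).1 (isUnit_of_mul_isUnit_left h4)
  obtain ⟨b', hb'⟩ := hbu.exists_left_inv
  have hSn : coeff n S = b' * a * coeff n (universalS k) := by
    linear_combination b' * hcoeff n - coeff n S * hb'
  have hne : coeff n S ≠ 0 := by
    intro h0
    apply hS.ne_zero
    ext m : 1
    have h4 := hS.coeff_mul_coeff m n
    rw [h0, zero_mul] at h4
    simpa using (mul_eq_zero.1 h4).resolve_right hn
  have d1 := (isHomogeneous_sum_of_isMultihomogeneous (hS.1 n)).totalDegree hne
  have d2 := (isHomogeneous_sum_of_isMultihomogeneous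
    ((isUniversalS_universalS (k := k)).1 n)).totalDegree hn
  rw [hSn] at hne d1
  rw [totalDegree_mul_of_isDomain (left_ne_zero_of_mul hne) hn, d2] at d1
  obtain ⟨e, he⟩ : ∃ e, b' * a = C e := ⟨_, totalDegree_eq_zero_iff_eq_C.1 (by omega)⟩
  have he0 : e ≠ 0 := by
    rintro rfl
    simp [he] at hne
  refine ⟨e ^ 3 * (-c), mul_ne_zero (pow_ne_zero 3 he0) (neg_ne_zero.2 hc), ?_⟩
  rw [map_mul, map_pow, ← he]
  have h5 : (b' * b) ^ 3 = 1 := by rw [hb', one_pow]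
  linear_combination (-b' ^ 3) * h2 - Ψ * h5

end ExplicitInvariant

/-! ### The rational parametrization of a nonsingular conic -/

section NormalForm

variable {k : Type*} [Field k]

theorem eval_conicForm (A : Matrix (Fin 3) (Fin 3) k) (v : Fin 3 → k) :
    eval v (conicForm A) = ∑ i, ∑ j, A i j * v i * v j := by
  simp [conicForm]

theorem exists_isotropic [IsAlgClosed k] [CharZero k] (A : Matrix (Fin 3) (Fin 3) k) :
    ∃ a : Fin 3 → k, a ≠ 0 ∧ eval a (conicForm A) = 0 := by
  by_cases h : A 0 0 = 0
  · refine ⟨![1, 0, 0], fun h0 => by simpa using congrFun h0 0, ?_⟩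
    simp [eval_conicForm, Fin.sum_univ_three, h]
  · obtain ⟨s, hs⟩ := IsAlgClosed.exists_eq_mul_self
      (discrim (A 0 0) (A 0 1 + A 1 0) (A 1 1))
    obtain ⟨x, hx⟩ := exists_quadratic_eq_zero h ⟨s, hs⟩
    refine ⟨![x, 1, 0], fun h0 => by simpa using congrFun h0 1, ?_⟩
    simp [eval_conicForm, Fin.sum_univ_three]
    linear_combination hx

/-- Let B be the bilinear form of `A`. Take `a` isotropic, `d` with B(a, d) = 1, and correct `d` by
a multiple of `a` to an isotropic `c`. A multiple `b` of Aa × Ac is orthogonal to both. The columns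
of `g` are `a`, `b`, `c`. -/
theorem exists_normalForm [IsAlgClosed k] [CharZero k] {A : Matrix (Fin 3) (Fin 3) k}
    (hA : A.IsSymm) (hdet : A.det ≠ 0) : ∃ g : Matrix (Fin 3) (Fin 3) k, g.det ≠ 0 ∧
      ∀ y, eval (g.mulVec y) (conicForm A) = 2 * (y 0 * y 2 - y 1 ^ 2) := by
  have s1 := hA.apply 0 1
  have s2 := hA.apply 0 2
  have s3 := hA.apply 1 2
  obtain ⟨a, ha, ha0⟩ := exists_isotropic A
  obtain ⟨d, hd⟩ : ∃ d : Fin 3 → k, a ⬝ᵥ A.mulVec d = 1 := by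
    have h1 : Matrix.vecMul a A ≠ 0 := fun h =>
      hdet (Matrix.exists_vecMul_eq_zero_iff.1 ⟨a, ha, h⟩)
    obtain ⟨j, hj⟩ := Function.ne_iff.1 h1
    refine ⟨Pi.single j (Matrix.vecMul a A j)⁻¹, ?_⟩
    rw [Matrix.dotProduct_mulVec, dotProduct_single]
    exact mul_inv_cancel₀ hj
  -- The scale of `b`: the choice r² det A = 2 makes B(b, b) = -2.
  obtain ⟨r, hr⟩ := IsAlgClosed.exists_eq_mul_self (2 / A.det)
  have hr' : A.det * (r * r) = 2 := by
    rw [← hr]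
    field_simp
  obtain ⟨c, hc⟩ : ∃ c : Fin 3 → k, c = d - (eval d (conicForm A) / 2) • a := ⟨_, rfl⟩
  rw [eval_conicForm] at ha0 hc
  have hc0 : ∑ i, ∑ j, A i j * c i * c j = 0 := by
    simp only [hc, Pi.sub_apply, Pi.smul_apply, smul_eq_mul]
    simp only [dotProduct, Matrix.mulVec, Fin.sum_univ_three, s1, s2, s3] at ha0 hd ⊢
    set D := (A 0 0 * d 0 * d 0 + A 0 1 * d 0 * d 1 + A 0 2 * d 0 * d 2 +
      (A 0 1 * d 1 * d 0 + A 1 1 * d 1 * d 1 + A 1 2 * d 1 * d 2) +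
      (A 0 2 * d 2 * d 0 + A 1 2 * d 2 * d 1 + A 2 2 * d 2 * d 2)) with hD
    linear_combination (-D) * hd + D ^ 2 / 4 * ha0 - hD
  have hac : a ⬝ᵥ A.mulVec c = 1 := by
    simp only [hc, dotProduct, Matrix.mulVec, Pi.sub_apply, Pi.smul_apply, smul_eq_mul,
      Fin.sum_univ_three, s1, s2, s3] at ha0 hd ⊢
    set D := (A 0 0 * d 0 * d 0 + A 0 1 * d 0 * d 1 + A 0 2 * d 0 * d 2 +
      (A 0 1 * d 1 * d 0 + A 1 1 * d 1 * d 1 + A 1 2 * d 1 * d 2) +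
      (A 0 2 * d 2 * d 0 + A 1 2 * d 2 * d 1 + A 2 2 * d 2 * d 2))
    linear_combination hd - D / 2 * ha0
  clear hc hd
  simp only [dotProduct, Matrix.mulVec, Fin.sum_univ_three, s1, s2, s3] at ha0 hc0 hac
  obtain ⟨b, hb⟩ : ∃ b : Fin 3 → k, b = fun j =>
    r * ((A.mulVec a (j + 1)) * (A.mulVec c (j + 2)) - (A.mulVec a (j + 2)) * (A.mulVec c (j +
        1))) :=
    ⟨_, rfl⟩
  have hb0 := congrFun hb 0
  have hb1 := congrFun hb 1
  have hb2 := congrFun hb 2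
  simp only [show (1 : Fin 3) + 1 = 2 from rfl, show (1 : Fin 3) + 2 = 0 from rfl,
    show (2 : Fin 3) + 1 = 0 from rfl, show (2 : Fin 3) + 2 = 1 from rfl, zero_add,
    dotProduct, Matrix.mulVec, Fin.sum_univ_three, s1, s2, s3] at hb0 hb1 hb2
  rw [Matrix.det_fin_three, s1, s2, s3] at hr'
  let B : (Fin 3 → k) → (Fin 3 → k) → k := fun u v =>
    A 0 0 * u 0 * v 0 + A 1 1 * u 1 * v 1 + A 2 2 * u 2 * v 2 + A 0 1 * (u 0 * v 1 + u 1 * v 0) +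
      A 0 2 * (u 0 * v 2 + u 2 * v 0) + A 1 2 * (u 1 * v 2 + u 2 * v 1)
  have eaa : B a a = 0 := by linear_combination ha0
  have ecc : B c c = 0 := by linear_combination hc0
  have eac : B a c = 1 := by linear_combination hac
  have eab : B a b = 0 := by
    simp only [B, hb0, hb1, hb2]
    ring
  have ebc : B b c = 0 := by
    simp only [B, hb0, hb1, hb2]
    ring
  have ebb : B b b = -2 := by
    have h1 : B b b = 2 * (B a a * B c c - B a c ^ 2) := by
      rw [← hr']
      simp only [B, hb0, hb1, hb2]
      ring
    rw [h1, eaa, eac]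
    ring
  have hg : a 0 * (b 1 * c 2 - b 2 * c 1) - a 1 * (b 0 * c 2 - b 2 * c 0) +
      a 2 * (b 0 * c 1 - b 1 * c 0) = r := by
    have h1 : a 0 * (b 1 * c 2 - b 2 * c 1) - a 1 * (b 0 * c 2 - b 2 * c 0) +
      a 2 * (b 0 * c 1 - b 1 * c 0) = r * (B a c ^ 2 - B a a * B c c) := by
      simp only [B, hb0, hb1, hb2]
      ring
    rw [h1, eaa, eac]
    ring
  refine ⟨Matrix.of fun i => ![a i, b i, c i], ?_, fun y => ?_⟩
  · have h1 : (Matrix.of fun i => ![a i, b i, c i]).det = r := by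
      rw [← hg, Matrix.det_fin_three]
      simp
      ring
    rw [h1]
    rintro rfl
    simp at hr'
  · have h1 : eval ((Matrix.of fun i => ![a i, b i, c i]).mulVec y) (conicForm A) =
        y 0 ^ 2 * B a a + y 1 ^ 2 * B b b + y 2 ^ 2 * B c c + 2 * (y 0 * y 1) * B a b +
          2 * (y 0 * y 2) * B a c + 2 * (y 1 * y 2) * B b c := by
      simp [eval_conicForm, Matrix.mulVec, dotProduct, Fin.sum_univ_three, B, s1, s2, s3]
      ring
    rw [h1, eaa, ebb, ecc, eab, eac, ebc]
    ring

/-- A conic in parametrized form: the columns of `g` are coordinates in which the conic with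
matrix `A` has the equation `y₀ y₂ = y₁²`. -/
structure IsConicFrame (A g : Matrix (Fin 3) (Fin 3) k) : Prop where
  symm : A.IsSymm
  det_ne_zero : A.det ≠ 0
  frame_det_ne_zero : g.det ≠ 0
  eval_eq : ∀ y, eval (g.mulVec y) (conicForm A) = 2 * (y 0 * y 2 - y 1 ^ 2)

/-- The point with parameter `t` of a parametrized conic. -/
def conicPoint {R : Type*} [CommRing R] (g : Matrix (Fin 3) (Fin 3) R) (t : R) : Fin 3 → R :=
  g.mulVec ![1, t, t ^ 2]

theorem IsConicFrame.eval_conicPoint {A g : Matrix (Fin 3) (Fin 3) k} (h : IsConicFrame A g)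
    (t : k) : eval (conicPoint g t) (conicForm A) = 0 := by
  rw [conicPoint, h.eval_eq]
  simp

theorem inv_mulVec_conicPoint {g : Matrix (Fin 3) (Fin 3) k} (hg : g.det ≠ 0) (t : k) :
    g⁻¹.mulVec (conicPoint g t) = ![1, t, t ^ 2] := by
  rw [conicPoint, Matrix.mulVec_mulVec, Matrix.nonsing_inv_mul _ (isUnit_iff_ne_zero.2 hg),
    Matrix.one_mulVec]

theorem eval_smul_of_isHomogeneous {σ : Type*} {E : MvPolynomial σ k} {n : ℕ}
    (hE : E.IsHomogeneous n) (r : k) (v : σ → k) : eval (r • v) E = r ^ n * eval v E := by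
  rw [← eval_weight_smul hE r v]
  simp only [Pi.one_apply, pow_one]
  rfl

/-- The restriction of a polynomial to a parametrized conic. -/
def conicRestrict (g : Matrix (Fin 3) (Fin 3) k) : MvPolynomial (Fin 3) k →ₐ[k] Polynomial k :=
  aeval (conicPoint (g.map Polynomial.C) Polynomial.X)

theorem eval_conicRestrict (g : Matrix (Fin 3) (Fin 3) k) (t : k) (E : MvPolynomial (Fin 3) k) :
    (conicRestrict g E).eval t = eval (conicPoint g t) E := by
  rw [conicRestrict, ← Polynomial.coe_evalRingHom, ← MvPolynomial.coe_aeval_eq_eval]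
  have h : (Polynomial.evalRingHom t).comp (aeval (conicPoint (g.map Polynomial.C)
      Polynomial.X)).toRingHom = (aeval (conicPoint g t) : MvPolynomial (Fin 3) k →ₐ[k] k).toRingHom
          := by
    refine MvPolynomial.ringHom_ext (fun a => by simp) fun j => ?_
    simp [conicPoint, Matrix.mulVec, dotProduct, Fin.sum_univ_three]
  exact congrArg (fun f : MvPolynomial (Fin 3) k →+* k => f E) h

theorem natDegree_conicRestrict_le (g : Matrix (Fin 3) (Fin 3) k) {E : MvPolynomial (Fin 3) k}
    {n : ℕ} (hE : E.IsHomogeneous n) : (conicRestrict g E).natDegree ≤ n * 2 := by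
  refine MvPolynomial.aeval_natDegree_le E hE.totalDegree_le _ fun j => ?_
  simp only [conicPoint, Matrix.mulVec, dotProduct, Fin.sum_univ_three, Matrix.map_apply,
    Matrix.cons_val]
  compute_degree

theorem exists_cubic_conicPoint [CharZero k] {g : Matrix (Fin 3) (Fin 3) k} (hg : g.det ≠ 0)
    {P : Polynomial k} (hP : P.natDegree ≤ 6) :
    ∃ c, ∀ t, eval (conicPoint g t) (cubicForm c) = P.eval t := by
  let Y : Fin 3 → MvPolynomial (Fin 3) k := fun j => linForm (g⁻¹ j)
  have hY1 : ∀ j, (Y j).IsHomogeneous 1 := fun j => linForm_isHomogeneous _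
  have hY : ∀ t, (fun j => eval (conicPoint g t) (Y j)) = ![1, t, t ^ 2] := by
    intro t
    rw [← inv_mulVec_conicPoint hg t]
    funext j
    rw [eval_linForm]
    rfl
  -- On the conic y = (1, t, t²), so the `n`-th of these cubics restricts to tⁿ.
  let M : Fin 7 → MvPolynomial (Fin 3) k := ![Y 0 * Y 0 * Y 0, Y 0 * Y 0 * Y 1, Y 0 * Y 0 * Y 2,
    Y 0 * Y 1 * Y 2, Y 0 * Y 2 * Y 2, Y 1 * Y 2 * Y 2, Y 2 * Y 2 * Y 2]
  have hM : ∀ n, (M n).IsHomogeneous 3 := by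
    have h3 : ∀ a b c, (Y a * Y b * Y c).IsHomogeneous 3 := fun a b c =>
      ((hY1 a).mul (hY1 b)).mul (hY1 c)
    intro n
    fin_cases n <;> exact h3 _ _ _
  have h : (∑ n : Fin 7, C (P.coeff n) * M n).IsHomogeneous 3 :=
    IsHomogeneous.sum _ _ _ fun n _ => (hM n).C_mul _
  obtain ⟨c, hc⟩ := exists_cubicForm h
  refine ⟨c, fun t => ?_⟩
  have y0 : eval (conicPoint g t) (Y 0) = 1 := congrFun (hY t) 0
  have y1 : eval (conicPoint g t) (Y 1) = t := congrFun (hY t) 1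
  have y2 : eval (conicPoint g t) (Y 2) = t ^ 2 := congrFun (hY t) 2
  rw [← hc, Polynomial.eval_eq_sum_range' (by omega : P.natDegree < 7), Finset.sum_range, map_sum]
  refine Finset.sum_congr rfl fun n _ => ?_
  rw [map_mul, eval_C]
  congr 1
  fin_cases n <;> simp [M, y0, y1, y2] <;> ring

theorem IsConicFrame.exists_eq_smul_conicPoint {A g : Matrix (Fin 3) (Fin 3) k}
    (h : IsConicFrame A g) [CharZero k] {z : Fin 3 → k} (hz : eval z (conicForm A) = 0)
    (h0 : g⁻¹.mulVec z 0 ≠ 0) :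
    z = g⁻¹.mulVec z 0 • conicPoint g (g⁻¹.mulVec z 1 / g⁻¹.mulVec z 0) := by
  have h1 : g.mulVec (g⁻¹.mulVec z) = z := by
    rw [Matrix.mulVec_mulVec, Matrix.mul_nonsing_inv _ (isUnit_iff_ne_zero.2 h.frame_det_ne_zero),
      Matrix.one_mulVec]
  set y := g⁻¹.mulVec z with hy
  have h2 := h.eval_eq y
  rw [h1, hz, eq_comm, mul_eq_zero, or_iff_right two_ne_zero] at h2
  rw [conicPoint, ← Matrix.mulVec_smul, ← h1]
  congr 1
  funext j
  fin_cases j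
  · simp
  · simp [mul_div_cancel₀ _ h0]
  · simp
    field_simp
    linear_combination h2

theorem conicPoint_ne_zero {g : Matrix (Fin 3) (Fin 3) k} (hg : g.det ≠ 0) (t : k) :
    conicPoint g t ≠ 0 := by
  intro h
  have h1 := Matrix.eq_zero_of_mulVec_eq_zero hg h
  simpa using congrFun h1 0

/-- A cubic apolar to a conic which vanishes on the conic is zero. -/
theorem IsConicFrame.eq_zero_of_apolar [IsAlgClosed k] [CharZero k]
    {A g : Matrix (Fin 3) (Fin 3) k} (h : IsConicFrame A g) {c : CubicIndex → k}
    (hc : ∀ j, polarCoeff A.adjugate c j = 0) (hz : conicRestrict g (cubicForm c) = 0) :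
    c = 0 := by
  have hirr := conicForm_irreducible h.symm h.det_ne_zero
  -- The parametrization misses the point of the conic with y₀ = 0; the extra factor y₀ takes care
  -- of it.
  have h1 : conicForm A ∣ cubicForm c * linForm (g⁻¹ 0) := by
    refine dvd_of_forall_eval_eq_zero hirr.prime fun z hz0 => ?_
    rw [map_mul, eval_linForm]
    by_cases h0 : g⁻¹.mulVec z 0 = 0
    · exact mul_eq_zero_of_right _ h0
    · refine mul_eq_zero_of_left ?_ _
      have h2 := h.exists_eq_smul_conicPoint hz0 h0
      have h3 := eval_conicRestrict g (g⁻¹.mulVec z 1 / g⁻¹.mulVec z 0) (cubicForm c)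
      rw [hz, Polynomial.eval_zero] at h3
      rw [h2, eval_smul_of_isHomogeneous (cubicForm_isHomogeneous c), ← h3, mul_zero]
  have h2 : linForm (g⁻¹ 0) ≠ 0 := by
    intro h0
    have h3 := eval_linForm (g⁻¹ 0) (conicPoint g 0)
    have h4 := congrFun (inv_mulVec_conicPoint h.frame_det_ne_zero 0) 0
    rw [h0, map_zero] at h3
    exact zero_ne_one (h3.trans h4)
  rcases hirr.prime.dvd_or_dvd h1 with h3 | h3
  · obtain ⟨m, hm⟩ := h3
    by_cases hc0 : cubicForm c = 0
    · exact cubicForm_injective (hc0.trans cubicForm_zero.symm)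
    · have h4 := cubicForm_isHomogeneous c
      rw [hm] at h4 hc0
      obtain ⟨a, b, hab, ha, hb⟩ := isHomogeneous_factor h4 hc0
      have ha2 := ha.inj_right (conicForm_isHomogeneous A) (left_ne_zero_of_mul hc0)
      obtain rfl : b = 1 := by omega
      obtain ⟨l, rfl⟩ := exists_linForm hb
      rw [← cubicForm_conicMulLin] at hm
      have h5 := cubicForm_injective hm
      rw [h5] at hc
      -- The cubic is θl, and θ*(θl) = 10 det(A) l.
      have hl : l = 0 := by
        funext j
        have h6 := hc j
        rw [polarCoeff_conicMulLin A h.symm] at h6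
        exact (mul_eq_zero.1 h6).resolve_left (mul_ne_zero (by norm_num) h.det_ne_zero)
      apply cubicForm_injective
      rw [h5, cubicForm_conicMulLin, hl, cubicForm_zero]
      simp [linForm]
  · exact absurd (eq_zero_of_dvd_of_lt (conicForm_isHomogeneous A) (linForm_isHomogeneous _)
      (by norm_num) h3) h2

end NormalForm

/-! ### The cubic of the seventh point for six points on a conic -/

section SeventhPoint

/-- Linearity in the last vector, by expansion along its row. That vector need not come from a
point: below it is also a polar functional or a derivative. -/
theorem dualInvariant_snoc {R : Type*} [CommRing R] (W : Fin 6 → CubicIndex → R)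
    (y : CubicIndex → R) :
    dualInvariant (Fin.snoc (α := fun _ => CubicIndex → R) W y) = ∑ m, y m *
      dualInvariant (Fin.snoc (α := fun _ => CubicIndex → R) W (Pi.single m 1)) := by
  simp only [dualInvariant, Finset.mul_sum]
  rw [Finset.sum_comm]
  refine Finset.sum_congr rfl fun t _ => ?_
  rw [Matrix.det_eq_sum_mul_adjugate_row _ (Sum.inl (Fin.last 6)), Finset.mul_sum]
  refine Finset.sum_congr rfl fun m _ => ?_
  rw [mul_left_comm, Matrix.adjugate_apply]
  refine congrArg₂ (· * ·) ?_ (congrArg (_ * ·) (congrArg Matrix.det ?_))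
  · simp only [Matrix.of_apply, Sum.elim_inl, Fin.snoc_last]
  · ext r c
    rcases r with r | r
    · refine Fin.lastCases ?_ (fun r => ?_) r
      · simp only [Matrix.updateRow_self, Matrix.of_apply, Sum.elim_inl, Fin.snoc_last]
      · have h : (Sum.inl (Fin.castSucc r) : Fin 7 ⊕ Fin 3) ≠ Sum.inl (Fin.last 6) :=
          Sum.inl_injective.ne (Fin.castSucc_lt_last r).ne
        simp only [Matrix.updateRow_ne h, Matrix.of_apply, Sum.elim_inl, Fin.snoc_castSucc]
    · simp only [Matrix.updateRow_ne Sum.inr_ne_inl, Matrix.of_apply, Sum.elim_inr]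

variable {k : Type*} [Field k]

/-- The coefficients of the cubic `Ψ(P₁, …, P₆, X)`. -/
def seventhCoeff {R : Type*} [CommRing R] (p : Fin 6 → Fin 3 → R) (m : CubicIndex) : R :=
  dualInvariant (Fin.snoc (α := fun _ => CubicIndex → R) (fun i => cubicMonomials (p i))
    (Pi.single m 1))

theorem sum_mul_seventhCoeff {R : Type*} [CommRing R] (p : Fin 6 → Fin 3 → R)
    (y : CubicIndex → R) : ∑ m, y m * seventhCoeff p m =
      dualInvariant (Fin.snoc (α := fun _ => CubicIndex → R) (fun i => cubicMonomials (p i)) y) :=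
  (dualInvariant_snoc _ y).symm

theorem map_seventhCoeff {R S : Type*} [CommRing R] [CommRing S] (f : R →+* S)
    (p : Fin 6 → Fin 3 → R) (m : CubicIndex) :
    f (seventhCoeff p m) = seventhCoeff (fun i j => f (p i j)) m := by
  rw [seventhCoeff, map_dualInvariant, seventhCoeff]
  congr 1
  funext i n
  refine Fin.lastCases ?_ (fun i => ?_) i
  · simp only [Fin.snoc_last, Pi.single_apply]
    split_ifs <;> simp
  · simp [map_cubicMonomials]

theorem seventhPointCubic_explicitPsi (p : Fin 6 → Fin 3 → k) :
    seventhPointCubic (explicitPsi k) p = cubicForm (seventhCoeff p) := by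
  have h : seventhPointCubic (explicitPsi k) p = dualInvariant
      (Fin.snoc (α := fun _ => CubicIndex → MvPolynomial (Fin 3) k)
        (fun i => cubicMonomials fun j => C (p i j)) (cubicMonomials X)) := by
    rw [seventhPointCubic, aeval_explicitPsi]
    congr 1
    funext i
    refine Fin.lastCases ?_ (fun i => ?_) i <;> simp [-Fin.reduceLast]
  rw [h, ← sum_mul_seventhCoeff, cubicForm]
  refine Finset.sum_congr rfl fun m _ => ?_
  rw [map_seventhCoeff, mul_comm]

theorem seventhPointCubic_C_mul (c : k) (Ψ : CoordRing k) (p : Fin 6 → Fin 3 → k) :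
    seventhPointCubic (C c * Ψ) p = C c * seventhPointCubic Ψ p := by
  rw [seventhPointCubic, map_mul, algHom_C, algebraMap_eq]
  rfl

theorem eval_seventhCoeff {R : Type*} [CommRing R] (p : Fin 6 → Fin 3 → R) (u : Fin 3 → R) :
    eval u (cubicForm (seventhCoeff p)) = dualInvariant (Fin.snoc (α := fun _ => CubicIndex → R)
      (fun i => cubicMonomials (p i)) (cubicMonomials u)) := by
  rw [eval_cubicForm, ← sum_mul_seventhCoeff]
  exact Finset.sum_congr rfl fun m _ => mul_comm _ _

theorem eval_seventhCoeff_eq_zero {R : Type*} [CommRing R] (p : Fin 6 → Fin 3 → R) (i : Fin 6) :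
    eval (p i) (cubicForm (seventhCoeff p)) = 0 := by
  rw [eval_seventhCoeff]
  refine dualInvariant_eq_zero_of_eq _ (i := i.castSucc) (j := Fin.last 6)
    (Fin.castSucc_lt_last i).ne ?_
  simp [-Fin.reduceLast]

theorem polarCoeff_eq_sum {R : Type*} [CommRing R] (a : Matrix (Fin 3) (Fin 3) R)
    (c : CubicIndex → R) (j : Fin 3) :
    polarCoeff a c j = ∑ m, polarCoeff a (Pi.single m 1) j * c m := by
  fin_cases j <;> simp [polarCoeff, Fintype.sum_sum_type, Fin.sum_univ_succ, Pi.single_apply] <;>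
    ring

theorem exists_det_ne_zero {G : Fin 3 → CubicIndex → k} (hG : LinearIndependent k G) :
    ∃ K : CubicIndex → Fin 7 → k,
      Matrix.det (Matrix.of fun m => Sum.elim (K m) fun j => G j m) ≠ 0 := by
  obtain ⟨Q, hQ⟩ := Submodule.exists_isCompl (Submodule.span k (Set.range G))
  have hrank : Module.finrank k Q = 7 := by
    have h1 := Submodule.finrank_add_eq_of_isCompl hQ
    rw [finrank_span_eq_card hG] at h1
    simp only [Fintype.card_fin, Module.finrank_fintype_fun_eq_card, Fintype.card_sum] at h1
    omega
  let b := Module.finBasisOfFinrankEq k Q hrank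
  refine ⟨fun m l => (b l : CubicIndex → k) m, ?_⟩
  have h1 : LinearIndependent k (Sum.elim (fun l => (b l : CubicIndex → k)) G) := by
    refine (b.linearIndependent.map' Q.subtype Q.ker_subtype).sum_type hG
      (hQ.symm.disjoint.mono_left (Submodule.span_le.2 ?_))
    rintro _ ⟨l, rfl⟩
    exact (b l).2
  rw [← Matrix.det_transpose, ← isUnit_iff_ne_zero, ← Matrix.isUnit_iff_isUnit_det,
    ← Matrix.linearIndependent_rows_iff_isUnit]
  convert h1 using 1
  funext x m
  rcases x with x | x <;> rfl

variable {A g : Matrix (Fin 3) (Fin 3) k}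

/-- Apolarity and the six points amount to 3 + 6 = 9 linear conditions on ten coefficients. -/
theorem exists_apolar_ne_zero (A : Matrix (Fin 3) (Fin 3) k) (p : Fin 6 → Fin 3 → k) :
    ∃ c : CubicIndex → k, c ≠ 0 ∧ (∀ j, polarCoeff A.adjugate c j = 0) ∧
      ∀ i, eval (p i) (cubicForm c) = 0 := by
  let f : (CubicIndex → k) →ₗ[k] (Fin 3 ⊕ Fin 6 → k) := Matrix.toLin' (Matrix.of
    (Sum.elim (fun j m => polarCoeff A.adjugate (Pi.single m 1) j) fun i => cubicMonomials (p i)))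
  have h := LinearMap.ker_ne_bot_of_finrank_lt (f := f) (by simp)
  obtain ⟨c, hc, h0⟩ := (Submodule.ne_bot_iff _).1 h
  have h1 : ∀ r, f c r = 0 := fun r => congrFun (LinearMap.mem_ker.1 hc) r
  refine ⟨c, h0, fun j => ?_, fun i => ?_⟩
  · rw [polarCoeff_eq_sum]
    exact h1 (Sum.inl j)
  · rw [eval_cubicForm, ← h1 (Sum.inr i)]
    exact Finset.sum_congr rfl fun m _ => mul_comm _ _

variable [CharZero k]

/-- The cubics θX₀, θX₁, θX₂ vanish at the points and have invariant 20 det A. Cubics restricting to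
the Lagrange basis serve as `K`, with `W K = 1`. -/
theorem IsConicFrame.dualInvariant_ne_zero (h : IsConicFrame A g) {t : Fin 7 → k}
    (ht : Function.Injective t) : dualInvariant (fun i => cubicMonomials (conicPoint g (t i))) ≠ 0
        := by
  classical
  choose c hc using fun b : Fin 7 => exists_cubic_conicPoint h.frame_det_ne_zero
    (P := Lagrange.basis Finset.univ t b) (by
      rw [Polynomial.natDegree_le_iff_degree_le,
        Lagrange.degree_basis ht.injOn (Finset.mem_univ b)]
      simp)
  have h1 := dualInvariant_mul_det (fun i => cubicMonomials (conicPoint g (t i)))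
    ![conicMulLin A ![1, 0, 0], conicMulLin A ![0, 1, 0], conicMulLin A ![0, 0, 1]] (by
      have hw : ∀ i l, ∑ m, cubicMonomials (conicPoint g (t i)) m * conicMulLin A l m = 0 := by
        intro i l
        have h2 := eval_cubicForm (conicMulLin A l) (conicPoint g (t i))
        rw [cubicForm_conicMulLin, map_mul, h.eval_conicPoint, zero_mul] at h2
        rw [h2]
        exact Finset.sum_congr rfl fun m _ => mul_comm _ _
      intro i a
      fin_cases a <;> exact hw _ _) fun m b => c b m
  have h2 : (Matrix.of fun i b => ∑ m, cubicMonomials (conicPoint g (t i)) m * c b m) =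
      (1 : Matrix (Fin 7) (Fin 7) k) := by
    ext i b
    have h3 := hc b (t i)
    rw [eval_cubicForm] at h3
    rw [Matrix.of_apply, Matrix.one_apply]
    refine (Finset.sum_congr rfl fun m _ => mul_comm _ _).trans (h3.trans ?_)
    split_ifs with hib
    · rw [hib]
      exact Lagrange.eval_basis_self ht.injOn (Finset.mem_univ b)
    · exact Lagrange.eval_basis_of_ne (Ne.symm hib) (Finset.mem_univ i)
  rw [h2, Matrix.det_one, one_mul, netInvariant_conicMulLin A h.symm] at h1
  simp only [polarCoeff_conicMulLin A h.symm] at h1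
  intro h0
  rw [h0, zero_mul] at h1
  simp [h.det_ne_zero] at h1

theorem exists_injective_snoc {t : Fin 6 → k} (ht : Function.Injective t) :
    ∃ s : k, Function.Injective (Fin.snoc (α := fun _ => k) t s : Fin 7 → k) := by
  classical
  obtain ⟨s, hs⟩ := Infinite.exists_notMem_finset (Finset.univ.image t)
  refine ⟨s, Fin.snoc_injective_iff.2 ⟨ht, ?_⟩⟩
  rintro ⟨i, hi⟩
  exact hs (Finset.mem_image.2 ⟨i, Finset.mem_univ i, hi⟩)

theorem IsConicFrame.exists_eval_seventhCoeff_ne_zero (h : IsConicFrame A g) {t : Fin 6 → k}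
    (ht : Function.Injective t) : ∃ s, s ∉ Set.range t ∧
      eval (conicPoint g s) (cubicForm (seventhCoeff fun i => conicPoint g (t i))) ≠ 0 := by
  obtain ⟨s, hs⟩ := exists_injective_snoc ht
  refine ⟨s, (Fin.snoc_injective_iff.1 hs).2, ?_⟩
  rw [eval_seventhCoeff]
  convert h.dualInvariant_ne_zero hs using 2
  funext i
  refine Fin.lastCases ?_ (fun i => ?_) i <;> simp [-Fin.reduceLast]

variable [IsAlgClosed k]

/-- The restriction of a cubic to the conic has degree at most 6 in the parameter, so seven zeros
make it vanish on the conic. -/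
theorem IsConicFrame.eq_zero_of_seven (h : IsConicFrame A g) {c : CubicIndex → k}
    (hc : ∀ j, polarCoeff A.adjugate c j = 0) {s : Finset k} (hs : 6 < s.card)
    (hz : ∀ t ∈ s, eval (conicPoint g t) (cubicForm c) = 0) : c = 0 := by
  refine h.eq_zero_of_apolar hc ?_
  refine Polynomial.eq_zero_of_natDegree_lt_card_of_eval_eq_zero' _ s (fun t ht => ?_) ?_
  · rw [eval_conicRestrict, hz t ht]
  · exact (natDegree_conicRestrict_le g (cubicForm_isHomogeneous c)).trans_lt hs

/-- Put the functional c ↦ "j-th coefficient of θ*(c)" in the place of the seventh point. It and the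
six evaluations kill θX_{j+1}, θX_{j+2} and any apolar cubic `c` through the points. These three are
independent when `c ≠ 0`, and their invariant pairs θ*(c) = 0 with a vector, so it is zero. -/
theorem IsConicFrame.polarCoeff_seventhCoeff (h : IsConicFrame A g) {p : Fin 6 → Fin 3 → k}
    (hp : ∀ i, eval (p i) (conicForm A) = 0) (j : Fin 3) :
    polarCoeff A.adjugate (seventhCoeff p) j = 0 := by
  obtain ⟨c, hc0, hc, hz⟩ := exists_apolar_ne_zero A p
  rw [polarCoeff_eq_sum, sum_mul_seventhCoeff]
  let l : Fin 3 → Fin 3 → k := fun i => Pi.single i 1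
  let G : Fin 3 → CubicIndex → k := ![conicMulLin A (l (j + 1)), conicMulLin A (l (j + 2)), c]
  have hj1 : j ≠ j + 1 := by fin_cases j <;> decide
  have hj2 : j ≠ j + 2 := by fin_cases j <;> decide
  have hj3 : j + 1 ≠ j + 2 := by fin_cases j <;> decide
  have h10 : (10 : k) * A.det ≠ 0 := mul_ne_zero (by norm_num) h.det_ne_zero
  have hG : LinearIndependent k G := by
    rw [Fintype.linearIndependent_iff]
    intro r hr
    have h1 : ∀ i, 10 * A.det * (r 0 * l (j + 1) i + r 1 * l (j + 2) i) = 0 := by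
      intro i
      have h2 := congrArg (fun c => polarCoeff A.adjugate c i) hr
      have h3 : ∀ c d e : CubicIndex → k, polarCoeff A.adjugate (r 0 • c + r 1 • d + r 2 • e) i =
          r 0 * polarCoeff A.adjugate c i + r 1 * polarCoeff A.adjugate d i +
            r 2 * polarCoeff A.adjugate e i := by
        intro c d e
        rw [polarCoeff_eq_sum, polarCoeff_eq_sum _ c, polarCoeff_eq_sum _ d, polarCoeff_eq_sum _ e]
        simp only [Finset.mul_sum, ← Finset.sum_add_distrib]
        refine Finset.sum_congr rfl fun m _ => ?_
        simp only [Pi.add_apply, Pi.smul_apply, smul_eq_mul]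
        ring
      have h4 : polarCoeff A.adjugate (0 : CubicIndex → k) i = 0 := by
        rw [polarCoeff_eq_sum]
        simp
      simp only [Fin.sum_univ_three, G, Matrix.cons_val] at h2
      rw [h3, hc, polarCoeff_conicMulLin A h.symm, polarCoeff_conicMulLin A h.symm, h4] at h2
      linear_combination h2
    have r0 : r 0 = 0 := by
      have h2 := (mul_eq_zero.1 (h1 (j + 1))).resolve_left h10
      simpa [l, Pi.single_apply, hj3] using h2
    have r1 : r 1 = 0 := by
      have h2 := (mul_eq_zero.1 (h1 (j + 2))).resolve_left h10
      simpa [l, Pi.single_apply, hj3.symm] using h2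
    have r2 : r 2 = 0 := by
      simp only [Fin.sum_univ_three, G, Matrix.cons_val, r0, r1, zero_smul, zero_add] at hr
      exact (smul_eq_zero.1 hr).resolve_right hc0
    intro i
    fin_cases i <;> assumption
  obtain ⟨K, hK⟩ := exists_det_ne_zero hG
  have h1 := dualInvariant_mul_det (Fin.snoc (α := fun _ => CubicIndex → k)
    (fun i => cubicMonomials (p i)) fun m => polarCoeff A.adjugate (Pi.single m 1) j) G ?_ K
  · have h2 : netInvariant G = 0 := by
      rw [netInvariant_conicMulLin A h.symm]
      simp [hc]
    rw [h2, mul_zero] at h1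
    exact (mul_eq_zero.1 h1).resolve_right hK
  · have hw : ∀ i l, ∑ m, cubicMonomials (p i) m * conicMulLin A l m = 0 := by
      intro i l
      have h2 := eval_cubicForm (conicMulLin A l) (p i)
      rw [cubicForm_conicMulLin, map_mul, hp, zero_mul] at h2
      rw [h2]
      exact Finset.sum_congr rfl fun m _ => mul_comm _ _
    intro i a
    refine Fin.lastCases ?_ (fun i => ?_) i
    · simp only [Fin.snoc_last, ← polarCoeff_eq_sum]
      fin_cases a
      · simp [G, polarCoeff_conicMulLin A h.symm, l, hj1]
      · simp [G, polarCoeff_conicMulLin A h.symm, l, hj2]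
      · simp [G, hc]
    · simp only [Fin.snoc_castSucc]
      fin_cases a
      · exact hw _ _
      · exact hw _ _
      · have h2 := hz i
        rw [eval_cubicForm] at h2
        rw [← h2]
        exact Finset.sum_congr rfl fun m _ => mul_comm _ _

/-- Subtract the multiple of ψ that agrees with `c` at one more point of the conic. The difference
is apolar and has seven zeros on the conic. -/
theorem IsConicFrame.eq_smul_seventhCoeff (h : IsConicFrame A g) {t : Fin 6 → k}
    (ht : Function.Injective t) {c : CubicIndex → k}
    (hc : ∀ j, polarCoeff A.adjugate c j = 0)
    (hz : ∀ i, eval (conicPoint g (t i)) (cubicForm c) = 0) :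
    ∃ a : k, c = a • seventhCoeff fun i => conicPoint g (t i) := by
  classical
  obtain ⟨s, hs, h0⟩ := h.exists_eval_seventhCoeff_ne_zero ht
  set ψ := seventhCoeff fun i => conicPoint g (t i) with hψ
  refine ⟨eval (conicPoint g s) (cubicForm c) / eval (conicPoint g s) (cubicForm ψ), ?_⟩
  set a := eval (conicPoint g s) (cubicForm c) / eval (conicPoint g s) (cubicForm ψ) with ha
  have hψp : ∀ j, polarCoeff A.adjugate ψ j = 0 :=
    h.polarCoeff_seventhCoeff fun i => h.eval_conicPoint _
  have hlin : cubicForm (c + (-a) • ψ) = cubicForm c + C (-a) * cubicForm ψ := by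
    rw [cubicForm_add, cubicForm_smul]
  have h1 := h.eq_zero_of_seven (c := c + (-a) • ψ) (s := insert s (Finset.univ.image t))
    (fun j => by
      have h2 := hc j
      have h3 := hψp j
      rw [polarCoeff_eq_sum] at h2 h3 ⊢
      simp only [Pi.add_apply, Pi.smul_apply, smul_eq_mul, mul_add, Finset.sum_add_distrib, h2,
        mul_left_comm _ (-a), ← Finset.mul_sum, h3]
      ring) (by
      rw [Finset.card_insert_of_notMem (by simpa using hs), Finset.card_image_of_injective _ ht]
      simp) fun u hu => by
      rw [hlin, map_add, map_mul, eval_C]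
      rcases Finset.mem_insert.1 hu with rfl | hu
      · rw [ha]
        field_simp
        ring
      · obtain ⟨i, -, rfl⟩ := Finset.mem_image.1 hu
        rw [hz i, hψ, eval_seventhCoeff_eq_zero (fun i => conicPoint g (t i)) i]
        ring
  rw [neg_smul, ← sub_eq_add_neg] at h1
  exact sub_eq_zero.1 h1

end SeventhPoint

/-! ### Irreducibility of the cubic of the seventh point -/

section Irreducibility

variable {R : Type*} [CommRing R]

/-- The derivatives at `u`, in the direction `w`, of the cubic monomials. -/
def polarMonomials (u w : Fin 3 → R) (m : CubicIndex) : R :=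
  u (cubicTriple m 0) * u (cubicTriple m 1) * w (cubicTriple m 2) +
    u (cubicTriple m 0) * w (cubicTriple m 1) * u (cubicTriple m 2) +
    w (cubicTriple m 0) * u (cubicTriple m 1) * u (cubicTriple m 2)

theorem cubicMonomials_add_smul (u w : Fin 3 → R) (s : R) (m : CubicIndex) :
    cubicMonomials (u + s • w) m = cubicMonomials u m + s * polarMonomials u w m +
      s ^ 2 * (polarMonomials w u m + s * cubicMonomials w m) := by
  simp only [cubicMonomials_eq_triple, polarMonomials, Pi.add_apply, Pi.smul_apply, smul_eq_mul]
  ring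

theorem polarMonomials_self (u : Fin 3 → R) (m : CubicIndex) :
    polarMonomials u u m = 3 * cubicMonomials u m := by
  simp only [cubicMonomials_eq_triple, polarMonomials]
  ring

theorem map_polarMonomials {S : Type*} [CommRing S] (f : R →+* S) (u w : Fin 3 → R)
    (m : CubicIndex) :
    f (polarMonomials u w m) = polarMonomials (fun j => f (u j)) (fun j => f (w j)) m := by
  simp only [polarMonomials, map_add, map_mul]

theorem polarMonomials_eq_sum (u w : Fin 3 → R) (m : CubicIndex) :
    polarMonomials u w m = ∑ l, w l * polarMonomials u (Pi.single l 1) m := by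
  have h : ∀ j, w j = ∑ l, w l * (Pi.single l (1 : R) : Fin 3 → R) j := by
    intro j
    simp [Pi.single_apply]
  simp only [polarMonomials, mul_add, Finset.sum_add_distrib]
  rw [h (cubicTriple m 0), h (cubicTriple m 1), h (cubicTriple m 2)]
  simp only [Finset.mul_sum, Finset.sum_mul]
  congr 1
  · congr 1 <;> exact Finset.sum_congr rfl fun l _ => by ring
  · exact Finset.sum_congr rfl fun l _ => by ring

/-- The coefficients of the product of a linear and a quadratic form. -/
def linMulQuad (l : Fin 3 → R) (d : Fin 6 → R) : CubicIndex → R :=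
  Sum.elim ![l 0 * d 0, l 1 * d 1, l 2 * d 2, l 0 * d 3 + l 1 * d 0, l 0 * d 4 + l 2 * d 0,
    l 1 * d 5 + l 2 * d 1, l 0 * d 5 + l 1 * d 4 + l 2 * d 3]
    ![l 0 * d 1 + l 1 * d 3, l 0 * d 2 + l 2 * d 4, l 1 * d 2 + l 2 * d 5]

theorem cubicForm_linMulQuad (l : Fin 3 → R) (d : Fin 6 → R) :
    cubicForm (linMulQuad l d) = linForm l * quadForm d := by
  simp [cubicForm, linForm, quadForm, linMulQuad, cubicMonomials, quadMonomials, quadIndex,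
    Fin.sum_univ_succ]
  ring

theorem sum_linMulQuad_mul_polarMonomials (l : Fin 3 → R) (d : Fin 6 → R) (u w : Fin 3 → R) :
    ∑ m, linMulQuad l d m * polarMonomials u w m =
      (∑ j, l j * w j) * (∑ h, d h * quadMonomials u h) + (∑ j, l j * u j) *
        ∑ h, d h * (u (quadIndex h).1 * w (quadIndex h).2 + w (quadIndex h).1 * u (quadIndex h).2)
            := by
  simp [linMulQuad, polarMonomials, cubicTriple, quadMonomials, quadIndex, Fin.sum_univ_succ]
  ring

/-- The derivative of the cubic of the seventh point at the `i`-th point, in the direction of the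
`j`-th point. -/
def tangentInvariant (i j : Fin 6) (p : Fin 6 → Fin 3 → R) : R :=
  ∑ m, polarMonomials (p i) (p j) m * seventhCoeff p m

theorem map_tangentInvariant {S : Type*} [CommRing S] (f : R →+* S) (i j : Fin 6)
    (p : Fin 6 → Fin 3 → R) :
    f (tangentInvariant i j p) = tangentInvariant i j fun i j => f (p i j) := by
  simp only [tangentInvariant, map_sum, map_mul, map_polarMonomials, map_seventhCoeff]

variable {k : Type*} [Field k] {A g : Matrix (Fin 3) (Fin 3) k}

/-- Taylor expansion at a singular point of the cubic: the constant and the linear term vanish. -/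
theorem sq_dvd_conicRestrict {c : CubicIndex → k} {t : k}
    (hz : eval (conicPoint g t) (cubicForm c) = 0)
    (hd : ∀ l, ∑ m, c m * polarMonomials (conicPoint g t) (Pi.single l 1) m = 0) :
    (Polynomial.X - Polynomial.C t) ^ 2 ∣ conicRestrict g (cubicForm c) := by
  -- The divided difference of the parametrization: (1, T, T²) - (1, t, t²) = (T - t)(0, 1, T + t).
  let w : Fin 3 → Polynomial k := fun j =>
    Polynomial.C (g j 1) + Polynomial.C (g j 2) * (Polynomial.X + Polynomial.C t)
  have hv : conicPoint (g.map Polynomial.C) Polynomial.X =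
      (fun j => Polynomial.C (conicPoint g t j)) + (Polynomial.X - Polynomial.C t) • w := by
    funext j
    simp [conicPoint, Matrix.mulVec, dotProduct, Fin.sum_univ_three, w]
    ring
  have h1 : conicRestrict g (cubicForm c) = ∑ m, Polynomial.C (c m) *
      cubicMonomials (conicPoint (g.map Polynomial.C) Polynomial.X) m := by
    rw [cubicForm, map_sum]
    refine Finset.sum_congr rfl fun m _ => ?_
    rw [map_mul, conicRestrict, algHom_C, ← AlgHom.coe_toRingHom, map_cubicMonomials]
    simp
  have h2 : ∑ m, Polynomial.C (c m) * cubicMonomials (fun j => Polynomial.C (conicPoint g t j)) m =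
      0 := by
    rw [eval_cubicForm] at hz
    rw [← Polynomial.C_0, ← hz, map_sum]
    refine Finset.sum_congr rfl fun m _ => ?_
    rw [map_mul, map_cubicMonomials]
  have h3 : ∑ m, Polynomial.C (c m) *
      polarMonomials (fun j => Polynomial.C (conicPoint g t j)) w m = 0 := by
    have h4 : ∀ l, ∑ m, Polynomial.C (c m) *
        polarMonomials (fun j => Polynomial.C (conicPoint g t j)) (Pi.single l 1) m = 0 := by
      intro l
      rw [← Polynomial.C_0, ← hd l, map_sum]
      refine Finset.sum_congr rfl fun m _ => ?_
      rw [map_mul, map_polarMonomials]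
      congr 2
      funext j
      simp only [Pi.single_apply]
      split_ifs <;> simp
    have h5 : ∀ m, Polynomial.C (c m) *
        polarMonomials (fun j => Polynomial.C (conicPoint g t j)) w m =
        ∑ l, w l * (Polynomial.C (c m) *
          polarMonomials (fun j => Polynomial.C (conicPoint g t j)) (Pi.single l 1) m) := by
      intro m
      rw [polarMonomials_eq_sum, Finset.mul_sum]
      exact Finset.sum_congr rfl fun l _ => by ring
    simp only [h5]
    rw [Finset.sum_comm]
    simp only [← Finset.mul_sum, h4, mul_zero, Finset.sum_const_zero]
  rw [h1, hv]
  simp only [cubicMonomials_add_smul, mul_add, Finset.sum_add_distrib,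
      mul_left_comm (Polynomial.C _),
    ← Finset.mul_sum, h2, h3, mul_zero, zero_add]
  exact Dvd.intro _ (by rw [mul_add])

variable [CharZero k]

/-- A reducible cubic is a line times a conic. That conic does not contain θ, because the cubic does
not, so it passes through at most four of the six points. The line then joins two of them, and the
derivative at one in the direction of the other is zero. -/
theorem IsConicFrame.irreducible_seventhCoeff (h : IsConicFrame A g) {t : Fin 6 → k}
    (ht : Function.Injective t)
    (hT : ∀ i j, i ≠ j → tangentInvariant i j (fun i => conicPoint g (t i)) ≠ 0) :
    Irreducible (cubicForm (seventhCoeff fun i => conicPoint g (t i))) := by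
  classical
  obtain ⟨s, -, hs⟩ := h.exists_eval_seventhCoeff_ne_zero ht
  by_contra hirr
  obtain ⟨l, q, hq, hlq⟩ := exists_linear_factor (by norm_num) (by norm_num)
    (cubicForm_isHomogeneous _) (fun h0 => hs (by rw [h0, map_zero])) hirr
  obtain ⟨d, rfl⟩ := exists_quadForm hq
  have hc : seventhCoeff (fun i => conicPoint g (t i)) = linMulQuad l d :=
    cubicForm_injective (hlq.trans (cubicForm_linMulQuad l d).symm)
  have hb0 : conicRestrict g (quadForm d) ≠ 0 := by
    intro h0
    have h1 := eval_conicRestrict g s (quadForm d)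
    rw [h0, Polynomial.eval_zero] at h1
    rw [hlq, map_mul, ← h1, mul_zero] at hs
    exact hs rfl
  let I : Finset (Fin 6) := Finset.univ.filter fun i => eval (conicPoint g (t i)) (linForm l) = 0
  let J : Finset (Fin 6) := Finset.univ.filter fun i => eval (conicPoint g (t i)) (quadForm d) = 0
  have hJ : J.card ≤ 4 := by
    by_contra! hJ
    refine hb0 (Polynomial.eq_zero_of_natDegree_lt_card_of_eval_eq_zero' _ (J.image t)
      (fun u hu => ?_) ?_)
    · obtain ⟨i, hi, rfl⟩ := Finset.mem_image.1 hu
      rw [eval_conicRestrict]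
      exact (Finset.mem_filter.1 hi).2
    · rw [Finset.card_image_of_injective _ ht]
      exact (natDegree_conicRestrict_le g (quadForm_isHomogeneous d)).trans_lt hJ
  have hIJ : Finset.univ ⊆ I ∪ J := by
    intro i _
    have h1 := eval_seventhCoeff_eq_zero (fun i => conicPoint g (t i)) i
    rw [hlq, map_mul, mul_eq_zero] at h1
    simpa [I, J] using h1
  have hI : 1 < I.card := by
    have h1 := (Finset.card_le_card hIJ).trans (Finset.card_union_le I J)
    simp at h1
    omega
  obtain ⟨i, hi, j, hj, hij⟩ := Finset.one_lt_card.1 hI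
  have hi' := (Finset.mem_filter.1 hi).2
  have hj' := (Finset.mem_filter.1 hj).2
  rw [eval_linForm] at hi' hj'
  apply hT i j hij
  rw [tangentInvariant, hc]
  have h2 := sum_linMulQuad_mul_polarMonomials l d (conicPoint g (t i)) (conicPoint g (t j))
  rw [hi', hj', zero_mul, zero_mul, add_zero] at h2
  rw [← h2]
  exact Finset.sum_congr rfl fun m _ => mul_comm _ _

theorem linForm_eq_zero_of_conic (hg : g.det ≠ 0) {d : Fin 3 → k} {s : Finset k} (hs : 2 < s.card)
    (hz : ∀ t ∈ s, ∑ j, d j * conicPoint g t j = 0) : d = 0 := by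
  have h1 : conicRestrict g (linForm d) = 0 := by
    refine Polynomial.eq_zero_of_natDegree_lt_card_of_eval_eq_zero' _ s (fun t ht => ?_) ?_
    · rw [eval_conicRestrict, eval_linForm, hz t ht]
    · exact (natDegree_conicRestrict_le g (linForm_isHomogeneous d)).trans_lt hs
  have h2 : ∀ t, ∑ j, d j * conicPoint g t j = 0 := by
    intro t
    rw [← eval_linForm, ← eval_conicRestrict, h1, Polynomial.eval_zero]
  have h3 : ∀ t, Matrix.vecMul d g ⬝ᵥ ![1, t, t ^ 2] = 0 := by
    intro t
    rw [← Matrix.dotProduct_mulVec]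
    exact h2 t
  have e0 := h3 0
  have e1 := h3 1
  have e2 := h3 (-1)
  simp [dotProduct, Fin.sum_univ_three] at e0 e1 e2
  have h4 : Matrix.vecMul d g = 0 := by
    have r1 : Matrix.vecMul d g 1 = 0 := by linear_combination (1 / 2 : k) * e1 - (1 / 2 : k) * e2
    have r2 : Matrix.vecMul d g 2 = 0 := by
      linear_combination (1 / 2 : k) * e1 + (1 / 2 : k) * e2 - e0
    funext j
    fin_cases j <;> assumption
  exact Matrix.eq_zero_of_vecMul_eq_zero hg h4

variable [IsAlgClosed k]

/-- If one tangent invariant vanished for all parameters, all would by symmetry. The gradient at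
each of six distinct points would then kill all six points, which span, and the cubic would be
singular at each. Its nonzero restriction to the conic, of degree at most 6, would have six double
zeros. -/
theorem IsConicFrame.exists_tangentInvariant_ne_zero (h : IsConicFrame A g) {i j : Fin 6}
    (hij : i ≠ j) : ∃ t : Fin 6 → k,
      tangentInvariant i j (fun i => conicPoint g (t i)) ≠ 0 := by
  classical
  by_contra! hT
  let t : Fin 6 → k := fun i => (i : ℕ)
  have ht : Function.Injective t := fun a b hab => Fin.ext (Nat.cast_injective hab)
  obtain ⟨s, -, hs⟩ := h.exists_eval_seventhCoeff_ne_zero ht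
  set ψ := seventhCoeff fun i => conicPoint g (t i) with hψ
  have hψz : ∀ a, eval (conicPoint g (t a)) (cubicForm ψ) = 0 :=
    eval_seventhCoeff_eq_zero fun i => conicPoint g (t i)
  have h1 : ∀ a b, a ≠ b →
      ∑ m, polarMonomials (conicPoint g (t a)) (conicPoint g (t b)) m * ψ m = 0 := by
    intro a b hab
    -- A permutation with i ↦ a and j ↦ b. By uniqueness of the apolar cubic, permuting the points
    -- changes ψ only by a nonzero factor.
    let σ : Equiv.Perm (Fin 6) := Equiv.swap (Equiv.swap i a j) b * Equiv.swap i a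
    have hσi : σ i = a := by
      simp only [σ, Equiv.Perm.mul_apply, Equiv.swap_apply_left]
      refine Equiv.swap_apply_of_ne_of_ne ?_ hab
      intro h2
      have h3 := congrArg (Equiv.swap i a) h2
      rw [Equiv.swap_apply_right, Equiv.swap_apply_self] at h3
      exact hij h3
    have hσj : σ j = b := by
      simp only [σ, Equiv.Perm.mul_apply, Equiv.swap_apply_left]
    have hσ : Function.Injective fun l => t (σ l) := ht.comp σ.injective
    obtain ⟨r, hr⟩ := h.eq_smul_seventhCoeff ht
      (c := seventhCoeff fun l => conicPoint g (t (σ l)))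
      (h.polarCoeff_seventhCoeff fun l => h.eval_conicPoint _) (fun l => by
        have h2 := eval_seventhCoeff_eq_zero (fun l => conicPoint g (t (σ l))) (σ.symm l)
        simpa using h2)
    have hr0 : r ≠ 0 := by
      rintro rfl
      obtain ⟨u, -, hu⟩ := h.exists_eval_seventhCoeff_ne_zero hσ
      rw [hr, zero_smul, cubicForm_zero, map_zero] at hu
      exact hu rfl
    have h2 := hT fun l => t (σ l)
    rw [tangentInvariant, hr, hσi, hσj] at h2
    simp only [Pi.smul_apply, smul_eq_mul, mul_left_comm _ r, ← Finset.mul_sum] at h2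
    exact (mul_eq_zero.1 h2).resolve_left hr0
  have h2 : ∀ a b,
      ∑ m, polarMonomials (conicPoint g (t a)) (conicPoint g (t b)) m * ψ m = 0 := by
    intro a b
    by_cases hab : a = b
    · subst hab
      have h3 := hψz a
      rw [eval_cubicForm] at h3
      simp only [polarMonomials_self, mul_assoc, ← Finset.mul_sum]
      rw [Finset.sum_congr rfl fun m _ => mul_comm (cubicMonomials (conicPoint g (t a)) m) (ψ m),
        h3, mul_zero]
    · exact h1 a b hab
  have h3 : ∀ a l, ∑ m, ψ m * polarMonomials (conicPoint g (t a)) (Pi.single l 1) m = 0 := by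
    intro a
    have h4 := linForm_eq_zero_of_conic h.frame_det_ne_zero (s := Finset.univ.image t)
      (d := fun l => ∑ m, ψ m * polarMonomials (conicPoint g (t a)) (Pi.single l 1) m) (by
        rw [Finset.card_image_of_injective _ ht]
        simp) fun u hu => by
        obtain ⟨b, -, rfl⟩ := Finset.mem_image.1 hu
        rw [← h2 a b]
        simp only [Finset.sum_mul]
        rw [Finset.sum_comm]
        refine Finset.sum_congr rfl fun m _ => ?_
        rw [polarMonomials_eq_sum _ (conicPoint g (t b)), Finset.sum_mul]
        exact Finset.sum_congr rfl fun l _ => by ring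
    exact congrFun h4
  have h4 : ∏ a, (Polynomial.X - Polynomial.C (t a)) ^ 2 ∣ conicRestrict g (cubicForm ψ) := by
    refine Finset.prod_dvd_of_coprime (fun a _ b _ hab => ?_) fun a _ =>
      sq_dvd_conicRestrict (hψz a) (h3 a)
    exact (Polynomial.isCoprime_X_sub_C_of_isUnit_sub
      (isUnit_iff_ne_zero.2 (sub_ne_zero.2 (ht.ne hab)))).pow
  have h5 : conicRestrict g (cubicForm ψ) ≠ 0 := by
    intro h0
    rw [← eval_conicRestrict, h0, Polynomial.eval_zero] at hs
    exact hs rfl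
  have h6 := Polynomial.natDegree_le_of_dvd h4 h5
  have h7 := natDegree_conicRestrict_le g (cubicForm_isHomogeneous ψ)
  rw [Polynomial.natDegree_prod_of_monic _ _ fun a _ => (Polynomial.monic_X_sub_C _).pow 2] at h6
  simp at h6
  omega

theorem IsConicFrame.exists_general (h : IsConicFrame A g) : ∃ t : Fin 6 → k,
    Function.Injective t ∧
      ∀ i j, i ≠ j → tangentInvariant i j (fun i => conicPoint g (t i)) ≠ 0 := by
  classical
  let T : Fin 6 × Fin 6 → MvPolynomial (Fin 6) k := fun a => if a.1 = a.2 then 1 else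
    (X a.1 - X a.2) * tangentInvariant a.1 a.2 fun i => conicPoint (g.map C) (X i)
  have hT : ∀ t i j, eval t (tangentInvariant i j fun i => conicPoint (g.map C) (X i)) =
      tangentInvariant i j fun i => conicPoint g (t i) := by
    intro t i j
    rw [map_tangentInvariant]
    congr 1
    funext i j
    simp [conicPoint, Matrix.mulVec, dotProduct, Fin.sum_univ_three]
  have h0 : ∏ a, T a ≠ 0 := by
    refine Finset.prod_ne_zero_iff.2 fun a _ => ?_
    simp only [T]
    split_ifs with ha
    · exact one_ne_zero
    · refine mul_ne_zero (sub_ne_zero.2 fun h1 => ha (X_injective h1)) fun h1 => ?_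
      obtain ⟨t, ht⟩ := h.exists_tangentInvariant_ne_zero ha
      rw [← hT, h1, map_zero] at ht
      exact ht rfl
  obtain ⟨t, ht⟩ := exists_eval_ne_zero h0
  rw [map_prod, Finset.prod_ne_zero_iff] at ht
  have h1 : ∀ i j, i ≠ j → t i ≠ t j ∧
      tangentInvariant i j (fun i => conicPoint g (t i)) ≠ 0 := by
    intro i j hij
    have h2 := ht (i, j) (Finset.mem_univ _)
    simp only [T, if_neg hij, map_mul, map_sub, eval_X, hT] at h2
    exact ⟨sub_ne_zero.1 (left_ne_zero_of_mul h2), right_ne_zero_of_mul h2⟩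
  exact ⟨t, fun i j hij => by_contra fun h2 => (h1 i j h2).1 hij, fun i j hij => (h1 i j hij).2⟩

theorem explicitPsi_irreducible : Irreducible (explicitPsi k) := by
  let A : Matrix (Fin 3) (Fin 3) k := !![0, 0, 1; 0, -2, 0; 1, 0, 0]
  have hA : A.IsSymm := by
    ext i j
    fin_cases i <;> fin_cases j <;> rfl
  have hdet : A.det ≠ 0 := by simp [A, Matrix.det_fin_three]
  obtain ⟨g, hg, hgA⟩ := exists_normalForm hA hdet
  have h : IsConicFrame A g := ⟨hA, hdet, hg, hgA⟩
  obtain ⟨t, ht, hT⟩ := h.exists_general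
  have hirr := h.irreducible_seventhCoeff ht hT
  refine irreducible_of_specializations three_ne_zero explicitPsi_isMultihomogeneous
    (fun i => ?_) fun i j hij p hp => ?_
  · let b : Fin 7 → Fin 3 → k := Fin.snoc (α := fun _ => Fin 3 → k) (fun i => conicPoint g (t i)) 0
    let s := Equiv.swap i (Fin.last 6)
    refine ⟨fun l => b (s l), ?_⟩
    have h1 : specializeAt i (fun l => b (s l)) (explicitPsi k) = dualInvariant fun l =>
        (Fin.snoc (α := fun _ => CubicIndex → MvPolynomial (Fin 3) k)
        (fun i => cubicMonomials fun j => C (conicPoint g (t i) j)) (cubicMonomials X) : Fin 7 → _)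
          (s l) := by
      rw [specializeAt, aeval_explicitPsi]
      congr 1
      funext l
      by_cases hl : l = i
      · subst hl
        simp [s, -Fin.reduceLast]
      · have h2 : s l ≠ Fin.last 6 := by
          rw [Ne, Equiv.swap_apply_eq_iff, Equiv.swap_apply_right]
          exact hl
        obtain ⟨r, hr⟩ := Fin.exists_castSucc_eq.2 h2
        simp only [hl, if_false, ← hr, b, Fin.snoc_castSucc]
    rw [h1, dualInvariant_perm]
    have hu : IsUnit (((Equiv.Perm.sign s : ℤˣ) : ℤ) : MvPolynomial (Fin 3) k) :=
      (Equiv.Perm.sign s).isUnit.map (Int.castRingHom _)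
    rw [irreducible_isUnit_mul hu]
    convert hirr using 1
    rw [← sum_mul_seventhCoeff, cubicForm]
    refine Finset.sum_congr rfl fun m _ => ?_
    rw [map_seventhCoeff, mul_comm]
  · rw [eval_explicitPsi]
    exact dualInvariant_eq_zero_of_eq _ hij (by rw [hp])

end Irreducibility

/-! ### Products of planes -/

section PlanePower

variable {k : Type*} [Field k] {n : ℕ}

/-- The tuple of the points with given nonzero coordinate vectors. -/
def PlanePower.mk (p : Fin n → Fin 3 → k) (hp : ∀ i, p i ≠ 0) : PlanePower k n :=
  fun i => Projectivization.mk k (p i) (hp i)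

theorem PlanePower.exists_coords_mk (p : Fin n → Fin 3 → k) (hp : ∀ i, p i ≠ 0) :
    ∃ r : Fin n → k, (∀ i, r i ≠ 0) ∧ (PlanePower.mk p hp).coords = fun i => r i • p i := by
  choose a ha using fun i => Projectivization.exists_smul_eq_mk_rep k (p i) (hp i)
  exact ⟨fun i => a i, fun i => (a i).ne_zero, funext fun i => (ha i).symm⟩

theorem eval_smul_ne_zero_iff {G : MvPolynomial (Fin n × Fin 3) k} {d : Fin n → ℕ}
    (hG : IsMultihomogeneous G d) {r : Fin n → k} (hr : ∀ i, r i ≠ 0) (p : Fin n → Fin 3 → k) :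
    eval (fun a : Fin n × Fin 3 => (r a.1 • p a.1) a.2) G ≠ 0 ↔
      eval (fun a : Fin n × Fin 3 => p a.1 a.2) G ≠ 0 := by
  have h := eval_multihomogeneous_smul hG r fun a => p a.1 a.2
  have h1 : ∏ i, r i ^ d i ≠ 0 := Finset.prod_ne_zero_iff.2 fun i _ => pow_ne_zero _ (hr i)
  simp only [Pi.smul_apply, smul_eq_mul]
  rw [h, mul_ne_zero_iff, and_iff_right h1]

theorem PlanePower.exists_basic_subset {U : Set (PlanePower k n)} (hU : IsOpen U)
    {Z : PlanePower k n} (hZ : Z ∈ U) : ∃ (G : MvPolynomial (Fin n × Fin 3) k) (d : Fin n → ℕ),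
      IsMultihomogeneous G d ∧ Z ∉ multiZeroLocus G ∧ (multiZeroLocus G)ᶜ ⊆ U := by
  induction hU with
  | basic s hs =>
    obtain ⟨G, d, hG, rfl⟩ := hs
    exact ⟨G, d, hG, hZ, subset_rfl⟩
  | univ =>
    exact ⟨1, 0, fun i => isWeightedHomogeneous_one _ _, by simp [multiZeroLocus],
      Set.subset_univ _⟩
  | inter s t _ _ hs ht =>
    obtain ⟨G, d, hG, h1, h2⟩ := hs hZ.1
    obtain ⟨H, e, hH, h3, h4⟩ := ht hZ.2
    refine ⟨G * H, d + e, hG.mul hH, ?_, fun Y hY => ⟨h2 ?_, h4 ?_⟩⟩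
    · simpa [multiZeroLocus] using And.intro h1 h3
    · exact fun h => hY (by simp only [multiZeroLocus, Set.mem_ofPred_eq] at h ⊢; simp [h])
    · exact fun h => hY (by simp only [multiZeroLocus, Set.mem_ofPred_eq] at h ⊢; simp [h])
  | sUnion S _ ih =>
    obtain ⟨s, hs, hZs⟩ := hZ
    obtain ⟨G, d, hG, h1, h2⟩ := ih s hs hZs
    exact ⟨G, d, hG, h1, h2.trans (Set.subset_sUnion_of_mem hs)⟩

/-- If basic open sets, where G and H do not vanish, were nonempty but disjoint on the locus, Φ
would divide G H ∏ X_{i0}, hence one factor. The product of the X_{i0} ensures that the zeros of Φ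
considered in affine space have nonzero coordinate vectors, so that they define points of (ℙ²)ⁿ. -/
theorem isIrreducible_multiZeroLocus [IsAlgClosed k] {Φ : MvPolynomial (Fin n × Fin 3) k}
    {d : Fin n → ℕ} (hΦ : Irreducible Φ) (hd : IsMultihomogeneous Φ d)
    (hX : ∀ i, ¬ Φ ∣ X (i, 0)) (hne : (multiZeroLocus Φ).Nonempty) :
    IsIrreducible (multiZeroLocus Φ) := by
  refine ⟨hne, fun U V hU hV ⟨Y, hYΦ, hYU⟩ ⟨Z, hZΦ, hZV⟩ => ?_⟩
  obtain ⟨G, e, hG, hYG, hGU⟩ := PlanePower.exists_basic_subset hU hYU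
  obtain ⟨H, f, hH, hZH, hHV⟩ := PlanePower.exists_basic_subset hV hZV
  by_contra hcon
  have h1 : Φ ∣ G * H * ∏ i, X (i, 0) := by
    refine dvd_of_forall_eval_eq_zero hΦ.prime fun p hp => ?_
    by_contra h0
    rw [map_mul, map_prod] at h0
    have h2 := fun i => Finset.prod_ne_zero_iff.1 (right_ne_zero_of_mul h0) i (Finset.mem_univ i)
    have hp0 : ∀ i, (fun j => p (i, j)) ≠ 0 := by
      intro i h3
      apply h2 i
      rw [eval_X]
      exact congrFun h3 0
    obtain ⟨r, hr, hc⟩ := PlanePower.exists_coords_mk (fun i j => p (i, j)) hp0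
    have h3 : ∀ {K : MvPolynomial (Fin n × Fin 3) k} {a : Fin n → ℕ}, IsMultihomogeneous K a →
        (PlanePower.mk (fun i j => p (i, j)) hp0 ∉ multiZeroLocus K ↔ eval p K ≠ 0) := by
      intro K a hK
      have h4 := eval_smul_ne_zero_iff hK hr fun i j => p (i, j)
      rw [multiZeroLocus, Set.mem_ofPred_eq, hc]
      exact h4
    have h4 := left_ne_zero_of_mul h0
    rw [map_mul] at h4
    refine hcon ⟨PlanePower.mk (fun i j => p (i, j)) hp0, ?_, hGU ?_, hHV ?_⟩
    · by_contra h5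
      exact (h3 hd).1 h5 hp
    · exact (h3 hG).2 (left_ne_zero_of_mul h4)
    · exact (h3 hH).2 (right_ne_zero_of_mul h4)
  have h5 : ∀ {K : MvPolynomial (Fin n × Fin 3) k} {W : PlanePower k n}, W ∈ multiZeroLocus Φ →
      W ∉ multiZeroLocus K → ¬ Φ ∣ K := by
    rintro K W hW hK ⟨r, rfl⟩
    apply hK
    simp only [multiZeroLocus, Set.mem_ofPred_eq] at hW ⊢
    rw [map_mul, hW, zero_mul]
  rcases hΦ.prime.dvd_or_dvd h1 with h6 | h6
  · rcases hΦ.prime.dvd_or_dvd h6 with h7 | h7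
    · exact h5 hYΦ hYG h7
    · exact h5 hZΦ hZH h7
  · obtain ⟨i, -, h7⟩ := (hΦ.prime.dvd_finsetProd_iff _).1 h6
    exact hX i h7

theorem multiZeroLocus_C_mul {c : k} (hc : c ≠ 0) (G : MvPolynomial (Fin n × Fin 3) k) :
    multiZeroLocus (C c * G) = multiZeroLocus G := by
  ext Z
  simp [multiZeroLocus, hc]

theorem continuous_toSym : Continuous (toSym (k := k) (n := n)) := continuous_coinduced_rng

theorem isIrreducible_hypersurfaceW [IsAlgClosed k] [CharZero k] {c : k} (hc : c ≠ 0) :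
    IsIrreducible (hypersurfaceW (C c * explicitPsi k)) := by
  rw [hypersurfaceW, multiZeroLocus_C_mul hc]
  refine (isIrreducible_multiZeroLocus explicitPsi_irreducible explicitPsi_isMultihomogeneous
    (fun i hi => ?_) ?_).image _ continuous_toSym.continuousOn
  · obtain ⟨r, hr⟩ := hi
    have h0 : (X (i, 0) : CoordRing k) ≠ 0 := X_ne_zero _
    have h1 := totalDegree_X (R := k) (i, (0 : Fin 3))
    rw [hr] at h0 h1
    rw [totalDegree_mul_of_isDomain (left_ne_zero_of_mul h0) (right_ne_zero_of_mul h0),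
      explicitPsi_isHomogeneous.totalDegree (left_ne_zero_of_mul h0)] at h1
    omega
  -- The Fano plane shows that the hypersurface is not empty.
  · have hp : ∀ i, fanoPoints k i ≠ 0 :=
      (distinctPoints_of_linearIndependent (linearIndependent_of_inlMatrix
        det_inlMatrix_fanoPoints)).1
    obtain ⟨r, hr, h1⟩ := PlanePower.exists_coords_mk (fanoPoints k) hp
    refine ⟨PlanePower.mk (fanoPoints k) hp, ?_⟩
    by_contra h2
    rw [multiZeroLocus, Set.mem_ofPred_eq, h1] at h2
    exact (eval_smul_ne_zero_iff explicitPsi_isMultihomogeneous hr _).1 h2 explicitPsi_fanoPoints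

end PlanePower

/-! ### General points on a conic -/

section GeneralOnConic

variable {k : Type*} [Field k]

theorem dualInvariant_smul {R : Type*} [CommRing R] (r : Fin 7 → R) (W : Fin 7 → CubicIndex → R) :
    dualInvariant (fun i => r i • W i) = (∏ i, r i) * dualInvariant W := by
  simp only [dualInvariant, Finset.mul_sum]
  refine Finset.sum_congr rfl fun t _ => ?_
  have h := Matrix.det_mul_column (Sum.elim r fun _ => 1 : Fin 7 ⊕ Fin 3 → R)
    (Matrix.of (Sum.elim W fun a => (Pi.single (invariantTriples t a) 1 : CubicIndex → R)))
  rw [Fintype.prod_sum_type] at h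
  simp only [Sum.elim_inl, Sum.elim_inr, Finset.prod_const_one, mul_one] at h
  rw [mul_left_comm, ← h]
  refine congrArg (_ * ·) (congrArg Matrix.det ?_)
  ext a b
  rcases a with a | a <;> simp

theorem seventhCoeff_smul {R : Type*} [CommRing R] (r : Fin 6 → R) (p : Fin 6 → Fin 3 → R) :
    seventhCoeff (fun i => r i • p i) = (∏ i, r i ^ 3) • seventhCoeff p := by
  funext m
  have h := dualInvariant_smul (Fin.snoc (α := fun _ => R) (fun i => r i ^ 3) 1)
    (Fin.snoc (α := fun _ => CubicIndex → R) (fun i => cubicMonomials (p i)) (Pi.single m 1))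
  rw [Fin.prod_univ_castSucc] at h
  simp only [Fin.snoc_castSucc, Fin.snoc_last, mul_one] at h
  rw [Pi.smul_apply, smul_eq_mul, seventhCoeff, seventhCoeff, ← h]
  congr 1
  funext i
  refine Fin.lastCases ?_ (fun i => ?_) i <;> simp [-Fin.reduceLast, cubicMonomials_smul]

theorem polarMonomials_isWeightedHomogeneous {σ : Type*} {w : σ → ℕ}
    {u v : Fin 3 → MvPolynomial σ k} {e f : ℕ} (hu : ∀ j, IsWeightedHomogeneous w (u j) e)
    (hv : ∀ j, IsWeightedHomogeneous w (v j) f) (m : CubicIndex) :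
    IsWeightedHomogeneous w (polarMonomials u v m) (e + e + f) := by
  refine IsWeightedHomogeneous.add (IsWeightedHomogeneous.add ?_ ?_) ?_
  · exact ((hu _).mul (hu _)).mul (hv _)
  · rw [add_right_comm]
    exact ((hu _).mul (hv _)).mul (hu _)
  · rw [add_comm (e + e) f, ← add_assoc]
    exact ((hv _).mul (hu _)).mul (hu _)

theorem tangentInvariant_isMultihomogeneous (i j : Fin 6) : ∃ d, IsMultihomogeneous
    (tangentInvariant i j fun i l => X (i, l) : MvPolynomial (Fin 6 × Fin 3) k) d := by
  refine ⟨fun a => ∑ l, Fin.snoc (α := fun _ => ℕ) (fun l : Fin 6 => (if l = a then 1 else 0) +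
    (if l = a then 1 else 0) + if l = a then 1 else 0) ((if i = a then 1 else 0) +
    (if i = a then 1 else 0) + if j = a then 1 else 0) l, fun a => ?_⟩
  have hX : ∀ l j, IsWeightedHomogeneous (fun b : Fin 6 × Fin 3 => if b.1 = a then 1 else 0)
      (X (l, j) : MvPolynomial (Fin 6 × Fin 3) k) (if l = a then 1 else 0) :=
    fun l j => isWeightedHomogeneous_X k _ (l, j)
  rw [tangentInvariant, sum_mul_seventhCoeff]
  refine dualInvariant_isWeightedHomogeneous fun l m => ?_
  refine Fin.lastCases ?_ (fun l => ?_) l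
  · simp only [Fin.snoc_last]
    exact polarMonomials_isWeightedHomogeneous (hX i) (hX j) m
  · simp only [Fin.snoc_castSucc]
    exact cubicMonomials_isWeightedHomogeneous (hX l) m

/-- The `r`-th coordinate of the `i`-th point with respect to the frame `g`. -/
def frameCoord (g : Matrix (Fin 3) (Fin 3) k) (r : Fin 3) (i : Fin 6) :
    MvPolynomial (Fin 6 × Fin 3) k :=
  ∑ l, C (g⁻¹ r l) * X (i, l)

theorem eval_frameCoord (g : Matrix (Fin 3) (Fin 3) k) (r : Fin 3) (i : Fin 6)
    (p : Fin 6 → Fin 3 → k) :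
    eval (fun a : Fin 6 × Fin 3 => p a.1 a.2) (frameCoord g r i) = g⁻¹.mulVec (p i) r := by
  simp [frameCoord, Matrix.mulVec, dotProduct]

theorem frameCoord_isMultihomogeneous (g : Matrix (Fin 3) (Fin 3) k) (r : Fin 3) (i : Fin 6) :
    IsMultihomogeneous (frameCoord g r i) (Pi.single i 1) := fun a =>
  Submodule.sum_mem (weightedHomogeneousSubmodule k _ _) fun l _ =>
    (isMultihomogeneous_X (i, l)).C_mul _ a

/-- The open condition on six points of a conic used for general points. -/
def sixPointLocus (g : Matrix (Fin 3) (Fin 3) k) : MvPolynomial (Fin 6 × Fin 3) k :=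
  ∏ a : Fin 6 × Fin 6, if a.1 = a.2 then frameCoord g 0 a.1 else
    (frameCoord g 0 a.1 * frameCoord g 1 a.2 - frameCoord g 0 a.2 * frameCoord g 1 a.1) *
      tangentInvariant a.1 a.2 fun i l => X (i, l)

theorem sixPointLocus_isMultihomogeneous (g : Matrix (Fin 3) (Fin 3) k) :
    ∃ d, IsMultihomogeneous (sixPointLocus g) d := by
  have h : ∀ a : Fin 6 × Fin 6, ∃ d, IsMultihomogeneous (if a.1 = a.2 then frameCoord g 0 a.1 else
      (frameCoord g 0 a.1 * frameCoord g 1 a.2 - frameCoord g 0 a.2 * frameCoord g 1 a.1) *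
        tangentInvariant a.1 a.2 fun i l => X (i, l)) d := by
    intro a
    split_ifs
    · exact ⟨_, frameCoord_isMultihomogeneous g 0 a.1⟩
    · obtain ⟨d, hd⟩ := tangentInvariant_isMultihomogeneous (k := k) a.1 a.2
      have h1 := (frameCoord_isMultihomogeneous g 0 a.1).mul (frameCoord_isMultihomogeneous g 1 a.2)
      have h2 := (frameCoord_isMultihomogeneous g 0 a.2).mul (frameCoord_isMultihomogeneous g 1 a.1)
      rw [add_comm] at h2
      exact ⟨_, IsMultihomogeneous.mul (fun i =>
        Submodule.sub_mem (weightedHomogeneousSubmodule k _ _) (h1 i) (h2 i)) hd⟩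
  choose d hd using h
  exact ⟨_, IsMultihomogeneous.prod _ fun a _ => hd a⟩

/-- For points of the conic the conditions mean: finite parameters, distinct parameters, and nonzero
derivative of the cubic at each point towards each other point. -/
theorem eval_sixPointLocus_ne_zero_iff (g : Matrix (Fin 3) (Fin 3) k) (p : Fin 6 → Fin 3 → k) :
    eval (fun a : Fin 6 × Fin 3 => p a.1 a.2) (sixPointLocus g) ≠ 0 ↔
      (∀ i, g⁻¹.mulVec (p i) 0 ≠ 0) ∧ ∀ i j, i ≠ j →
        g⁻¹.mulVec (p i) 0 * g⁻¹.mulVec (p j) 1 - g⁻¹.mulVec (p j) 0 * g⁻¹.mulVec (p i) 1 ≠ 0 ∧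
          tangentInvariant i j p ≠ 0 := by
  have hT : ∀ i j, eval (fun a : Fin 6 × Fin 3 => p a.1 a.2)
      (tangentInvariant i j fun i l => X (i, l)) = tangentInvariant i j p := by
    intro i j
    rw [map_tangentInvariant]
    simp
  rw [sixPointLocus, map_prod, Finset.prod_ne_zero_iff]
  refine ⟨fun h => ⟨fun i => ?_, fun i j hij => ?_⟩, fun h a _ => ?_⟩
  · simpa [eval_frameCoord] using h (i, i) (Finset.mem_univ _)
  · have h1 := h (i, j) (Finset.mem_univ _)
    simp only [if_neg hij, map_mul, map_sub, eval_frameCoord, hT] at h1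
    exact mul_ne_zero_iff.1 h1
  · split_ifs with ha
    · rw [eval_frameCoord]
      exact h.1 a.1
    · simp only [map_mul, map_sub, eval_frameCoord, hT]
      exact mul_ne_zero_iff.2 (h.2 _ _ ha)

variable [CharZero k] [IsAlgClosed k] {A g : Matrix (Fin 3) (Fin 3) k}

theorem IsConicFrame.mem_apolarCubicsThrough (h : IsConicFrame A g) {t : Fin 6 → k}
    (ht : Function.Injective t) {r : Fin 6 → k} (hr : ∀ i, r i ≠ 0) (D : MvPolynomial (Fin 3) k) :
    D ∈ apolarCubicsThrough A (fun i => r i • conicPoint g (t i)) ↔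
      ∃ a : k, D = C a * cubicForm (seventhCoeff fun i => conicPoint g (t i)) := by
  have hz : ∀ c i, eval (r i • conicPoint g (t i)) (cubicForm c) = 0 ↔
      eval (conicPoint g (t i)) (cubicForm c) = 0 := by
    intro c i
    rw [eval_smul_of_isHomogeneous (cubicForm_isHomogeneous c), mul_eq_zero,
      or_iff_right (pow_ne_zero 3 (hr i))]
  constructor
  · rintro ⟨hD, hv, hap⟩
    obtain ⟨c, rfl⟩ := exists_cubicForm hD
    rw [dualConicApply_cubicForm] at hap
    have hp : ∀ j, polarCoeff A.adjugate c j = 0 := by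
      intro j
      have h1 := eval_linForm (polarCoeff A.adjugate c) (Pi.single j 1)
      rw [hap, map_zero] at h1
      simpa [Pi.single_apply] using h1.symm
    obtain ⟨a, rfl⟩ := h.eq_smul_seventhCoeff ht hp fun i => (hz c i).1 (hv i)
    exact ⟨a, cubicForm_smul _ _⟩
  · rintro ⟨a, rfl⟩
    rw [← cubicForm_smul]
    refine ⟨cubicForm_isHomogeneous _, fun i => (hz _ i).2 ?_, ?_⟩
    · rw [cubicForm_smul, map_mul, eval_seventhCoeff_eq_zero (fun i => conicPoint g (t i)) i,
        mul_zero]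
    · rw [dualConicApply_cubicForm]
      have h1 : polarCoeff A.adjugate (a • seventhCoeff fun i => conicPoint g (t i)) = 0 := by
        funext j
        have h2 := h.polarCoeff_seventhCoeff (p := fun i => conicPoint g (t i))
          (fun i => h.eval_conicPoint _) j
        rw [polarCoeff_eq_sum] at h2 ⊢
        simp only [Pi.smul_apply, smul_eq_mul, mul_left_comm _ a, ← Finset.mul_sum, h2]
        simp
      rw [h1]
      simp [linForm]

theorem forGeneralSixOn {c : k} (hc : c ≠ 0) (hA : A.IsSymm) (hdet : A.det ≠ 0) :
    ForGeneralSixOn A fun Z => Irreducible (seventhPointCubic (C c * explicitPsi k) Z.coords) ∧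
      apolarCubicsThrough A Z.coords =
        (Submodule.span k {seventhPointCubic (C c * explicitPsi k) Z.coords} :
          Set (MvPolynomial (Fin 3) k)) := by
  obtain ⟨g, hg, hgA⟩ := exists_normalForm hA hdet
  have h : IsConicFrame A g := ⟨hA, hdet, hg, hgA⟩
  obtain ⟨d, hd⟩ := sixPointLocus_isMultihomogeneous g
  refine ⟨(multiZeroLocus (sixPointLocus g))ᶜ,
    TopologicalSpace.isOpen_generateFrom_of_mem ⟨_, d, hd, rfl⟩, ?_, fun Z hZ hZA => ?_⟩
  · obtain ⟨t, ht, hT⟩ := h.exists_general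
    obtain ⟨r, hr, h1⟩ := PlanePower.exists_coords_mk (fun i => conicPoint g (t i))
      fun i => conicPoint_ne_zero hg _
    refine ⟨PlanePower.mk (fun i => conicPoint g (t i)) fun i => conicPoint_ne_zero hg _, ?_, ?_⟩
    · have h2 := (eval_sixPointLocus_ne_zero_iff g fun i => conicPoint g (t i)).2
        ⟨fun i => by
          rw [inv_mulVec_conicPoint hg]
          simp, fun i j hij => ⟨by
          rw [inv_mulVec_conicPoint hg, inv_mulVec_conicPoint hg]
          simpa [sub_eq_zero] using (ht.ne hij).symm, hT i j hij⟩⟩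
      have h3 := (eval_smul_ne_zero_iff hd hr fun i => conicPoint g (t i)).2 h2
      rw [Set.mem_compl_iff, multiZeroLocus, Set.mem_ofPred_eq, h1]
      exact h3
    · intro i
      rw [h1, eval_smul_of_isHomogeneous (conicForm_isHomogeneous A), h.eval_conicPoint, mul_zero]
  · have hZ' : eval (fun a : Fin 6 × Fin 3 => Z.coords a.1 a.2) (sixPointLocus g) ≠ 0 := hZ
    have hU := (eval_sixPointLocus_ne_zero_iff g Z.coords).1 hZ'
    have hx := hU.1
    -- Homogeneous coordinates are fixed only up to scalars, so each point is `r i` times a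
    -- parametrized one. This multiplies the cubic by the nonzero constant ∏ r_i³.
    let r : Fin 6 → k := fun i => g⁻¹.mulVec (Z.coords i) 0
    let t : Fin 6 → k := fun i => g⁻¹.mulVec (Z.coords i) 1 / g⁻¹.mulVec (Z.coords i) 0
    have hco : Z.coords = fun i => r i • conicPoint g (t i) :=
      funext fun i => h.exists_eq_smul_conicPoint (hZA i) (hx i)
    have ht : Function.Injective t := by
      intro i j hij
      by_contra hne
      apply (hU.2 i j hne).1
      have h2 := (div_eq_div_iff (hx i) (hx j)).1 hij
      linear_combination -h2
    have hT : ∀ i j, i ≠ j → tangentInvariant i j (fun i => conicPoint g (t i)) ≠ 0 := by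
      rw [hco] at hZ'
      have h2 := (eval_smul_ne_zero_iff hd hx fun i => conicPoint g (t i)).1 hZ'
      have h3 := (eval_sixPointLocus_ne_zero_iff g fun i => conicPoint g (t i)).1 h2
      exact fun i j hij => (h3.2 i j hij).2
    have hirr := h.irreducible_seventhCoeff ht hT
    set e : k := c * ∏ i, r i ^ 3 with he
    have he0 : e ≠ 0 := mul_ne_zero hc (Finset.prod_ne_zero_iff.2 fun i _ => pow_ne_zero 3 (hx i))
    have hS : seventhPointCubic (C c * explicitPsi k) Z.coords =
        C e * cubicForm (seventhCoeff fun i => conicPoint g (t i)) := by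
      rw [seventhPointCubic_C_mul, seventhPointCubic_explicitPsi, hco, seventhCoeff_smul,
        cubicForm_smul, he, map_mul, mul_assoc]
    beta_reduce
    rw [hS]
    refine ⟨(irreducible_isUnit_mul ((IsUnit.mk0 e he0).map C)).2 hirr, ?_⟩
    ext D
    rw [hco, h.mem_apolarCubicsThrough ht hx, SetLike.mem_coe, Submodule.mem_span_singleton]
    constructor
    · rintro ⟨a, rfl⟩
      refine ⟨a / e, ?_⟩
      rw [smul_eq_C_mul, ← mul_assoc, ← C_mul, div_mul_cancel₀ a he0]
    · rintro ⟨a, rfl⟩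
      exact ⟨a * e, by rw [smul_eq_C_mul, ← mul_assoc, ← C_mul]⟩

end GeneralOnConic

end Morley

end

/-! ### The main theorem -/

theorem corollaryC {k : Type*} [Field k] [IsAlgClosed k] [CharZero k] :
    (∃ Ψ : Morley.CoordRing k, Morley.IsMorleyInvariant Ψ) ∧
    ∀ Ψ : Morley.CoordRing k, Morley.IsMorleyInvariant Ψ →
      Irreducible Ψ ∧
      IsIrreducible (Morley.hypersurfaceW Ψ) ∧
      ∀ A : Matrix (Fin 3) (Fin 3) k, A.IsSymm → A.det ≠ 0 →
        Morley.ForGeneralSixOn A fun Z =>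
          Irreducible (Morley.seventhPointCubic Ψ Z.coords) ∧
          Morley.apolarCubicsThrough A Z.coords =
            (Submodule.span k {Morley.seventhPointCubic Ψ Z.coords} :
              Set (MvPolynomial (Fin 3) k)) := by
  refine ⟨Morley.exists_isMorleyInvariant, fun Ψ hΨ => ?_⟩
  obtain ⟨c, hc, rfl⟩ := hΨ.eq_explicitPsi Morley.explicitPsi_irreducible
  exact ⟨(irreducible_isUnit_mul ((IsUnit.mk0 c hc).map C)).2 Morley.explicitPsi_irreducible,
    Morley.isIrreducible_hypersurfaceW hc, fun A hA hdet => Morley.forGeneralSixOn hc hA hdet⟩
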